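/- **Theorem 2.3.** Let $I=(-1,1)$, $0<\beta<1$, $\mu>0$, $T>0$, $p\in\{1,2\}$, and let $r\ge 1$, $m\ge r+1$ be real numbers. Let $u$ be a solution of the linear time-fractional subdiffusion problem $$ {}_0^C\mathcal D_t^\beta u=\mu\,\partial_x^2u+f\ \text{ in } I\times(0,T),\qquad u=0 \text{ on }\partial I\times(0,T),\qquad u(\cdot,0)=u_0 \text{ in } I,$$ where ${}_0^C\mathcal D_t^\beta u(x,t)=\frac1{\Gamma(1-\beta)}\int_0^t(t-s)^{-\beta}\partial_su(x,s)\,ds$, with $u\in C([0,T];H^m(I)\cap H_0^1(I))$, $f\in C([0,T];H^m(I))$ and $u_0\in H^m(I)$. Assume that $$u(t)=u_0+c_0t^{\sigma}+\sum_{j\ge1}c_jt^{\sigma_j},\qquad 0\le t\le T,\qquad \beta<\sigma<\sigma_1<\sigma_2<\cdots,$$ with coefficients $c_j\in H^m(I)$ (finitely or infinitely many of them non-zero), where the series and its termwise time derivatives of order up to $p+1$ converge absolutely in $H^m(I)$ on $(0,T]$, that is, with $\sigma_0=\sigma$, $\sum_{j\ge0}(1+\sigma_j)^{p+1}T^{\sigma_j}\|c_j\|_{H^m(I)}<\infty$.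 For integers $N,n_T\ge1$ let $\tau=T/n_T$, $t_k=k\tau$, $u^k=u(t_k)$, $f^k=f(t_k)$, and let $V_N^0$ be the space of polynomials of degree at most $N$ that vanish at $\pm1$. For a sequence $w^k$ put $$D_\tau^{(\beta)}w^k=\tau^{-\beta}\sum_{j=0}^k\varpi_{k-j}(w^j-w^0),\quad (1-z)^\beta=\sum_{k\ge0}\varpi_kz^k,\qquad L_1^{(\beta)}w^k=w^k,\quad L_2^{(\beta)}w^k=\bigl(1-\tfrac\beta2\bigr)w^k+\tfrac\beta2w^{k-1}.$$ Let $I_N$ be the Legendre–Gauss–Lobatto interpolation operator, i.e. polynomial interpolation of degree at most $N$ at the $N+1$ zeros of $(1-x^2)P_N'(x)$, where $P_N$ is the Legendre polynomial of degree $N$. With the inner product $(\cdot,\cdot)$ and the norm $\|\cdot\|$ of $L^2(I)$, consider the Galerkin spectral scheme: $u_N^0=I_Nu_0$, and, for $k=1,\dots,n_T$, $u_N^k\in V_N^0$ satisfies $$\bigl(D_\tau^{(\beta)}u_N^k,v\bigr)+\mu\bigl(L_p^{(\beta)}\partial_xu_N^k,\partial_xv\bigr)=\bigl(I_N(L_p^{(\beta)}f^k),v\bigr)\qquad\forall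 v\in V_N^0 .$$ Then there is a constant $C>0$, independent of $\tau$, $N$ and $k$, such that for all integers $N,n_T\ge1$ (no restriction on $\tau=T/n_T$), for every solution $(u_N^k)$ of the scheme and all $1\le k\le n_T$, $$\|u^k-u_N^k\|\le C\,(\tau^{q}+N^{-r}),\qquad q=\min\{\sigma-\beta,p\}.$$ -/

import Mathlib

open MeasureTheory Set Filter Topology Polynomial
open scoped ContDiff

noncomputable section

namespace Subdiffusion

/-! ### Sobolev spaces on the interval `I = (-1, 1)` -/

/-- Lebesgue measure on `I = (-1, 1)`. -/
def volI : Measure ℝ := volume.restrict (Ioo (-1 : ℝ) 1)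

/-- `w` is the `k`-th weak derivative of `v` on `I`, tested against `C_c^∞(I)`. -/
def IsWeakDeriv (k : ℕ) (v w : ℝ → ℝ) : Prop :=
  ∀ φ : ℝ → ℝ, ContDiff ℝ ∞ φ → HasCompactSupport φ → tsupport φ ⊆ Ioo (-1 : ℝ) 1 →
    ∫ x, v x * iteratedDeriv k φ x ∂volI = (-1 : ℝ) ^ k * ∫ x, w x * φ x ∂volI

/-- `g 0 = v`, and `g 0, …, g k` are weak derivatives of `v` of orders `0, …, k` in `L²(I)`. -/
def IsWeakDerivTower (k : ℕ) (v : ℝ → ℝ) (g : ℕ → ℝ → ℝ) : Prop :=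
  g 0 = v ∧ ∀ j ≤ k, MemLp (g j) 2 volI ∧ IsWeakDeriv j v (g j)

/-- The square of the Gagliardo (Slobodeckij) seminorm of order `θ ∈ (0, 1)` on `I`. -/
def gagliardoSq (θ : ℝ) (w : ℝ → ℝ) : ENNReal :=
  ∫⁻ x, ∫⁻ y, ENNReal.ofReal ((w x - w y) ^ 2 / |x - y| ^ (1 + 2 * θ)) ∂volI ∂volI

/-- The norm of `H^m(I)` for a real order `m ≥ 0`, with value `∞` outside `H^m(I)`:
the `L²` norms of the weak derivatives up to the order `⌊m⌋`, and, when `m` is not an integer, the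
Gagliardo seminorm of order `m - ⌊m⌋` of the last one. Weak derivatives are unique up to null
sets, so that the infimum is the common value over all towers, and `∞` when there is none. -/
def sobolevNorm (m : ℝ) (v : ℝ → ℝ) : ENNReal :=
  ⨅ (g : ℕ → ℝ → ℝ) (_ : IsWeakDerivTower ⌊m⌋₊ v g),
    ((∑ j ∈ Finset.range (⌊m⌋₊ + 1), ∫⁻ x, ENNReal.ofReal ((g j x) ^ 2) ∂volI)
      + (if Int.fract m = 0 then 0 else gagliardoSq (Int.fract m) (g ⌊m⌋₊))) ^ (1 / 2 : ℝ)

/-- `v ∈ H^m(I)`. It is used for `m > 1/2` only, where every class has exactly one representative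
that is continuous on `[-1, 1]`; the function `v` is that representative. -/
def MemSobolev (m : ℝ) (v : ℝ → ℝ) : Prop :=
  ContinuousOn v (Icc (-1 : ℝ) 1) ∧ sobolevNorm m v < ⊤

/-- `w ∈ C([0, T]; H^m(I))`; here and below a function of time and space is written `w t x`. -/
def ContinuousInSobolev (T m : ℝ) (w : ℝ → ℝ → ℝ) : Prop :=
  (∀ t ∈ Icc 0 T, MemSobolev m (w t)) ∧
    ∀ t ∈ Icc 0 T, Tendsto (fun s => sobolevNorm m (w s - w t)) (𝓝[Icc 0 T] t) (𝓝 0)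

/-- The `L²(I)` norm. -/
def normL2 (v : ℝ → ℝ) : ℝ := Real.sqrt (∫ x, v x ^ 2 ∂volI)

/-! ### The linear time-fractional subdiffusion equation -/

/-- The Caputo derivative of order `β ∈ (0, 1)` of `g` exists at `t > 0` and equals `d`:
`g` is differentiable on `(0, t)`, the integrand is integrable, and
`d = 1 / Γ(1 - β) * ∫_0^t (t - s)^(-β) g'(s) ds`. -/
def HasCaputoDerivAt (β : ℝ) (g : ℝ → ℝ) (t d : ℝ) : Prop :=
  (∀ s ∈ Ioo 0 t, DifferentiableAt ℝ g s) ∧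
    IntervalIntegrable (fun s => (t - s) ^ (-β) * deriv g s) volume 0 t ∧
    d = 1 / Real.Gamma (1 - β) * ∫ s in (0 : ℝ)..t, (t - s) ^ (-β) * deriv g s

/-- `u` solves `D_t^β u = μ ∂_x² u + f` on `I × (0, T)`, `u = 0` on `∂I × (0, T)`,
`u(·, 0) = u₀` on `I`. -/
structure IsSolution (β μ T : ℝ) (f : ℝ → ℝ → ℝ) (u₀ : ℝ → ℝ) (u : ℝ → ℝ → ℝ) : Prop where
  equation : ∀ t ∈ Ioo 0 T, ∃ uxx : ℝ → ℝ, MemLp uxx 2 volI ∧ IsWeakDeriv 2 (u t) uxx ∧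
    ∀ᵐ x ∂volI, HasCaputoDerivAt β (fun s => u s x) t (μ * uxx x + f t x)
  boundary : ∀ t ∈ Ioo 0 T, u t (-1) = 0 ∧ u t 1 = 0
  initial : ∀ x ∈ Ioo (-1 : ℝ) 1, u 0 x = u₀ x

/-- The expansion `u(t) = u₀ + c₀ t^(σ₀) + ∑_{j ≥ 1} c_j t^(σ_j)` for `0 ≤ t ≤ T`, with strictly
increasing exponents. The coefficients lie in `H^m(I)`, and the series converges on `(0, T]`,
absolutely in `H^m(I)`, together with its termwise time derivatives up to the order `l`.
(A finite expansion has `c_j = 0` from some `j` on.) -/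
structure HasTimeExpansion (T m : ℝ) (l : ℕ) (u₀ : ℝ → ℝ) (u : ℝ → ℝ → ℝ)
    (σ : ℕ → ℝ) (c : ℕ → ℝ → ℝ) : Prop where
  strictMono : StrictMono σ
  coeff : ∀ j, MemSobolev m (c j)
  converges : ∑' j, ENNReal.ofReal ((1 + σ j) ^ l * T ^ σ j) * sobolevNorm m (c j) < ⊤
  expansion : ∀ t ∈ Icc 0 T, ∀ x ∈ Icc (-1 : ℝ) 1,
    HasSum (fun j => c j x * t ^ σ j) (u t x - u₀ x)

/-! ### The fully discrete scheme -/

/-- `ϖ_k = (-1)^k (β choose k)`, the coefficients of `(1 - z)^β = ∑ ϖ_k z^k`. -/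
def cqWeight (β : ℝ) (k : ℕ) : ℝ := (-1 : ℝ) ^ k * Ring.choose β k

/-- `D_τ^(β) w^k = τ^(-β) ∑_{j=0}^k ϖ_{k-j} (w^j - w^0)`. -/
def discreteFracDeriv {E : Type*} [AddCommGroup E] [Module ℝ E] (β τ : ℝ) (w : ℕ → E) (k : ℕ) :
    E :=
  (1 / τ ^ β) • ∑ j ∈ Finset.range (k + 1), cqWeight β (k - j) • (w j - w 0)

/-- `L_p^(β) w^k`: this is `w^k` for `p = 1`, and `w^(k-β/2) = (1 - β/2) w^k + (β/2) w^(k-1)` for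
`p = 2`. It is used for `p ∈ {1, 2}` and `k ≥ 1` only. -/
def timeAverage {E : Type*} [AddCommGroup E] [Module ℝ E] (β : ℝ) (p : ℕ) (w : ℕ → E) (k : ℕ) :
    E :=
  if p = 1 then w k else (1 - β / 2) • w k + (β / 2) • w (k - 1)

/-- The Legendre polynomial of degree `N`, by Rodrigues' formula. -/
def legendre (N : ℕ) : ℝ[X] :=
  C (1 / (2 ^ N * (N.factorial : ℝ))) * derivative^[N] ((X ^ 2 - 1) ^ N)

/-- The Legendre--Gauss--Lobatto nodes: the `N + 1` zeros of `(1 - x²) P_N'(x)`, for `N ≥ 1`. -/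
def lglNodes (N : ℕ) : Finset ℝ := ((1 - X ^ 2) * derivative (legendre N)).roots.toFinset

/-- The Legendre--Gauss--Lobatto interpolation operator `I_N`. -/
def lglInterp (N : ℕ) (v : ℝ → ℝ) : ℝ[X] := Lagrange.interpolate (lglNodes N) id v

/-- The `L²(I)` inner product of two polynomials. -/
def innerL2 (a b : ℝ[X]) : ℝ := ∫ x, a.eval x * b.eval x ∂volI

/-- `V_N^0`: the polynomials of degree at most `N` that vanish at `-1` and at `1`. -/
def galerkinSpace (N : ℕ) : Set ℝ[X] :=
  {v | v.natDegree ≤ N ∧ v.eval (-1) = 0 ∧ v.eval 1 = 0}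

/-- `U^0, …, U^(n_T)` is a solution of the Galerkin spectral scheme with `L_p^(β)`, degree `N` and
time step `τ`. -/
structure IsGalerkinSolution (β μ : ℝ) (f : ℝ → ℝ → ℝ) (u₀ : ℝ → ℝ) (p N nT : ℕ) (τ : ℝ)
    (U : ℕ → ℝ[X]) : Prop where
  mem : ∀ k, 1 ≤ k → k ≤ nT → U k ∈ galerkinSpace N
  initial : U 0 = lglInterp N u₀
  equation : ∀ k, 1 ≤ k → k ≤ nT → ∀ v ∈ galerkinSpace N,
    innerL2 (discreteFracDeriv β τ U k) v
      + μ * innerL2 (timeAverage β p (fun j => derivative (U j)) k) (derivative v)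
      = innerL2 (lglInterp N (timeAverage β p (fun j => f (j * τ)) k)) v

end Subdiffusion

end

noncomputable section

namespace Subdiffusion

/-! ### The `L²(I)` norm -/

/-! The error is split by the elliptic projection Π (`ellProj`): Πu has degree at most N, keeps the
boundary values of u, and its derivative is the L² projection of u'. The part u - Πu is an
approximation error of order N^(-⌊m⌋), and ⌊m⌋ > r because m ≥ r + 1. The part e^k = Πu^k - U^k lies
in V_N^0 and solves the scheme with a residual on the right. Since Π commutes with the diffusion
term, the residual (`abs_residual_le`) has only three contributions: the projection error of D_τ u,
the quadrature error D_τ u^k - L_p ∂_t^β u^k, and the Lobatto interpolation error of L_p f.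

Stability (`galerkin_stability`) comes from testing with L_p e^k. Because ϖ_0 = 1 and all other
weights are nonpositive, twice the inner product of D_τ e^k with L_p e^k dominates the discrete
fractional derivative of the squared norm (`innerL2_sum_cqWeight_ge`). Poincaré and Young absorb the
residual into the diffusion term. The remaining scalar inequality is compared with a multiple of the
coefficients of (1 - z)^(-1-β), whose discrete fractional derivative is constant
(`le_of_sum_cqWeight_mul_le`). No growth term has to be absorbed, so the step size is unrestricted.

In time, the error is estimated on each power t^s. Such a power is a convolution of truncated powers
of order l, so its defect is the integral of a Peano kernel against a Riemann-Liouville kernel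
(`powerDefect_eq_integral`). The Peano kernel decays because the partial sums of the weights satisfy
Γ(1-β) n^β b_n = 1 - β(1-β)/(2n) + O(n^(-2)) (`exists_abs_cqSum_sub_le`); the choice θ = 1 - β/2
cancels the 1/n term and yields second order. The resulting bound C (1+s)^(p+1) max(1, k^(s-β-p))
has C independent of s (`exists_abs_powerDefect_le`), so the assumed weighted summability of the
coefficients allows summation over the expansion. The exponent σ - β is what the first term leaves
when k is small.

In space, Legendre's equation gives a spectral gap, hence the rate of the L² projection, then that
of Π by duality (`exists_ellProj_error_le`). Lobatto interpolation is controlled by its discrete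
norm, which dominates the L² norm on polynomials of degree N. The excess of the discrete norm over
the L² norm is governed by the largest weight, which is O(1/N), through the
Chebyshev-Markov-Stieltjes inequality (`LobattoRule.sum_sq_le`, `LobattoRule.weight_le`,
`exists_lglInterp_error_le`). -/

lemma integral_volI (h : ℝ → ℝ) : ∫ x, h x ∂volI = ∫ x in (-1 : ℝ)..1, h x := by
  rw [volI, intervalIntegral.integral_of_le (by norm_num), integral_Ioc_eq_integral_Ioo]

instance : IsFiniteMeasure volI := by unfold volI; infer_instance

lemma volI_real_univ : volI.real univ = 2 := by
  simp [volI, Measure.real]; norm_num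

lemma ae_volI_mem : ∀ᵐ x ∂volI, x ∈ Ioo (-1 : ℝ) 1 := ae_restrict_mem measurableSet_Ioo

lemma ae_volI_of_forall {P : ℝ → Prop} (h : ∀ x ∈ Ioo (-1 : ℝ) 1, P x) : ∀ᵐ x ∂volI, P x :=
  ae_volI_mem.mono h

lemma volI_eq_restrict_Icc : volI = volume.restrict (Icc (-1 : ℝ) 1) :=
  restrict_Ioo_eq_restrict_Icc

lemma _root_.ContinuousOn.memLp_volI {f : ℝ → ℝ} (hf : ContinuousOn f (Icc (-1) 1)) (p : ENNReal) :
    MemLp f p volI := by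
  obtain ⟨C, hC⟩ := isCompact_Icc.exists_bound_of_continuousOn hf
  refine MemLp.of_bound ?_ C ?_
  · rw [volI_eq_restrict_Icc]
    exact hf.aestronglyMeasurable measurableSet_Icc
  · exact ae_volI_of_forall fun x hx => hC x (Ioo_subset_Icc_self hx)

lemma _root_.Polynomial.continuousOn_eval (p : ℝ[X]) (s : Set ℝ) :
    ContinuousOn (fun x => p.eval x) s := p.continuous.continuousOn

lemma memLp_eval (p : ℝ[X]) (q : ENNReal) : MemLp (fun x => p.eval x) q volI :=
  (p.continuousOn_eval _).memLp_volI q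

lemma integrable_mul {f g : ℝ → ℝ} (hf : MemLp f 2 volI) (hg : MemLp g 2 volI) :
    Integrable (fun x => f x * g x) volI := hf.integrable_mul hg

lemma normL2_nonneg (v : ℝ → ℝ) : 0 ≤ normL2 v := Real.sqrt_nonneg _

lemma normL2_sq (v : ℝ → ℝ) : normL2 v ^ 2 = ∫ x, v x ^ 2 ∂volI :=
  Real.sq_sqrt (integral_nonneg fun _ => sq_nonneg _)

lemma normL2_congr {f g : ℝ → ℝ} (h : ∀ᵐ x ∂volI, f x = g x) : normL2 f = normL2 g := by
  unfold normL2
  have h2 : (fun x => f x ^ 2) =ᵐ[volI] fun x => g x ^ 2 := h.mono fun x hx => by simp only [hx]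
  rw [integral_congr_ae h2]

lemma normL2_congr_Icc {f g : ℝ → ℝ} (h : ∀ x ∈ Icc (-1 : ℝ) 1, f x = g x) :
    normL2 f = normL2 g :=
  normL2_congr (ae_volI_of_forall fun x hx => h x (Ioo_subset_Icc_self hx))

lemma abs_integral_mul_le {f g : ℝ → ℝ} (hf : MemLp f 2 volI) (hg : MemLp g 2 volI) :
    |∫ x, f x * g x ∂volI| ≤ normL2 f * normL2 g := by
  have h := integral_mul_le_Lp_mul_Lq_of_nonneg (μ := volI) (Real.HolderConjugate.two_two)
    (f := fun x => |f x|) (g := fun x => |g x|) (ae_of_all _ fun _ => abs_nonneg _)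
    (ae_of_all _ fun _ => abs_nonneg _) (by rw [ENNReal.ofReal_ofNat]; exact hf.abs)
    (by rw [ENNReal.ofReal_ofNat]; exact hg.abs)
  calc |∫ x, f x * g x ∂volI| ≤ ∫ x, |f x * g x| ∂volI := abs_integral_le_integral_abs
    _ = ∫ x, |f x| * |g x| ∂volI := by simp_rw [abs_mul]
    _ ≤ _ := h
    _ = _ := by
        unfold normL2
        simp only [Real.sqrt_eq_rpow]
        norm_num [Real.rpow_two, sq_abs]

lemma normL2_add_le {f g : ℝ → ℝ} (hf : MemLp f 2 volI) (hg : MemLp g 2 volI) :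
    normL2 (fun x => f x + g x) ≤ normL2 f + normL2 g := by
  refine abs_le_of_sq_le_sq' ?_ (add_nonneg (normL2_nonneg _) (normL2_nonneg _)) |>.2
  have h1 : ∫ x, (f x + g x) ^ 2 ∂volI
      = ∫ x, f x ^ 2 ∂volI + 2 * ∫ x, f x * g x ∂volI + ∫ x, g x ^ 2 ∂volI := by
    rw [← integral_const_mul, ← integral_add, ← integral_add]
    · congr 1; ext x; ring
    · exact hf.integrable_sq.add ((integrable_mul hf hg).const_mul 2)
    · exact hg.integrable_sq
    · exact hf.integrable_sq
    · exact (integrable_mul hf hg).const_mul 2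
  rw [normL2_sq, h1, add_sq, normL2_sq, normL2_sq]
  have := (abs_le.1 (abs_integral_mul_le hf hg)).2
  linarith

lemma normL2_const_mul (a : ℝ) (f : ℝ → ℝ) : normL2 (fun x => a * f x) = |a| * normL2 f := by
  unfold normL2
  simp_rw [mul_pow]
  rw [integral_const_mul, Real.sqrt_mul (sq_nonneg a), Real.sqrt_sq_eq_abs]

lemma normL2_neg (f : ℝ → ℝ) : normL2 (fun x => -f x) = normL2 f := by
  simp [normL2]

lemma normL2_sub_le {f g : ℝ → ℝ} (hf : MemLp f 2 volI) (hg : MemLp g 2 volI) :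
    normL2 (fun x => f x - g x) ≤ normL2 f + normL2 g := by
  rw [← normL2_neg g]
  exact (normL2_congr (ae_of_all _ fun x => sub_eq_add_neg _ _)).le.trans (normL2_add_le hf hg.neg)

lemma normL2_mono {f g : ℝ → ℝ} (hg : MemLp g 2 volI) (h : ∀ᵐ x ∂volI, |f x| ≤ |g x|) :
    normL2 f ≤ normL2 g :=
  Real.sqrt_le_sqrt (integral_mono_of_nonneg (ae_of_all _ fun _ => sq_nonneg _) hg.integrable_sq
    (h.mono fun _ hx => sq_le_sq.2 hx))

lemma normL2_const (B : ℝ) : normL2 (fun _ => B) = Real.sqrt 2 * |B| := by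
  unfold normL2
  rw [integral_const, volI_real_univ, smul_eq_mul, Real.sqrt_mul (by norm_num),
    Real.sqrt_sq_eq_abs]

lemma normL2_le_of_bound {f : ℝ → ℝ} {B : ℝ} (hB : 0 ≤ B) (h : ∀ x ∈ Ioo (-1 : ℝ) 1, |f x| ≤ B) :
    normL2 f ≤ 2 * B := by
  refine (normL2_mono (g := fun _ => B) (memLp_const _)
    (ae_volI_of_forall fun _ hx => (h _ hx).trans (le_abs_self _))).trans ?_
  rw [normL2_const, abs_of_nonneg hB]
  gcongr
  exact (Real.sqrt_le_left (by norm_num)).2 (by norm_num)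

lemma normL2_le_add_sub {f g : ℝ → ℝ} (hf : MemLp f 2 volI) (hg : MemLp g 2 volI) :
    normL2 f ≤ normL2 g + normL2 (fun x => f x - g x) := by
  refine (normL2_congr (ae_of_all _ fun x => ?_)).le.trans (normL2_add_le hg (hf.sub hg))
  simp

/-! ### Absolutely continuous functions on `[-1, 1]` with derivative in `L²` -/

/-- `w` is on `[-1, 1]` a primitive of the square integrable function `g`. -/
structure IsPrim (w g : ℝ → ℝ) : Prop where
  memLp : MemLp g 2 volI
  eq_add : ∀ x ∈ Icc (-1 : ℝ) 1, w x = w (-1) + ∫ t in (-1 : ℝ)..x, g t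

lemma _root_.MeasureTheory.MemLp.intervalIntegrable_volI {g : ℝ → ℝ} (hg : MemLp g 2 volI)
    {a b : ℝ} (ha : a ∈ Icc (-1 : ℝ) 1) (hb : b ∈ Icc (-1 : ℝ) 1) :
    IntervalIntegrable g volume a b := by
  have h : IntegrableOn g (Icc (-1 : ℝ) 1) volume := by
    have := hg.integrable (by norm_num)
    rwa [volI_eq_restrict_Icc] at this
  exact (h.mono_set (uIcc_subset_Icc ha hb)).intervalIntegrable

lemma neg_one_mem_Icc : (-1 : ℝ) ∈ Icc (-1 : ℝ) 1 := by simp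
lemma one_mem_Icc : (1 : ℝ) ∈ Icc (-1 : ℝ) 1 := by simp

lemma isPrim_of_eq {w g : ℝ → ℝ} {a : ℝ} (hg : MemLp g 2 volI)
    (h : ∀ x ∈ Icc (-1 : ℝ) 1, w x = a + ∫ t in (-1 : ℝ)..x, g t) : IsPrim w g := by
  refine ⟨hg, fun x hx => ?_⟩
  rw [h x hx, h (-1) neg_one_mem_Icc]
  simp

/-- Formulated for the explicit primitive rather than for `w`, because its derivative can be read
off almost everywhere, while `w` is unconstrained off [-1, 1]. -/
lemma IsPrim.absolutelyContinuous {w g : ℝ → ℝ} (h : IsPrim w g) :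
    AbsolutelyContinuousOnInterval (fun x => w (-1) + ∫ t in (-1 : ℝ)..x, g t) (-1) 1 := by
  have h1 := (h.memLp.intervalIntegrable_volI neg_one_mem_Icc one_mem_Icc
    ).absolutelyContinuousOnInterval_intervalIntegral (c := -1) (by simp)
  have h2 : AbsolutelyContinuousOnInterval (fun _ : ℝ => w (-1)) (-1) 1 :=
    LipschitzOnWith.absolutelyContinuousOnInterval (K := 0) (LipschitzWith.const _).lipschitzOnWith
  exact h2.add h1

lemma IsPrim.continuousOn {w g : ℝ → ℝ} (h : IsPrim w g) : ContinuousOn w (Icc (-1) 1) := by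
  have := h.absolutelyContinuous.continuousOn
  rw [uIcc_of_le (by norm_num)] at this
  exact this.congr fun x hx => h.eq_add x hx

lemma IsPrim.memLp_self {w g : ℝ → ℝ} (h : IsPrim w g) : MemLp w 2 volI :=
  h.continuousOn.memLp_volI 2

lemma IsPrim.sub_eq {w g : ℝ → ℝ} (h : IsPrim w g) {x y : ℝ} (hx : x ∈ Icc (-1 : ℝ) 1)
    (hy : y ∈ Icc (-1 : ℝ) 1) : w y - w x = ∫ t in x..y, g t := by
  rw [h.eq_add x hx, h.eq_add y hy]
  have := intervalIntegral.integral_add_adjacent_intervals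
    (h.memLp.intervalIntegrable_volI neg_one_mem_Icc hx) (h.memLp.intervalIntegrable_volI hx hy)
  linarith

/-- Both factors coincide on [-1, 1] with absolutely continuous primitives, for which the
fundamental theorem of calculus holds for products; the derivatives need only agree almost
everywhere. -/
lemma IsPrim.mul {f f' g g' : ℝ → ℝ} (hf : IsPrim f f') (hg : IsPrim g g') :
    IsPrim (fun x => f x * g x) (fun x => f' x * g x + f x * g' x) := by
  refine ⟨((hg.continuousOn.memLp_volI ⊤).mul' hf.memLp).add
    (hg.memLp.mul' (hf.continuousOn.memLp_volI ⊤)), fun y hy => ?_⟩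
  have hsub : uIcc (-1) y ⊆ uIcc (-1 : ℝ) 1 := by
    rw [uIcc_of_le hy.1, uIcc_of_le (by norm_num)]
    exact Icc_subset_Icc_right hy.2
  have key := (hf.absolutelyContinuous.mono hsub).integral_deriv_mul_eq_sub
    (hg.absolutelyContinuous.mono hsub)
  have hd : ∀ {w u : ℝ → ℝ}, IsPrim w u → ∀ᵐ x : ℝ, x ∈ uIcc (-1 : ℝ) 1 →
      deriv (fun x => w (-1) + ∫ t in (-1 : ℝ)..x, u t) x = u x := by
    intro w u h
    filter_upwards [(h.memLp.intervalIntegrable_volI neg_one_mem_Icc one_mem_Icc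
      ).ae_hasDerivAt_integral] with x hx hx'
    exact ((hx hx' (-1) (by simp)).const_add _).deriv
  have e : ∫ x in (-1 : ℝ)..y, f' x * g x + f x * g' x = f y * g y - f (-1) * g (-1) := by
    rw [hf.eq_add y hy, hg.eq_add y hy]
    refine Eq.trans (intervalIntegral.integral_congr_ae ?_) (key.trans (by simp))
    filter_upwards [hd hf, hd hg] with x hx1 hx2 hx'
    have hx3 := hsub (uIoc_subset_uIcc hx')
    rw [hx1 hx3, hx2 hx3]
    rw [uIcc_of_le (by norm_num)] at hx3
    rw [← hf.eq_add x hx3, ← hg.eq_add x hx3]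
  rw [e]
  ring

/-- Integration by parts on `I`. -/
lemma IsPrim.integral_mul_deriv {f f' g g' : ℝ → ℝ} (hf : IsPrim f f') (hg : IsPrim g g') :
    ∫ x, f x * g' x ∂volI = f 1 * g 1 - f (-1) * g (-1) - ∫ x, f' x * g x ∂volI := by
  have h := (hf.mul hg).eq_add 1 one_mem_Icc
  rw [← integral_volI, integral_add (integrable_mul hf.memLp hg.memLp_self)
    (integrable_mul hf.memLp_self hg.memLp)] at h
  linarith

lemma IsPrim.sub {f f' g g' : ℝ → ℝ} (hf : IsPrim f f') (hg : IsPrim g g') :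
    IsPrim (fun x => f x - g x) (fun x => f' x - g' x) := by
  refine ⟨hf.memLp.sub hg.memLp, fun x hx => ?_⟩
  rw [hf.eq_add x hx, hg.eq_add x hx, intervalIntegral.integral_sub
    (hf.memLp.intervalIntegrable_volI neg_one_mem_Icc hx)
    (hg.memLp.intervalIntegrable_volI neg_one_mem_Icc hx)]
  ring

lemma IsPrim.add {f f' g g' : ℝ → ℝ} (hf : IsPrim f f') (hg : IsPrim g g') :
    IsPrim (fun x => f x + g x) (fun x => f' x + g' x) := by
  refine ⟨hf.memLp.add hg.memLp, fun x hx => ?_⟩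
  rw [hf.eq_add x hx, hg.eq_add x hx, intervalIntegral.integral_add
    (hf.memLp.intervalIntegrable_volI neg_one_mem_Icc hx)
    (hg.memLp.intervalIntegrable_volI neg_one_mem_Icc hx)]
  ring

lemma IsPrim.const_mul {f f' : ℝ → ℝ} (a : ℝ) (hf : IsPrim f f') :
    IsPrim (fun x => a * f x) (fun x => a * f' x) := by
  refine ⟨hf.memLp.const_mul a, fun x hx => ?_⟩
  rw [hf.eq_add x hx, intervalIntegral.integral_const_mul]
  ring

lemma isPrim_eval (p : ℝ[X]) : IsPrim (fun x => p.eval x) (fun x => (derivative p).eval x) := by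
  refine ⟨memLp_eval _ _, fun x _ => ?_⟩
  rw [intervalIntegral.integral_eq_sub_of_hasDerivAt (fun t _ => p.hasDerivAt t)
    ((derivative p).continuous.intervalIntegrable _ _)]
  ring

lemma IsPrim.abs_sub_le {w g : ℝ → ℝ} (h : IsPrim w g) {x y : ℝ} (hx : x ∈ Icc (-1 : ℝ) 1)
    (hy : y ∈ Icc (-1 : ℝ) 1) : |w y - w x| ≤ 2 * normL2 g := by
  rw [h.sub_eq hx hy]
  have hg := h.memLp.integrable (by norm_num)
  have h1 : |∫ t in x..y, g t| ≤ ∫ t, |g t| ∂volI := by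
    rw [volI_eq_restrict_Icc]
    refine (intervalIntegral.norm_integral_le_integral_norm_uIoc (f := g)).trans ?_
    refine setIntegral_mono_set ?_ (ae_of_all _ fun t => norm_nonneg _) ?_
    · rw [volI_eq_restrict_Icc] at hg; exact hg.norm
    · exact (uIoc_subset_uIcc.trans (uIcc_subset_Icc hx hy)).eventuallyLE
  refine h1.trans ?_
  have h2 := abs_integral_mul_le h.memLp.abs (memLp_const (μ := volI) (p := 2) (1 : ℝ))
  simp only [mul_one] at h2
  have h3 : normL2 (fun x => |g x|) = normL2 g := by simp [normL2, sq_abs]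
  have h4 : normL2 (fun _ => (1 : ℝ)) ≤ 2 := by
    simpa using normL2_le_of_bound (f := fun _ => (1 : ℝ)) zero_le_one (by simp)
  calc _ ≤ _ := le_abs_self _
    _ ≤ _ := h2
    _ ≤ 2 * normL2 g := by
      change normL2 (fun x => |g x|) * _ ≤ _
      rw [h3, mul_comm]
      gcongr
      exact normL2_nonneg _

/-- Poincaré inequality with a convenient constant; one vanishing endpoint suffices. -/
lemma IsPrim.normL2_le {w g : ℝ → ℝ} (h : IsPrim w g) (h0 : w (-1) = 0) :
    normL2 w ≤ 4 * normL2 g := by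
  have := normL2_le_of_bound (f := w) (B := 2 * normL2 g) (by have := normL2_nonneg g; positivity)
    fun x hx => by
      simpa [h0] using h.abs_sub_le neg_one_mem_Icc (Ioo_subset_Icc_self hx)
  linarith

/-- The embedding of H¹ into bounded functions: the constant function with value `w x` is compared
in L² with `w`, and the oscillation of `w` is controlled by its derivative. -/
lemma IsPrim.abs_le {w g : ℝ → ℝ} (h : IsPrim w g) {x : ℝ} (hx : x ∈ Icc (-1 : ℝ) 1) :
    |w x| ≤ normL2 w + 4 * normL2 g := by
  have h1 : normL2 (fun _ => w x) ≤ normL2 w + normL2 (fun y => w x - w y) :=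
    normL2_le_add_sub (memLp_const _) h.memLp_self
  have h2 : normL2 (fun y => w x - w y) ≤ 2 * (2 * normL2 g) :=
    normL2_le_of_bound (by have := normL2_nonneg g; positivity)
      fun y hy => h.abs_sub_le (Ioo_subset_Icc_self hy) hx
  have h3 : |w x| ≤ normL2 (fun _ => w x) := by
    rw [normL2_const]
    exact le_mul_of_one_le_left (abs_nonneg _) (Real.one_le_sqrt.2 (by norm_num))
  linarith


/-! ### The `L²(I)` inner product of polynomials -/

lemma innerL2_comm (a b : ℝ[X]) : innerL2 a b = innerL2 b a := by
  simp only [innerL2, mul_comm]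

lemma integrable_eval (p : ℝ[X]) : Integrable (fun x => p.eval x) volI :=
  (memLp_eval p 1).integrable le_rfl

lemma integrable_eval_mul (a b : ℝ[X]) : Integrable (fun x => a.eval x * b.eval x) volI := by
  simpa using integrable_eval (a * b)

lemma innerL2_add_left (a b c : ℝ[X]) : innerL2 (a + b) c = innerL2 a c + innerL2 b c := by
  simp only [innerL2, eval_add, add_mul]
  exact integral_add (integrable_eval_mul a c) (integrable_eval_mul b c)

lemma innerL2_smul_left (r : ℝ) (a b : ℝ[X]) : innerL2 (r • a) b = r * innerL2 a b := by
  simp only [innerL2, eval_smul, smul_eq_mul, mul_assoc]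
  exact integral_const_mul _ _

/-- The `L²(I)` inner product as a bilinear form. -/
def innerForm : LinearMap.BilinForm ℝ ℝ[X] :=
  LinearMap.mk₂ ℝ innerL2 innerL2_add_left innerL2_smul_left
    (fun a b c => by rw [innerL2_comm, innerL2_add_left, innerL2_comm b, innerL2_comm c])
    (fun r a b => by rw [innerL2_comm, innerL2_smul_left, innerL2_comm b, smul_eq_mul])

lemma innerForm_apply (a b : ℝ[X]) : innerForm a b = innerL2 a b := rfl

lemma innerL2_add_right (a b c : ℝ[X]) : innerL2 a (b + c) = innerL2 a b + innerL2 a c :=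
  (innerForm a).map_add b c

lemma innerL2_sub_left (a b c : ℝ[X]) : innerL2 (a - b) c = innerL2 a c - innerL2 b c :=
  innerForm.map_sub₂ a b c

lemma innerL2_sub_right (a b c : ℝ[X]) : innerL2 a (b - c) = innerL2 a b - innerL2 a c :=
  (innerForm a).map_sub b c

lemma innerL2_neg_left (a b : ℝ[X]) : innerL2 (-a) b = -innerL2 a b :=
  innerForm.map_neg₂ a b

lemma innerL2_smul_right (r : ℝ) (a b : ℝ[X]) : innerL2 a (r • b) = r * innerL2 a b :=
  (innerForm a).map_smul r b

lemma innerL2_sum_left {ι : Type*} (s : Finset ι) (a : ι → ℝ[X]) (b : ℝ[X]) :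
    innerL2 (∑ i ∈ s, a i) b = ∑ i ∈ s, innerL2 (a i) b := by
  simpa only [innerForm_apply] using LinearMap.map_sum₂ innerForm s a b

lemma innerL2_sum_right {ι : Type*} (s : Finset ι) (a : ι → ℝ[X]) (b : ℝ[X]) :
    innerL2 b (∑ i ∈ s, a i) = ∑ i ∈ s, innerL2 b (a i) :=
  map_sum (innerForm b) a s

lemma innerL2_mul_left (a b c : ℝ[X]) : innerL2 (a * b) c = innerL2 a (b * c) := by
  simp only [innerL2, eval_mul, mul_assoc]

lemma innerL2_self (a : ℝ[X]) : innerL2 a a = normL2 (fun x => a.eval x) ^ 2 := by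
  rw [normL2_sq]; simp only [innerL2, sq]

lemma innerL2_derivative_right (a b : ℝ[X]) : innerL2 a (derivative b) =
    a.eval 1 * b.eval 1 - a.eval (-1) * b.eval (-1) - innerL2 (derivative a) b :=
  (isPrim_eval a).integral_mul_deriv (isPrim_eval b)

/-- A polynomial that is non-negative on `I` and not zero has a positive integral. -/
lemma integral_eval_pos {p : ℝ[X]} (hp : p ≠ 0) (h : ∀ x ∈ Ioo (-1 : ℝ) 1, 0 ≤ p.eval x) :
    0 < ∫ x, p.eval x ∂volI := by
  have h0 : ∀ᵐ x ∂volI, 0 ≤ p.eval x := ae_volI_of_forall h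
  refine lt_of_le_of_ne (integral_nonneg_of_ae h0) fun h1 => ?_
  have h2 := (integral_eq_zero_iff_of_nonneg_ae h0 (integrable_eval p)).1 h1.symm
  have h3 : ∀ᵐ x ∂volI, x ∉ (p.roots.toFinset : Set ℝ) := by
    have : volI (p.roots.toFinset : Set ℝ) = 0 := by
      refine le_antisymm ((Measure.restrict_apply_le _ _).trans ?_) zero_le
      exact (p.roots.toFinset.finite_toSet.measure_zero _).le
    exact measure_eq_zero_iff_ae_notMem.1 this
  have h4 : ∀ᵐ x ∂volI, False := by
    filter_upwards [h2, h3] with x hx hx'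
    exact hx' (by simpa [hp] using hx)
  have h5 : volI univ = 0 := by
    rw [eventually_false_iff_eq_bot, ae_eq_bot] at h4
    simp [h4]
  have := volI_real_univ
  simp [Measure.real, h5] at this

lemma innerL2_self_pos {p : ℝ[X]} (hp : p ≠ 0) : 0 < innerL2 p p := by
  have := integral_eval_pos (mul_ne_zero hp hp) fun x _ => by
    rw [eval_mul]; exact mul_self_nonneg _
  simpa [innerL2] using this

/-! ### Legendre polynomials -/

lemma natDegree_X_sq_sub_one_pow (N : ℕ) : ((X ^ 2 - 1 : ℝ[X]) ^ N).natDegree = 2 * N := by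
  have : (X ^ 2 - 1 : ℝ[X]).natDegree = 2 := by
    simpa using natDegree_X_pow_sub_C (R := ℝ) (n := 2) (r := 1)
  rw [natDegree_pow, this, mul_comm]

lemma coeff_X_sq_sub_one_pow (N : ℕ) : ((X ^ 2 - 1 : ℝ[X]) ^ N).coeff (2 * N) = 1 := by
  have : ((X ^ 2 - 1 : ℝ[X]) ^ N).Monic := by
    have : (X ^ 2 - 1 : ℝ[X]).Monic := by
      simpa using monic_X_pow_sub_C (1 : ℝ) (n := 2) (by norm_num)
    exact this.pow N
  rw [← natDegree_X_sq_sub_one_pow]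
  exact this

lemma natDegree_legendre_le (N : ℕ) : (legendre N).natDegree ≤ N := by
  unfold legendre
  refine (natDegree_C_mul_le _ _).trans ((natDegree_iterate_derivative _ _).trans ?_)
  rw [natDegree_X_sq_sub_one_pow]
  omega

lemma coeff_legendre_ne_zero (N : ℕ) : (legendre N).coeff N ≠ 0 := by
  unfold legendre
  rw [coeff_C_mul, coeff_iterate_derivative, ← two_mul, coeff_X_sq_sub_one_pow]
  have : (2 * N).descFactorial N ≠ 0 := by
    rw [Ne, Nat.descFactorial_eq_zero_iff_lt]; omega
  simp [this, Nat.factorial_ne_zero]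

lemma legendre_ne_zero (N : ℕ) : legendre N ≠ 0 := fun h => coeff_legendre_ne_zero N (by simp [h])

lemma natDegree_legendre (N : ℕ) : (legendre N).natDegree = N :=
  le_antisymm (natDegree_legendre_le N) (le_natDegree_of_ne_zero (coeff_legendre_ne_zero N))

lemma legendre_mem_degreeLT {n N : ℕ} (h : n < N) : legendre n ∈ degreeLT ℝ N := by
  rw [mem_degreeLT, degree_eq_natDegree (legendre_ne_zero n), natDegree_legendre]
  exact_mod_cast h

/-- The endpoints are zeros of order N, so the boundary terms disappear in the repeated integrations
by parts of Rodrigues' formula. -/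
lemma eval_iterate_derivative_X_sq_sub_one_pow {N i : ℕ} (hi : i < N) {a : ℝ} (ha : a ^ 2 = 1) :
    (derivative^[i] ((X ^ 2 - 1 : ℝ[X]) ^ N)).eval a = 0 := by
  refine isRoot_iterate_derivative_of_lt_rootMultiplicity (lt_of_lt_of_le hi ?_)
  rw [le_rootMultiplicity_iff (by
    intro h; have := natDegree_X_sq_sub_one_pow N; rw [h] at this; simp at this; omega)]
  refine pow_dvd_pow_of_dvd (dvd_iff_isRoot.2 ?_) N
  simp [ha]

lemma innerL2_iterate_derivative (N : ℕ) (q : ℝ[X]) : ∀ j ≤ N,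
    innerL2 q (derivative^[j] ((X ^ 2 - 1 : ℝ[X]) ^ N)) =
      (-1) ^ j * innerL2 (derivative^[j] q) ((X ^ 2 - 1 : ℝ[X]) ^ N) := by
  intro j
  induction j generalizing q with
  | zero => simp
  | succ j ih =>
    intro hj
    rw [Function.iterate_succ_apply', innerL2_derivative_right,
      eval_iterate_derivative_X_sq_sub_one_pow hj (by norm_num),
      eval_iterate_derivative_X_sq_sub_one_pow hj (by norm_num), ih _ (by omega),
      Function.iterate_succ_apply]
    ring

lemma innerL2_legendre_of_degree_lt {N : ℕ} {q : ℝ[X]} (hq : q ∈ degreeLT ℝ N) :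
    innerL2 q (legendre N) = 0 := by
  unfold legendre
  rw [← smul_eq_C_mul, innerL2_smul_right, innerL2_iterate_derivative N q N le_rfl]
  have : derivative^[N] q = 0 := by
    by_cases h0 : q = 0
    · simp [h0]
    · refine iterate_derivative_eq_zero ?_
      rw [mem_degreeLT, degree_eq_natDegree h0] at hq
      exact_mod_cast hq
  rw [this]
  simp [innerL2]

lemma innerL2_legendre_legendre {n N : ℕ} (h : n ≠ N) : innerL2 (legendre n) (legendre N) = 0 := by
  rcases lt_or_gt_of_ne h with h | h
  · exact innerL2_legendre_of_degree_lt (legendre_mem_degreeLT h)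
  · rw [innerL2_comm]; exact innerL2_legendre_of_degree_lt (legendre_mem_degreeLT h)

/-- `(1 - x²) P_N'`, the polynomial whose zeros are the Legendre--Gauss--Lobatto nodes. -/
def lobatto (N : ℕ) : ℝ[X] := (1 - X ^ 2) * derivative (legendre N)

lemma natDegree_one_sub_X_sq : (1 - X ^ 2 : ℝ[X]).natDegree = 2 := by
  rw [← natDegree_neg, neg_sub]
  simpa using natDegree_X_pow_sub_C (R := ℝ) (n := 2) (r := 1)

/-- The Sturm--Liouville operator of the Legendre polynomials is symmetric. -/
lemma innerL2_sturmLiouville (a b : ℝ[X]) :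
    innerL2 (derivative ((1 - X ^ 2) * derivative a)) b =
      -innerL2 ((1 - X ^ 2) * derivative a) (derivative b) := by
  have := innerL2_derivative_right b ((1 - X ^ 2) * derivative a)
  rw [innerL2_comm, this]
  simp [innerL2_comm]

lemma innerL2_sturmLiouville_symm (a b : ℝ[X]) :
    innerL2 (derivative ((1 - X ^ 2) * derivative a)) b =
      innerL2 a (derivative ((1 - X ^ 2) * derivative b)) := by
  rw [innerL2_sturmLiouville, innerL2_comm a, innerL2_sturmLiouville]
  simp only [innerL2, eval_mul]
  congr 2; ext x; ring

lemma derivative_one_sub_X_sq_mul_mem {N : ℕ} {q : ℝ[X]} (hq : q ∈ degreeLT ℝ N) :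
    derivative ((1 - X ^ 2) * derivative q) ∈ degreeLT ℝ N := by
  by_cases h0 : derivative ((1 - X ^ 2) * derivative q) = 0
  · rw [h0]; exact Submodule.zero_mem _
  have hq0 : derivative q ≠ 0 := by rintro h; simp [h] at h0
  have hq1 : q ≠ 0 := by rintro rfl; simp at hq0
  have hqd : q.natDegree ≠ 0 := fun h => hq0 (derivative_of_natDegree_zero h)
  rw [mem_degreeLT, degree_eq_natDegree hq1] at hq
  rw [mem_degreeLT, degree_eq_natDegree h0]
  have h1 := natDegree_derivative_le ((1 - X ^ 2) * derivative q)
  have h2 := natDegree_mul_le (p := (1 - X ^ 2 : ℝ[X])) (q := derivative q)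
  rw [natDegree_one_sub_X_sq] at h2
  have h3 := natDegree_derivative_le q
  have h4 : q.natDegree < N := by exact_mod_cast hq
  have : (derivative ((1 - X ^ 2) * derivative q)).natDegree < N := by omega
  exact_mod_cast this

lemma mem_degreeLT_of_coeff_eq_zero {N : ℕ} {q : ℝ[X]} (hq : q ∈ degreeLT ℝ (N + 1))
    (h : q.coeff N = 0) : q ∈ degreeLT ℝ N := by
  rw [mem_degreeLT, degree_lt_iff_coeff_zero] at hq ⊢
  intro m hm
  rcases hm.eq_or_lt with rfl | hm
  · exact h
  · exact hq m hm

/-- Legendre's differential equation. -/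
lemma derivative_lobatto (N : ℕ) :
    derivative (lobatto N) = -((N * (N + 1) : ℝ) • legendre N) := by
  have hL : legendre N ∈ degreeLT ℝ (N + 1) := legendre_mem_degreeLT (Nat.lt_succ_self N)
  -- The leading coefficients cancel, so d has degree below N; by symmetry of the Sturm-Liouville
  -- operator d is orthogonal to all such polynomials, hence to itself.
  set d := derivative (lobatto N) + (N * (N + 1) : ℝ) • legendre N with hd
  have h1 : d ∈ degreeLT ℝ (N + 1) :=
    Submodule.add_mem _ (derivative_one_sub_X_sq_mul_mem hL) (Submodule.smul_mem _ _ hL)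
  have h2 : d.coeff N = 0 := by
    have hc : (derivative (legendre N)).coeff (N + 1) = 0 := by
      rw [coeff_derivative, coeff_eq_zero_of_natDegree_lt (by rw [natDegree_legendre]; omega)]
      simp
    have hX : (X ^ 2 * derivative (legendre N)).coeff (N + 1) = (legendre N).coeff N * N := by
      cases N with
      | zero =>
        have : derivative (legendre 0) = 0 :=
          derivative_of_natDegree_zero (natDegree_legendre 0)
        simp [this]
      | succ n =>
        rw [show n + 1 + 1 = n + 2 from rfl, coeff_X_pow_mul, coeff_derivative]
        push_cast; ring
    rw [hd, coeff_add, coeff_derivative, lobatto, sub_mul, one_mul, coeff_sub, hc, hX, coeff_smul,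
      smul_eq_mul]
    ring
  have h3 := mem_degreeLT_of_coeff_eq_zero h1 h2
  have h4 : ∀ q ∈ degreeLT ℝ N, innerL2 d q = 0 := by
    intro q hq
    rw [hd, innerL2_add_left, innerL2_smul_left, innerL2_comm (legendre N),
      innerL2_legendre_of_degree_lt hq, lobatto, innerL2_sturmLiouville_symm, innerL2_comm,
      innerL2_legendre_of_degree_lt (derivative_one_sub_X_sq_mul_mem hq)]
    ring
  have h5 : d = 0 := by
    by_contra h
    exact (innerL2_self_pos h).ne' (h4 d h3)
  exact eq_neg_of_add_eq_zero_left h5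

lemma exists_legendre_sum (M : ℕ) : ∀ q ∈ degreeLT ℝ M,
    ∃ a : ℕ → ℝ, q = ∑ n ∈ Finset.range M, a n • legendre n := by
  induction M with
  | zero =>
    intro q hq
    refine ⟨0, ?_⟩
    rw [mem_degreeLT] at hq
    simpa using hq
  | succ M ih =>
    intro q hq
    set t := q.coeff M / (legendre M).coeff M with ht
    obtain ⟨a, ha⟩ := ih (q - t • legendre M) (mem_degreeLT_of_coeff_eq_zero
      (Submodule.sub_mem _ hq (Submodule.smul_mem _ _ (legendre_mem_degreeLT (Nat.lt_succ_self M))))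
      (by rw [coeff_sub, coeff_smul, smul_eq_mul, ht,
            div_mul_cancel₀ _ (coeff_legendre_ne_zero M), sub_self]))
    refine ⟨Function.update a M t, ?_⟩
    rw [Finset.sum_range_succ, Function.update_self, Finset.sum_congr rfl fun n hn => by
      rw [Function.update_of_ne (Finset.mem_range.1 hn).ne], ← ha]
    ring

lemma innerL2_sum_legendre (M : ℕ) (a b : ℕ → ℝ) :
    innerL2 (∑ n ∈ Finset.range M, a n • legendre n) (∑ n ∈ Finset.range M, b n • legendre n) =
      ∑ n ∈ Finset.range M, a n * b n * innerL2 (legendre n) (legendre n) := by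
  rw [innerL2_sum_left]
  refine Finset.sum_congr rfl fun n hn => ?_
  rw [innerL2_sum_right, Finset.sum_eq_single_of_mem n hn]
  · rw [innerL2_smul_left, innerL2_smul_right]; ring
  · intro m _ hm
    rw [innerL2_smul_left, innerL2_smul_right, innerL2_legendre_legendre hm.symm]; ring

/-- The spectral gap of the Legendre operator on the complement of the polynomials of degree
less than `N`. -/
lemma mul_innerL2_self_le {N : ℕ} {z : ℝ[X]} (hz : ∀ q ∈ degreeLT ℝ N, innerL2 z q = 0) :
    (N * (N + 1) : ℝ) * innerL2 z z ≤ innerL2 ((1 - X ^ 2) * derivative z) (derivative z) := by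
  obtain ⟨a, ha⟩ := exists_legendre_sum (z.natDegree + 1) z (by
    rw [mem_degreeLT]
    exact lt_of_le_of_lt degree_le_natDegree (by exact_mod_cast Nat.lt_succ_self _))
  set M := z.natDegree + 1
  -- In the Legendre basis both quadratic forms are diagonal, with quotient n(n+1); the
  -- orthogonality assumption removes every n < N.
  have hL : innerL2 ((1 - X ^ 2) * derivative z) (derivative z) =
      ∑ n ∈ Finset.range M, (n * (n + 1) * a n : ℝ) * a n * innerL2 (legendre n) (legendre n) := by
    rw [← innerL2_sum_legendre, ← ha, ← neg_eq_iff_eq_neg.2 (innerL2_sturmLiouville z z),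
      ← innerL2_neg_left]
    congr 1
    conv_lhs => rw [ha]
    rw [derivative_sum, Finset.mul_sum, derivative_sum, ← Finset.sum_neg_distrib]
    refine Finset.sum_congr rfl fun n _ => ?_
    have := derivative_lobatto n
    rw [lobatto] at this
    rw [derivative_smul, mul_smul_comm, derivative_smul, this, smul_neg, neg_neg, smul_smul]
    congr 1; ring
  have hz2 : innerL2 z z = ∑ n ∈ Finset.range M, a n * a n * innerL2 (legendre n) (legendre n) := by
    rw [← innerL2_sum_legendre, ← ha]
  rw [hL, hz2, Finset.mul_sum]
  refine Finset.sum_le_sum fun n hn => ?_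
  have hp := innerL2_self_pos (legendre_ne_zero n)
  rcases lt_or_ge n N with h | h
  · have h1 := hz _ (legendre_mem_degreeLT h)
    have h2 : innerL2 z (legendre n) = a n * innerL2 (legendre n) (legendre n) := by
      conv_lhs => rw [ha]
      rw [innerL2_sum_left, Finset.sum_eq_single_of_mem n hn, innerL2_smul_left]
      intro m _ hm
      rw [innerL2_smul_left, innerL2_legendre_legendre hm, mul_zero]
    have h3 : a n = 0 := by
      rw [h2] at h1
      exact (mul_eq_zero.1 h1).resolve_right hp.ne'
    simp [h3]
  · have h1 : (N * (N + 1) : ℝ) ≤ n * (n + 1) := by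
      have : (N : ℝ) ≤ n := by exact_mod_cast h
      gcongr
    have h2 : 0 ≤ a n * a n * innerL2 (legendre n) (legendre n) :=
      mul_nonneg (mul_self_nonneg _) hp.le
    calc _ ≤ (n * (n + 1) : ℝ) * (a n * a n * innerL2 (legendre n) (legendre n)) :=
          mul_le_mul_of_nonneg_right h1 h2
      _ = _ := by ring


/-! ### The `L²(I)` projection onto polynomials -/

/-- The `L²(I)`-orthogonal projection onto the polynomials of degree less than `N`. -/
def legendreProj (N : ℕ) (h : ℝ → ℝ) : ℝ[X] :=
  ∑ n ∈ Finset.range N, ((∫ x, h x * (legendre n).eval x ∂volI) /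
    innerL2 (legendre n) (legendre n)) • legendre n

lemma sum_legendre_mem_degreeLT (N : ℕ) (a : ℕ → ℝ) :
    ∑ n ∈ Finset.range N, a n • legendre n ∈ degreeLT ℝ N :=
  Submodule.sum_mem _ fun _ hn =>
    Submodule.smul_mem _ _ (legendre_mem_degreeLT (Finset.mem_range.1 hn))

lemma integral_mul_sum_legendre {h : ℝ → ℝ} (hh : MemLp h 2 volI) (N : ℕ) (a : ℕ → ℝ) :
    ∫ x, h x * (∑ n ∈ Finset.range N, a n • legendre n).eval x ∂volI =
      ∑ n ∈ Finset.range N, a n * ∫ x, h x * (legendre n).eval x ∂volI := by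
  simp only [eval_finsetSum, eval_smul, smul_eq_mul, Finset.mul_sum, mul_left_comm (h _)]
  rw [integral_finsetSum]
  · simp only [integral_const_mul]
  · intro n _
    exact (integrable_mul hh (memLp_eval _ 2)).const_mul _

lemma integral_sub_legendreProj_mul {h : ℝ → ℝ} (hh : MemLp h 2 volI) {N : ℕ} {q : ℝ[X]}
    (hq : q ∈ degreeLT ℝ N) : ∫ x, (h x - (legendreProj N h).eval x) * q.eval x ∂volI = 0 := by
  obtain ⟨a, rfl⟩ := exists_legendre_sum N q hq
  have h1 : ∫ x, (legendreProj N h).eval x *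
      (∑ n ∈ Finset.range N, a n • legendre n).eval x ∂volI =
      ∑ n ∈ Finset.range N, a n * ∫ x, h x * (legendre n).eval x ∂volI := by
    change innerL2 _ _ = _
    rw [legendreProj, innerL2_sum_legendre]
    refine Finset.sum_congr rfl fun n _ => ?_
    have := (innerL2_self_pos (legendre_ne_zero n)).ne'
    field_simp
  simp only [sub_mul]
  rw [integral_sub (integrable_mul hh (memLp_eval _ 2)) (integrable_eval_mul _ _), h1,
    integral_mul_sum_legendre hh, sub_self]

lemma normL2_sub_legendreProj_le {h : ℝ → ℝ} (hh : MemLp h 2 volI) {N : ℕ} {q : ℝ[X]}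
    (hq : q ∈ degreeLT ℝ N) :
    normL2 (fun x => h x - (legendreProj N h).eval x) ≤ normL2 (fun x => h x - q.eval x) := by
  refine abs_le_of_sq_le_sq' ?_ (normL2_nonneg _) |>.2
  set d := legendreProj N h - q with hd
  have hdm : d ∈ degreeLT ℝ N := Submodule.sub_mem _ (sum_legendre_mem_degreeLT N _) hq
  have h0 := integral_sub_legendreProj_mul hh hdm
  have he : MemLp (fun x => h x - (legendreProj N h).eval x) 2 volI := hh.sub (memLp_eval _ 2)
  rw [normL2_sq, normL2_sq]
  have h1 : ∫ x, (h x - q.eval x) ^ 2 ∂volI = ∫ x, (h x - (legendreProj N h).eval x) ^ 2 ∂volI +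
      2 * ∫ x, (h x - (legendreProj N h).eval x) * d.eval x ∂volI + ∫ x, d.eval x ^ 2 ∂volI := by
    rw [← integral_const_mul, ← integral_add, ← integral_add]
    · congr 1; ext x; rw [hd, eval_sub]; ring
    · exact he.integrable_sq.add ((integrable_mul he (memLp_eval _ 2)).const_mul 2)
    · exact (memLp_eval d 2).integrable_sq
    · exact he.integrable_sq
    · exact (integrable_mul he (memLp_eval _ 2)).const_mul 2
  rw [h1, h0]
  have : 0 ≤ ∫ x, d.eval x ^ 2 ∂volI := integral_nonneg fun _ => sq_nonneg _
  linarith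

lemma legendreProj_mem (N : ℕ) (h : ℝ → ℝ) : legendreProj N h ∈ degreeLT ℝ N :=
  sum_legendre_mem_degreeLT N _

lemma normL2_sub_legendreProj_le_add {h w : ℝ → ℝ} (hh : MemLp h 2 volI) (hw : MemLp w 2 volI)
    (N : ℕ) : normL2 (fun x => h x - (legendreProj N h).eval x) ≤
      normL2 (fun x => h x - w x) + normL2 (fun x => w x - (legendreProj N w).eval x) := by
  refine (normL2_sub_legendreProj_le hh (legendreProj_mem N w)).trans ?_
  refine (normL2_congr (ae_of_all _ fun x => ?_)).le.trans
    (normL2_add_le (hh.sub hw) (hw.sub (memLp_eval (legendreProj N w) 2)))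
  simp

lemma normL2_sub_legendreProj_le_self {h : ℝ → ℝ} (hh : MemLp h 2 volI) (N : ℕ) :
    normL2 (fun x => h x - (legendreProj N h).eval x) ≤ normL2 h := by
  simpa using normL2_sub_legendreProj_le hh (N := N) (q := 0) (Submodule.zero_mem _)

/-- The projection P and the error e = z - P are orthogonal also for the weighted form with weight 1
- x², because the Sturm-Liouville operator preserves the degree bound. So N² ‖e‖² is bounded through
the spectral gap by the weighted energy of e, then by that of z, and the weight is at most 1. -/
lemma mul_normL2_eval_sub_legendreProj_le (z : ℝ[X]) (N : ℕ) :
    N * normL2 (fun x => z.eval x - (legendreProj N fun x => z.eval x).eval x) ≤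
      normL2 (fun x => (derivative z).eval x) := by
  set P := legendreProj N fun x => z.eval x with hP
  have hPm : P ∈ degreeLT ℝ N := legendreProj_mem N _
  set e := z - P with he
  have horth : ∀ q ∈ degreeLT ℝ N, innerL2 e q = 0 := by
    intro q hq
    have := integral_sub_legendreProj_mul (memLp_eval z 2) hq
    simpa [innerL2, he] using this
  have h1 := mul_innerL2_self_le horth
  have h2 : innerL2 ((1 - X ^ 2) * derivative e) (derivative P) = 0 := by
    have := innerL2_sturmLiouville_symm e P
    rw [innerL2_sturmLiouville, horth _ (derivative_one_sub_X_sq_mul_mem hPm)] at this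
    linarith
  have h3 : innerL2 ((1 - X ^ 2) * derivative z) (derivative z) =
      innerL2 ((1 - X ^ 2) * derivative e) (derivative e)
        + innerL2 ((1 - X ^ 2) * derivative P) (derivative P) := by
    have hz : z = e + P := by rw [he]; ring
    have h2' : innerL2 ((1 - X ^ 2) * derivative P) (derivative e) = 0 := by
      rw [← h2, innerL2_mul_left, innerL2_mul_left, innerL2_comm, innerL2_comm _ (_ * _),
        innerL2_mul_left, innerL2_mul_left, mul_comm (derivative P)]
      simp only [innerL2, eval_mul]
      congr 1; ext x; ring
    conv_lhs => rw [hz]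
    rw [derivative_add, mul_add, innerL2_add_left, innerL2_add_right, innerL2_add_right, h2, h2']
    ring
  have hw : ∀ x ∈ Ioo (-1 : ℝ) 1, 0 ≤ 1 - x ^ 2 := fun x hx => by nlinarith [hx.1, hx.2]
  have h4 : 0 ≤ innerL2 ((1 - X ^ 2) * derivative P) (derivative P) := by
    refine integral_nonneg_of_ae (ae_volI_of_forall fun x hx => ?_)
    have := mul_nonneg (hw x hx) (sq_nonneg ((derivative P).eval x))
    simp only [eval_mul, eval_sub, eval_one, eval_pow, eval_X, Pi.zero_apply]
    linarith
  have h5 : innerL2 ((1 - X ^ 2) * derivative z) (derivative z) ≤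
      innerL2 (derivative z) (derivative z) := by
    refine integral_mono_ae (integrable_eval_mul _ _) (integrable_eval_mul _ _)
      (ae_of_all _ fun x => ?_)
    simp only [eval_mul, eval_sub, eval_one, eval_pow, eval_X]
    nlinarith [mul_nonneg (sq_nonneg x) (sq_nonneg ((derivative z).eval x))]
  have h6 : normL2 (fun x => e.eval x) = normL2 (fun x => z.eval x - P.eval x) := by
    simp only [he, eval_sub]
  rw [← h6]
  refine abs_le_of_sq_le_sq' ?_ (normL2_nonneg _) |>.2
  rw [mul_pow, ← innerL2_self, ← innerL2_self]
  have h7 : (N : ℝ) ^ 2 * innerL2 e e ≤ N * (N + 1) * innerL2 e e := by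
    refine mul_le_mul_of_nonneg_right ?_ (by rw [innerL2_self]; positivity)
    nlinarith [(Nat.cast_nonneg N : (0 : ℝ) ≤ N)]
  linarith

/-- Density of continuous functions in L² followed by Weierstrass approximation, each with error
ε/2. -/
lemma exists_polynomial_normL2_sub_le {g : ℝ → ℝ} (hg : MemLp g 2 volI) {ε : ℝ} (hε : 0 < ε) :
    ∃ q : ℝ[X], normL2 (fun x => g x - q.eval x) ≤ ε := by
  have : volI.WeaklyRegular := by unfold volI; infer_instance
  obtain ⟨φ, hφ1, hφ2⟩ := hg.exists_boundedContinuous_eLpNorm_sub_le (by norm_num)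
    (ε := ENNReal.ofReal (ε / 2)) (by simpa using hε)
  obtain ⟨q, hq⟩ := exists_polynomial_near_of_continuousOn (-1) 1 φ φ.continuous.continuousOn
    (ε / 4) (by positivity)
  refine ⟨q, ?_⟩
  have h1 : normL2 (fun x => g x - φ x) ≤ ε / 2 := by
    have h2 : normL2 (fun x => g x - φ x) = (eLpNorm (g - (φ : ℝ → ℝ)) 2 volI).toReal := by
      rw [(hg.sub hφ2).eLpNorm_eq_integral_rpow_norm (by norm_num) (by norm_num),
        ENNReal.toReal_ofReal (by positivity), normL2, Real.sqrt_eq_rpow]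
      norm_num
    rw [h2]
    exact ENNReal.toReal_le_of_le_ofReal (by positivity) hφ1
  have h2 : normL2 (fun x => φ x - q.eval x) ≤ 2 * (ε / 4) :=
    normL2_le_of_bound (by positivity) fun x hx => by
      rw [abs_sub_comm]; exact (hq x (Ioo_subset_Icc_self hx)).le
  have h3 := normL2_add_le (hg.sub hφ2) (hφ2.sub (memLp_eval q 2))
  simp only [Pi.sub_apply, sub_add_sub_cancel] at h3
  refine h3.trans ?_
  change normL2 (fun x => g x - φ x) + normL2 (fun x => φ x - q.eval x) ≤ ε
  linarith

lemma exists_polynomial_primitive (q : ℝ[X]) :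
    ∃ P : ℝ[X], derivative P = q ∧ P.eval (-1) = 0 ∧
      ∀ N, q ∈ degreeLT ℝ N → P ∈ degreeLT ℝ (N + 1) := by
  set P₀ : ℝ[X] := ∑ i ∈ Finset.range (q.natDegree + 1), C (q.coeff i / (i + 1)) * X ^ (i + 1)
    with hP₀
  refine ⟨P₀ - C (P₀.eval (-1)), ?_, by simp, fun N hN => ?_⟩
  · rw [derivative_sub, derivative_C, sub_zero, hP₀, derivative_sum]
    conv_rhs => rw [q.as_sum_range_C_mul_X_pow]
    refine Finset.sum_congr rfl fun i _ => ?_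
    rw [derivative_C_mul_X_pow]
    push_cast
    rw [div_mul_cancel₀ _ (by positivity)]
  · refine Submodule.sub_mem _ (Submodule.sum_mem _ fun i _ => ?_) ?_
    · by_cases h : q.coeff i = 0
      · simp [h]
      · rw [mem_degreeLT] at hN ⊢
        have hi : i < N := by
          by_contra hi
          exact h ((degree_lt_iff_coeff_zero q N).1 hN i (by omega))
        refine lt_of_le_of_lt (degree_C_mul_X_pow_le _ _) ?_
        exact_mod_cast Nat.succ_lt_succ hi
    · rw [mem_degreeLT]
      exact lt_of_le_of_lt degree_C_le (by exact_mod_cast Nat.succ_pos N)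

/-- The primitive of a polynomial that vanishes at `-1`. -/
def primitive (q : ℝ[X]) : ℝ[X] := (exists_polynomial_primitive q).choose

lemma derivative_primitive (q : ℝ[X]) : derivative (primitive q) = q :=
  (exists_polynomial_primitive q).choose_spec.1

lemma eval_primitive (q : ℝ[X]) : (primitive q).eval (-1) = 0 :=
  (exists_polynomial_primitive q).choose_spec.2.1

lemma primitive_mem {N : ℕ} {q : ℝ[X]} (h : q ∈ degreeLT ℝ N) :
    primitive q ∈ degreeLT ℝ (N + 1) :=
  (exists_polynomial_primitive q).choose_spec.2.2 N h

lemma C_mem_degreeLT (a : ℝ) (N : ℕ) : C a ∈ degreeLT ℝ (N + 1) := by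
  rw [mem_degreeLT]
  exact lt_of_le_of_lt degree_C_le (by exact_mod_cast Nat.succ_pos N)

/-- First order approximation by polynomials in `L²(I)`. -/
lemma IsPrim.mul_normL2_sub_legendreProj_le {w g : ℝ → ℝ} (h : IsPrim w g) (N : ℕ) :
    N * normL2 (fun x => w x - (legendreProj N w).eval x) ≤ normL2 g := by
  refine le_of_forall_pos_le_add fun δ hδ => ?_
  -- Replacing g by q changes w by at most 4ε in L² (Poincaré), which is then multiplied by N, and
  -- changes the norm of g by ε; hence the budget (4N + 1) ε = δ.
  obtain ⟨q, hq⟩ := exists_polynomial_normL2_sub_le h.memLp (ε := δ / (4 * N + 1)) (by positivity)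
  set ε := δ / (4 * N + 1)
  set Z := C (w (-1)) + primitive q with hZ
  have hZ' : derivative Z = q := by rw [hZ, derivative_add, derivative_C, zero_add,
    derivative_primitive]
  have hp := h.sub (isPrim_eval Z)
  have h1 : normL2 (fun x => w x - Z.eval x) ≤ 4 * ε := by
    refine (hp.normL2_le (by simp [hZ, eval_primitive])).trans ?_
    rw [hZ']
    linarith
  have h2 := mul_normL2_eval_sub_legendreProj_le Z N
  rw [hZ'] at h2
  have h3 : normL2 (fun x => q.eval x) ≤ normL2 g + ε := by
    have h4 := normL2_le_add_sub (memLp_eval q 2) h.memLp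
    have h5 : normL2 (fun x => q.eval x - g x) = normL2 (fun x => g x - q.eval x) := by
      rw [← normL2_neg]; simp
    linarith
  have h4 := normL2_sub_legendreProj_le_add h.memLp_self (memLp_eval Z 2) N
  have hε : ε * (4 * N + 1) = δ := div_mul_cancel₀ _ (by positivity)
  have hN : (0 : ℝ) ≤ N := Nat.cast_nonneg N
  calc _ ≤ N * (4 * ε + normL2 (fun x => Z.eval x - (legendreProj N fun x => Z.eval x).eval x)) := by
        gcongr; linarith
    _ ≤ normL2 g + δ := by linarith

/-! ### Sobolev regularity and polynomial approximation -/

/-- `h 0, …, h k` are the derivatives of orders `0, …, k` of a function in `H^k(I)`, and have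
`L²(I)` norms of at most `B`. -/
structure SobChain (k : ℕ) (h : ℕ → ℝ → ℝ) (B : ℝ) : Prop where
  prim : ∀ i < k, IsPrim (h i) (h (i + 1))
  memLp : ∀ i ≤ k, MemLp (h i) 2 volI
  bound : ∀ i ≤ k, normL2 (h i) ≤ B

lemma SobChain.nonneg {k : ℕ} {h : ℕ → ℝ → ℝ} {B : ℝ} (H : SobChain k h B) : 0 ≤ B :=
  (normL2_nonneg _).trans (H.bound 0 (Nat.zero_le _))

lemma SobChain.tail {k : ℕ} {h : ℕ → ℝ → ℝ} {B : ℝ} (H : SobChain (k + 1) h B) :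
    SobChain k (fun i => h (i + 1)) B :=
  ⟨fun i hi => H.prim (i + 1) (by omega), fun i hi => H.memLp (i + 1) (by omega),
    fun i hi => H.bound (i + 1) (by omega)⟩

/-- Induction on the order: if q approximates h' and Q is its primitive, the first-order estimate is
applied to h - Q, whose derivative is h' - q. Taking primitives raises the degree, so q must come
from N - 1; this costs the factor 2^k and makes N = 1 a separate case. -/
lemma exists_pow_mul_normL2_sub_legendreProj_le (k : ℕ) : ∃ C : ℝ, 0 ≤ C ∧
    ∀ (h : ℕ → ℝ → ℝ) (B : ℝ) (N : ℕ), SobChain k h B → 1 ≤ N →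
      (N : ℝ) ^ k * normL2 (fun x => h 0 x - (legendreProj N (h 0)).eval x) ≤ C * B := by
  induction k with
  | zero =>
    refine ⟨1, zero_le_one, fun h B N H _ => ?_⟩
    have := normL2_sub_legendreProj_le_self (H.memLp 0 le_rfl) N
    have := H.bound 0 le_rfl
    simp only [pow_zero, one_mul]
    linarith
  | succ k ih =>
    obtain ⟨C, hC, ih⟩ := ih
    refine ⟨2 ^ k * C + 1, by positivity, fun h B N H hN => ?_⟩
    have hB := H.nonneg
    rcases hN.eq_or_lt with rfl | hN
    · have := normL2_sub_legendreProj_le_self (H.memLp 0 (by omega)) 1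
      have := H.bound 0 (by omega)
      have : 0 ≤ 2 ^ k * C * B := by positivity
      simp only [Nat.cast_one, one_pow, one_mul]
      linarith
    · obtain ⟨M, rfl⟩ : ∃ M, N = M + 1 := ⟨N - 1, by omega⟩
      have hM : 1 ≤ M := by omega
      have h1 := ih _ B M H.tail hM
      simp only [zero_add] at h1
      set q := legendreProj M (h 1) with hq
      set Q := primitive q with hQ
      have hQm : Q ∈ degreeLT ℝ (M + 1) := primitive_mem (legendreProj_mem M _)
      have hp := (H.prim 0 (by omega)).sub (isPrim_eval Q)
      rw [hQ, derivative_primitive, ← hQ] at hp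
      have h2 := hp.mul_normL2_sub_legendreProj_le (M + 1)
      set W := legendreProj (M + 1) (fun x => h 0 x - Q.eval x)
      have h3 := normL2_sub_legendreProj_le (H.memLp 0 (by omega)) (N := M + 1) (q := Q + W)
        (Submodule.add_mem _ hQm (legendreProj_mem _ _))
      simp only [eval_add, ← sub_sub] at h3
      have hM2 : ((M + 1 : ℕ) : ℝ) ≤ 2 * M := by
        have : (1 : ℝ) ≤ M := by exact_mod_cast hM
        push_cast; linarith
      calc _ ≤ ((M + 1 : ℕ) : ℝ) ^ (k + 1) * normL2 (fun x => h 0 x - Q.eval x - W.eval x) := by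
            gcongr
        _ = ((M + 1 : ℕ) : ℝ) ^ k * (((M + 1 : ℕ) : ℝ) *
              normL2 (fun x => h 0 x - Q.eval x - W.eval x)) := by ring
        _ ≤ (2 * M) ^ k * normL2 (fun x => h 1 x - q.eval x) := by
            have := normL2_nonneg (fun x => h 0 x - Q.eval x - W.eval x)
            gcongr
        _ = 2 ^ k * (M ^ k * normL2 (fun x => h 1 x - q.eval x)) := by ring
        _ ≤ 2 ^ k * (C * B) := by gcongr
        _ ≤ _ := by linarith

/-- The `n`-th Legendre coefficient of the derivative of `v`, in a form that does not contain
the derivative. -/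
def derivCoeff (n : ℕ) (v : ℝ → ℝ) : ℝ :=
  (v 1 * (legendre n).eval 1 - v (-1) * (legendre n).eval (-1)
    - ∫ x, v x * (derivative (legendre n)).eval x ∂volI) / innerL2 (legendre n) (legendre n)

/-- The elliptic projection: the polynomial of degree at most `N` with the boundary values of `v`
whose derivative is the `L²(I)` projection of `v'`. -/
def ellProj (N : ℕ) (v : ℝ → ℝ) : ℝ[X] :=
  C (v (-1)) + ∑ n ∈ Finset.range N, derivCoeff n v • primitive (legendre n)

lemma derivative_ellProj (N : ℕ) (v : ℝ → ℝ) :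
    derivative (ellProj N v) = ∑ n ∈ Finset.range N, derivCoeff n v • legendre n := by
  simp [ellProj, derivative_primitive]

lemma ellProj_mem (N : ℕ) (v : ℝ → ℝ) : ellProj N v ∈ degreeLT ℝ (N + 1) :=
  Submodule.add_mem _ (C_mem_degreeLT _ _) (Submodule.sum_mem _ fun _ hn =>
    Submodule.smul_mem _ _ (primitive_mem (legendre_mem_degreeLT (Finset.mem_range.1 hn))))

lemma eval_neg_one_ellProj (N : ℕ) (v : ℝ → ℝ) : (ellProj N v).eval (-1) = v (-1) := by
  simp [ellProj, eval_finsetSum, eval_primitive]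

/-- The defining property of Π in integrated form: no derivative of v is needed, so it applies to
functions known only through the weak form of the equation. -/
lemma innerL2_derivative_ellProj {v : ℝ → ℝ} (hv : MemLp v 2 volI) {N : ℕ} {q : ℝ[X]}
    (hq : q ∈ degreeLT ℝ N) : innerL2 (derivative (ellProj N v)) q =
      v 1 * q.eval 1 - v (-1) * q.eval (-1) - ∫ x, v x * (derivative q).eval x ∂volI := by
  obtain ⟨b, rfl⟩ := exists_legendre_sum N q hq
  rw [derivative_ellProj, innerL2_sum_legendre]
  have h1 : ∫ x, v x * (derivative (∑ n ∈ Finset.range N, b n • legendre n)).eval x ∂volI =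
      ∑ n ∈ Finset.range N, b n * ∫ x, v x * (derivative (legendre n)).eval x ∂volI := by
    simp only [derivative_sum, derivative_smul, eval_finsetSum, eval_smul, smul_eq_mul,
      Finset.mul_sum, mul_left_comm (v _)]
    rw [integral_finsetSum]
    · simp only [integral_const_mul]
    · intro n _
      exact (integrable_mul hv (memLp_eval _ 2)).const_mul _
  rw [h1, eval_finsetSum, eval_finsetSum, Finset.mul_sum, Finset.mul_sum, ← Finset.sum_sub_distrib,
    ← Finset.sum_sub_distrib]
  refine Finset.sum_congr rfl fun n _ => ?_
  have := (innerL2_self_pos (legendre_ne_zero n)).ne'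
  rw [derivCoeff, div_mul_eq_mul_div, div_mul_cancel₀ _ this]
  simp only [eval_smul, smul_eq_mul]
  ring

lemma eval_one_ellProj {v : ℝ → ℝ} (hv : MemLp v 2 volI) {N : ℕ} (hN : 1 ≤ N) :
    (ellProj N v).eval 1 = v 1 := by
  obtain ⟨M, rfl⟩ : ∃ M, N = M + 1 := ⟨N - 1, by omega⟩
  -- Testing with the constant 1, admissible since N ≥ 1, says that (Πv)' has integral v(1) - v(-1).
  have h1 := innerL2_derivative_ellProj hv (C_mem_degreeLT 1 M)
  rw [innerL2_comm, innerL2_derivative_right] at h1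
  simp [innerL2, eval_neg_one_ellProj] at h1
  linarith

lemma IsPrim.derivative_ellProj {v v' : ℝ → ℝ} (h : IsPrim v v') (N : ℕ) :
    derivative (ellProj N v) = legendreProj N v' := by
  rw [Subdiffusion.derivative_ellProj, legendreProj]
  refine Finset.sum_congr rfl fun n _ => ?_
  rw [derivCoeff, h.integral_mul_deriv (isPrim_eval (legendre n))]
  congr 2; ring

/-! ### Linearity and continuity of the elliptic projection -/

lemma ellProj_add {v w : ℝ → ℝ} (hv : MemLp v 2 volI) (hw : MemLp w 2 volI) (N : ℕ) :
    ellProj N (fun x => v x + w x) = ellProj N v + ellProj N w := by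
  have : ∀ n, derivCoeff n (fun x => v x + w x) = derivCoeff n v + derivCoeff n w := fun n => by
    simp only [derivCoeff, add_mul]
    rw [integral_add (integrable_mul hv (memLp_eval _ 2)) (integrable_mul hw (memLp_eval _ 2))]
    ring
  simp only [ellProj, this, add_smul, Finset.sum_add_distrib, C_add]
  ring

lemma ellProj_const_mul (a : ℝ) (v : ℝ → ℝ) (N : ℕ) :
    ellProj N (fun x => a * v x) = a • ellProj N v := by
  have : ∀ n, derivCoeff n (fun x => a * v x) = a * derivCoeff n v := fun n => by
    simp only [derivCoeff, mul_assoc]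
    rw [integral_const_mul]
    ring
  simp only [ellProj, this, smul_add, Finset.smul_sum, mul_smul, C_mul, smul_eq_C_mul]

lemma ellProj_sub {v w : ℝ → ℝ} (hv : MemLp v 2 volI) (hw : MemLp w 2 volI) (N : ℕ) :
    ellProj N (fun x => v x - w x) = ellProj N v - ellProj N w := by
  have h := ellProj_add hv (hw.const_mul (-1)) N
  rw [ellProj_const_mul] at h
  simpa [← sub_eq_add_neg] using h

lemma ellProj_sum {ι : Type*} (s : Finset ι) (a : ι → ℝ) {v : ι → ℝ → ℝ}
    (hv : ∀ i ∈ s, MemLp (v i) 2 volI) (N : ℕ) :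
    ellProj N (fun x => ∑ i ∈ s, a i * v i x) = ∑ i ∈ s, a i • ellProj N (v i) := by
  classical
  induction s using Finset.induction_on with
  | empty => simp [ellProj, derivCoeff]
  | insert i s hi ih =>
    simp only [Finset.sum_insert hi]
    rw [ellProj_add ((hv i (by simp)).const_mul _) (memLp_finsetSum s fun j hj =>
      (hv j (by simp [hj])).const_mul _), ellProj_const_mul, ih fun j hj => hv j (by simp [hj])]

/-- Continuity for uniform convergence at fixed N. The constant depends on N, which is harmless: it
serves only to pass to the limit in a series in `exists_ellProj_series_error_le`. -/
lemma exists_normL2_ellProj_le (N : ℕ) : ∃ K : ℝ, 0 ≤ K ∧ ∀ (v : ℝ → ℝ) (ε : ℝ), 0 ≤ ε →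
    (∀ x ∈ Icc (-1 : ℝ) 1, |v x| ≤ ε) → normL2 (fun x => (ellProj N v).eval x) ≤ K * ε := by
  have key : ∀ n, ∃ K : ℝ, 0 ≤ K ∧ ∀ (v : ℝ → ℝ) (ε : ℝ), 0 ≤ ε →
      (∀ x ∈ Icc (-1 : ℝ) 1, |v x| ≤ ε) → |derivCoeff n v| ≤ K * ε := by
    intro n
    have hp := innerL2_self_pos (legendre_ne_zero n)
    refine ⟨(|(legendre n).eval 1| + |(legendre n).eval (-1)|
      + ∫ x, |(derivative (legendre n)).eval x| ∂volI) / innerL2 (legendre n) (legendre n),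
      by positivity, fun v ε hε hv => ?_⟩
    rw [derivCoeff, abs_div, abs_of_pos hp, div_mul_eq_mul_div]
    gcongr
    have h1 : |∫ x, v x * (derivative (legendre n)).eval x ∂volI| ≤
        ε * ∫ x, |(derivative (legendre n)).eval x| ∂volI := by
      rw [← integral_const_mul]
      refine (abs_integral_le_integral_abs).trans (integral_mono_of_nonneg
        (ae_of_all _ fun _ => abs_nonneg _) ((integrable_eval _).abs.const_mul _)
        (ae_volI_of_forall fun x hx => ?_))
      simp only [abs_mul]
      gcongr
      exact hv x (Ioo_subset_Icc_self hx)
    have h2 := hv 1 one_mem_Icc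
    have h3 := hv (-1) neg_one_mem_Icc
    refine (abs_sub _ _).trans ((add_le_add (abs_sub _ _) le_rfl).trans ?_)
    rw [abs_mul, abs_mul]
    have := mul_le_mul_of_nonneg_right h2 (abs_nonneg ((legendre n).eval 1))
    have := mul_le_mul_of_nonneg_right h3 (abs_nonneg ((legendre n).eval (-1)))
    linarith
  choose K hK hKb using key
  refine ⟨2 + ∑ n ∈ Finset.range N, K n * normL2 (fun x => (primitive (legendre n)).eval x),
    add_nonneg zero_le_two (Finset.sum_nonneg fun n _ => mul_nonneg (hK n) (normL2_nonneg _)),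
    fun v ε hε hv => ?_⟩
  have hs : ∀ s : Finset ℕ, normL2 (fun x => (C (v (-1)) + ∑ n ∈ s,
      derivCoeff n v • primitive (legendre n)).eval x) ≤
      2 * ε + (∑ n ∈ s, K n * normL2 (fun x => (primitive (legendre n)).eval x)) * ε := by
    intro s
    induction s using Finset.induction_on with
    | empty =>
      simp only [Finset.sum_empty, add_zero, zero_mul]
      exact normL2_le_of_bound hε fun x _ => by simpa using hv (-1) neg_one_mem_Icc
    | insert n s hn ih =>
      rw [Finset.sum_insert hn, Finset.sum_insert hn]
      have h1 := normL2_add_le (memLp_eval (C (v (-1)) + ∑ n ∈ s,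
        derivCoeff n v • primitive (legendre n)) 2)
        (memLp_eval (derivCoeff n v • primitive (legendre n)) 2)
      have h2 : normL2 (fun x => (derivCoeff n v • primitive (legendre n)).eval x) ≤
          K n * ε * normL2 (fun x => (primitive (legendre n)).eval x) := by
        simp only [eval_smul, smul_eq_mul]
        rw [normL2_const_mul]
        exact mul_le_mul_of_nonneg_right (hKb n v ε hε hv) (normL2_nonneg _)
      refine le_trans (le_of_eq ?_) (h1.trans ?_)
      · congr 1; ext x; simp only [eval_add]; ring
      · linarith
  rw [add_mul]
  exact hs _

/-- Error of the elliptic projection in `H¹` and in `L²`. -/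
lemma exists_ellProj_error_le (k : ℕ) : ∃ C : ℝ, 0 ≤ C ∧
    ∀ (h : ℕ → ℝ → ℝ) (B : ℝ) (N : ℕ), SobChain (k + 1) h B → 1 ≤ N →
      (N : ℝ) ^ k * normL2 (fun x => h 1 x - (derivative (ellProj N (h 0))).eval x) ≤ C * B ∧
      (N : ℝ) ^ (k + 1) * normL2 (fun x => h 0 x - (ellProj N (h 0)).eval x) ≤ C * B := by
  obtain ⟨C, hC, hp⟩ := exists_pow_mul_normL2_sub_legendreProj_le k
  refine ⟨C, hC, fun h B N H hN => ?_⟩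
  have H0 := H.prim 0 (by omega)
  simp only [zero_add] at H0
  have h1 := hp _ B N H.tail hN
  simp only [zero_add] at h1
  rw [H0.derivative_ellProj]
  refine ⟨h1, ?_⟩
  set E := ellProj N (h 0) with hE
  have hw := H0.sub (isPrim_eval E)
  rw [hE, H0.derivative_ellProj, ← hE] at hw
  set w := fun x => h 0 x - E.eval x with hwdef
  set w' := fun x => h 1 x - (legendreProj N (h 1)).eval x with hw'def
  have w1 : w 1 = 0 := by
    simp [hwdef, hE, eval_one_ellProj H0.memLp_self hN]
  have w2 : w (-1) = 0 := by
    simp [hwdef, hE, eval_neg_one_ellProj]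
  -- Aubin-Nitsche duality: w vanishes at both ends, so ‖w‖² = -(w', Z) for the primitive Z of w. As
  -- w' is orthogonal to degree below N, the projection of Z may be subtracted, which gains the
  -- factor 1/N.
  set Z := fun x => ∫ t in (-1 : ℝ)..x, w t with hZ
  have hZp : IsPrim Z w := isPrim_of_eq (a := 0) hw.memLp_self fun x _ => by simp [hZ]
  have e1 : normL2 w ^ 2 = -∫ x, w' x * (Z x - (legendreProj N Z).eval x) ∂volI := by
    have e2 := hw.integral_mul_deriv hZp
    rw [w1, w2] at e2
    have e3 := integral_sub_legendreProj_mul H0.memLp (legendreProj_mem N Z)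
    have e4 : ∫ x, w' x * (Z x - (legendreProj N Z).eval x) ∂volI =
        ∫ x, w' x * Z x ∂volI - ∫ x, w' x * (legendreProj N Z).eval x ∂volI := by
      simp only [mul_sub]
      exact integral_sub (integrable_mul hw.memLp hZp.memLp_self)
        (integrable_mul hw.memLp (memLp_eval _ 2))
    rw [e4, e3, normL2_sq]
    simp only [sq]
    linarith
  have e5 := abs_integral_mul_le hw.memLp (hZp.memLp_self.sub (memLp_eval (legendreProj N Z) 2))
  have e6 := hZp.mul_normL2_sub_legendreProj_le N
  have e7 : normL2 w ^ 2 ≤ normL2 w' * normL2 (fun x => Z x - (legendreProj N Z).eval x) := by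
    rw [e1]; exact (neg_le_abs _).trans e5
  have hN0 : (0 : ℝ) ≤ N := Nat.cast_nonneg N
  have e8 : (N : ℝ) * normL2 w ≤ normL2 w' := by
    rcases (normL2_nonneg w).eq_or_lt with h0 | h0
    · rw [← h0, mul_zero]; exact normL2_nonneg _
    · refine le_of_mul_le_mul_right ?_ h0
      calc N * normL2 w * normL2 w = N * normL2 w ^ 2 := by ring
        _ ≤ N * (normL2 w' * normL2 (fun x => Z x - (legendreProj N Z).eval x)) := by gcongr
        _ = normL2 w' * (N * normL2 (fun x => Z x - (legendreProj N Z).eval x)) := by ring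
        _ ≤ normL2 w' * normL2 w := by gcongr; exact normL2_nonneg _
  calc (N : ℝ) ^ (k + 1) * normL2 w = N ^ k * (N * normL2 w) := by ring
    _ ≤ N ^ k * normL2 w' := by gcongr
    _ ≤ C * B := h1


/-! ### Gauss--Lobatto quadrature -/

/-- A quadrature rule on `[-1, 1]` with positive weights `w` and nodes `S`, among them `-1` and
`1`, that integrates the polynomials of degree at most `2 N - 1` exactly, where `N + 1` is the
number of nodes. -/
structure LobattoRule (N : ℕ) (S : Finset ℝ) (w : ℝ → ℝ) : Prop where
  one_le : 1 ≤ N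
  subset : ∀ a ∈ S, a ∈ Icc (-1 : ℝ) 1
  neg_one_mem : (-1 : ℝ) ∈ S
  one_mem : (1 : ℝ) ∈ S
  card : S.card = N + 1
  pos : ∀ a ∈ S, 0 < w a
  exact : ∀ p : ℝ[X], p.natDegree ≤ 2 * N - 1 → ∑ a ∈ S, w a * p.eval a = ∫ x, p.eval x ∂volI

/-- The Peano kernel of a quadrature rule. -/
def quadKernel (S : Finset ℝ) (w : ℝ → ℝ) (x : ℝ) : ℝ :=
  x + 1 - ∑ a ∈ S, if a ≤ x then w a else 0

lemma measurable_quadKernel (S : Finset ℝ) (w : ℝ → ℝ) : Measurable (quadKernel S w) := by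
  refine (measurable_id.add_const 1).sub (Finset.measurable_fun_sum S fun a _ => ?_)
  exact Measurable.ite measurableSet_Ici measurable_const measurable_const

lemma LobattoRule.sum_weights {N : ℕ} {S : Finset ℝ} {w : ℝ → ℝ} (R : LobattoRule N S w) :
    ∑ a ∈ S, w a = 2 := by
  have := R.exact 1 (by simp)
  simpa [volI_real_univ] using this

lemma LobattoRule.abs_quadKernel_le {N : ℕ} {S : Finset ℝ} {w : ℝ → ℝ} (R : LobattoRule N S w)
    {x : ℝ} (hx : x ∈ Ioo (-1 : ℝ) 1) : |quadKernel S w x| ≤ 2 := by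
  have h0 : 0 ≤ ∑ a ∈ S, (if a ≤ x then w a else 0) :=
    Finset.sum_nonneg fun a ha => by split_ifs; exacts [(R.pos a ha).le, le_rfl]
  have h1 : ∑ a ∈ S, (if a ≤ x then w a else 0) ≤ 2 := by
    rw [← R.sum_weights]
    exact Finset.sum_le_sum fun a ha => by split_ifs; exacts [le_rfl, (R.pos a ha).le]
  rw [quadKernel, abs_le]
  constructor <;> linarith [hx.1, hx.2]

lemma LobattoRule.memLp_kernel {N : ℕ} {S : Finset ℝ} {w : ℝ → ℝ} (R : LobattoRule N S w) :
    MemLp (quadKernel S w) 2 volI :=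
  MemLp.of_bound (measurable_quadKernel S w).aestronglyMeasurable 2
    (ae_volI_of_forall fun _ hx => R.abs_quadKernel_le hx)

lemma IsPrim.integral_ite_mul {g g' : ℝ → ℝ} (hg : IsPrim g g') {a : ℝ}
    (ha : a ∈ Icc (-1 : ℝ) 1) : ∫ x, (if a ≤ x then g' x else 0) ∂volI = g 1 - g a := by
  have h1 : Integrable (fun x => if a ≤ x then g' x else 0) volI :=
    Integrable.indicator (s := Ici a) (hg.memLp.integrable (by norm_num)) measurableSet_Ici
  have h2 : MemLp (fun x => if a ≤ x then g' x else 0) 2 volI :=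
    hg.memLp.indicator (s := Ici a) measurableSet_Ici
  rw [hg.sub_eq ha one_mem_Icc, integral_volI, ← intervalIntegral.integral_add_adjacent_intervals
    (h2.intervalIntegrable_volI neg_one_mem_Icc ha) (h2.intervalIntegrable_volI ha one_mem_Icc)]
  have e1 : ∫ x in (-1 : ℝ)..a, (if a ≤ x then g' x else 0) = ∫ x in (-1 : ℝ)..a, (0 : ℝ) := by
    refine intervalIntegral.integral_congr_ae ?_
    filter_upwards [measure_eq_zero_iff_ae_notMem.1 (measure_singleton (μ := volume) a)] with x hx hx'
    rw [uIoc_of_le ha.1] at hx'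
    rw [if_neg (not_le.2 (lt_of_le_of_ne hx'.2 hx))]
  have e2 : ∫ x in a..1, (if a ≤ x then g' x else 0) = ∫ x in a..1, g' x := by
    refine intervalIntegral.integral_congr_ae (ae_of_all _ fun x hx' => ?_)
    rw [uIoc_of_le ha.2] at hx'
    rw [if_pos hx'.1.le]
  rw [e1, e2]
  simp

/-- The quadrature error as an integral against g': each g(a) is written as g(1) minus the integral
of g' over (a, 1), and the integral of g comes from integrating (x + 1) g' by parts. -/
lemma LobattoRule.sum_eq_integral_add {N : ℕ} {S : Finset ℝ} {w : ℝ → ℝ} (R : LobattoRule N S w)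
    {g g' : ℝ → ℝ} (hg : IsPrim g g') :
    ∑ a ∈ S, w a * g a = ∫ x, g x ∂volI + ∫ x, quadKernel S w x * g' x ∂volI := by
  have h1 : ∀ a ∈ S, w a * g a = w a * g 1 - ∫ x, (if a ≤ x then w a else 0) * g' x ∂volI := by
    intro a ha
    have := hg.integral_ite_mul (R.subset a ha)
    have e : ∀ x, (if a ≤ x then w a else 0) * g' x = w a * (if a ≤ x then g' x else 0) :=
      fun x => by split_ifs <;> simp
    simp only [e]
    rw [integral_const_mul, this]
    ring
  rw [Finset.sum_congr rfl h1, Finset.sum_sub_distrib, ← Finset.sum_mul, R.sum_weights]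
  have hi : ∀ a ∈ S, Integrable (fun x => (if a ≤ x then w a else 0) * g' x) volI := by
    intro a _
    refine Integrable.bdd_mul (c := |w a|) (hg.memLp.integrable (by norm_num))
      (Measurable.ite measurableSet_Ici measurable_const
        measurable_const).aestronglyMeasurable (ae_of_all _ fun x => ?_)
    split_ifs <;> simp
  rw [← integral_finsetSum _ hi]
  have h2 := (isPrim_eval (X + 1)).integral_mul_deriv hg
  simp only [eval_add, eval_X, eval_one, derivative_add, derivative_X, derivative_one, add_zero,
    one_mul] at h2
  have h3 : ∫ x, quadKernel S w x * g' x ∂volI = ∫ x, (x + 1) * g' x ∂volI -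
      ∫ x, ∑ a ∈ S, (if a ≤ x then w a else 0) * g' x ∂volI := by
    rw [← integral_sub]
    · simp only [quadKernel, sub_mul, Finset.sum_mul]
    · exact (integrable_mul (memLp_eval (X + 1) 2) hg.memLp).congr (ae_of_all _ fun x => by simp)
    · exact integrable_finsetSum _ hi
  rw [h3, h2]
  ring

/-- Exactness on the primitive of q, read through the kernel formula. -/
lemma LobattoRule.integral_kernel_mul {N : ℕ} {S : Finset ℝ} {w : ℝ → ℝ} (R : LobattoRule N S w)
    {q : ℝ[X]} (hq : q.natDegree + 1 ≤ 2 * N - 1) : ∫ x, quadKernel S w x * q.eval x ∂volI = 0 := by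
  have hd : (primitive q).natDegree ≤ 2 * N - 1 := by
    have h1 : q ∈ degreeLT ℝ (q.natDegree + 1) := by
      rw [mem_degreeLT]
      exact lt_of_le_of_lt degree_le_natDegree (by exact_mod_cast Nat.lt_succ_self _)
    have h2 := primitive_mem h1
    rw [mem_degreeLT] at h2
    have := natDegree_le_of_degree_le (n := q.natDegree + 1) (p := primitive q) (by
      exact Order.le_of_lt_succ (by exact_mod_cast h2))
    omega
  have h1 := R.sum_eq_integral_add (isPrim_eval (primitive q))
  rw [R.exact _ hd, derivative_primitive] at h1
  linarith

/-- Between consecutive nodes the kernel is affine with slope 1, so it changes sign there at most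
once, from negative to positive. -/
lemma LobattoRule.exists_sign_change {N : ℕ} {S : Finset ℝ} {w : ℝ → ℝ} (R : LobattoRule N S w)
    {a : ℝ} (ha : a ∈ S) (ha1 : a ≠ 1) : ∃ z, a ≤ z ∧
      (∀ x, a ≤ x → (∀ c ∈ S, c ≤ x → c ≤ a) → 0 ≤ quadKernel S w x * (x - z)) ∧
      (∀ c ∈ S, a < c → z ≤ c) := by
  have hne : (S.filter (a < ·)).Nonempty :=
    ⟨1, Finset.mem_filter.2 ⟨R.one_mem, lt_of_le_of_ne (R.subset a ha).2 ha1⟩⟩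
  set ν := (S.filter (a < ·)).min' hne
  have hν := Finset.mem_filter.1 (Finset.min'_mem _ hne)
  have hνle : ∀ c ∈ S, a < c → ν ≤ c := fun c hc h =>
    Finset.min'_le _ _ (Finset.mem_filter.2 ⟨hc, h⟩)
  -- The zero a - K(a) of the affine piece, clamped to the gap [a, ν] when it falls outside.
  refine ⟨max a (min (a - quadKernel S w a) ν), le_max_left _ _, fun x hx h => ?_, fun c hc h =>
    max_le h.le ((min_le_right _ _).trans (hνle c hc h))⟩
  have hK : quadKernel S w x = quadKernel S w a + (x - a) := by
    have : ∑ c ∈ S, (if c ≤ x then w c else 0) = ∑ c ∈ S, (if c ≤ a then w c else 0) :=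
      Finset.sum_congr rfl fun c hc => if_congr ⟨h c hc, fun h => h.trans hx⟩ rfl rfl
    rw [quadKernel, quadKernel, this]; ring
  have hxν : x < ν := by
    by_contra hc
    exact absurd (h ν hν.1 (not_lt.1 hc)) (not_le.2 hν.2)
  rw [hK]
  rcases le_total (a - quadKernel S w a) a with h1 | h1
  · rw [max_eq_left ((min_le_left _ _).trans h1)]
    exact mul_nonneg (by linarith) (by linarith)
  · rcases le_total (a - quadKernel S w a) ν with h2 | h2
    · rw [min_eq_left h2, max_eq_right h1]
      nlinarith [sq_nonneg (x - (a - quadKernel S w a))]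
    · rw [min_eq_right h2, max_eq_right hν.2.le]
      exact mul_nonneg_of_nonpos_of_nonpos (by linarith) (by linarith)

/-- The Chebyshev--Markov--Stieltjes inequality. -/
lemma LobattoRule.add_one_le_sum {N : ℕ} {S : Finset ℝ} {w : ℝ → ℝ} (R : LobattoRule N S w)
    {b : ℝ} (hb : b ∈ S) : b + 1 ≤ ∑ a ∈ S, if a ≤ b then w a else 0 := by
  by_contra hcon
  rw [not_le] at hcon
  -- The contrary assumption says that K is positive at the node b, hence on the whole gap to the
  -- right of b, so that K has no sign change there.
  have hK : 0 < quadKernel S w b := by rw [quadKernel]; linarith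
  have hb1 : b ≠ 1 := by
    rintro rfl
    have : ∑ a ∈ S, (if a ≤ 1 then w a else 0) = ∑ a ∈ S, w a :=
      Finset.sum_congr rfl fun a ha => if_pos (R.subset a ha).2
    rw [this, R.sum_weights] at hcon
    norm_num at hcon
  have hbm : b ≠ -1 := by
    rintro rfl
    have : 0 ≤ ∑ a ∈ S, (if a ≤ -1 then w a else 0) :=
      Finset.sum_nonneg fun a ha => by split_ifs; exacts [(R.pos a ha).le, le_rfl]
    linarith
  have hz : ∀ a, ∃ z, a ∈ S → a ≠ 1 → a ≤ z ∧
      (∀ x, a ≤ x → (∀ c ∈ S, c ≤ x → c ≤ a) → 0 ≤ quadKernel S w x * (x - z)) ∧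
      (∀ c ∈ S, a < c → z ≤ c) := by
    intro a
    by_cases h : a ∈ S ∧ a ≠ 1
    · obtain ⟨z, hz⟩ := R.exists_sign_change h.1 h.2
      exact ⟨z, fun _ _ => hz⟩
    · exact ⟨0, fun h1 h2 => absurd ⟨h1, h2⟩ h⟩
  choose z hz using hz
  set S' := ((S.erase 1).erase (-1)).erase b with hS'
  have hm1 : (-1 : ℝ) ∈ S.erase 1 := Finset.mem_erase.2 ⟨by norm_num, R.neg_one_mem⟩
  have hbm1 : b ∈ (S.erase 1).erase (-1) := by simp [hb, hb1, hbm]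
  have hcard : S'.card + 3 = N + 1 := by
    rw [← R.card, ← Finset.card_erase_add_one R.one_mem, ← Finset.card_erase_add_one hm1,
      ← Finset.card_erase_add_one hbm1]
  have hS'mem : ∀ a ∈ S', a ∈ S ∧ a ≠ 1 ∧ a ≠ -1 ∧ a ≠ b := fun a ha => by
    simp only [hS', Finset.mem_erase] at ha; tauto
  -- The polynomial p records all possible sign changes of K: the zero in the first gap, and for
  -- each interior node other than b the node itself and the zero in the gap after it. Its degree 1
  -- + 2(N - 2) is low enough for p to be orthogonal to K, while K p ≥ 0; so K p vanishes almost
  -- everywhere, which is impossible to the right of b.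
  set p : ℝ[X] := (X - C (z (-1))) * ∏ a ∈ S', ((X - C a) * (X - C (z a))) with hp
  have hpm : p.Monic := (monic_X_sub_C _).mul
    (monic_prod_of_monic _ _ fun a _ => (monic_X_sub_C _).mul (monic_X_sub_C _))
  have hpd : p.natDegree = 1 + 2 * S'.card := by
    rw [hp, (monic_X_sub_C _).natDegree_mul
      (monic_prod_of_monic _ _ fun a _ => (monic_X_sub_C _).mul (monic_X_sub_C _)),
      natDegree_X_sub_C, natDegree_prod_of_monic _ _
        fun a _ => (monic_X_sub_C _).mul (monic_X_sub_C _)]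
    simp [(monic_X_sub_C _).natDegree_mul (monic_X_sub_C _), mul_comm]
  have hint := R.integral_kernel_mul (q := p) (by omega)
  have hpe : ∀ x, p.eval x = (x - z (-1)) * ∏ a ∈ S', ((x - a) * (x - z a)) := fun x => by
    simp [hp, eval_prod]
  have hlast : ∀ x ∈ Ioo (-1 : ℝ) 1, ∃ a₀ ∈ S, a₀ ≤ x ∧ ∀ c ∈ S, c ≤ x → c ≤ a₀ := by
    intro x hx
    have hne : (S.filter (· ≤ x)).Nonempty :=
      ⟨-1, Finset.mem_filter.2 ⟨R.neg_one_mem, hx.1.le⟩⟩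
    have h1 := Finset.mem_filter.1 (Finset.max'_mem _ hne)
    exact ⟨_, h1.1, h1.2, fun c hc h => Finset.le_max' _ _ (Finset.mem_filter.2 ⟨hc, h⟩)⟩
  have hfac : ∀ x ∈ Ioo (-1 : ℝ) 1, ∀ a₀ ∈ S, a₀ ≤ x → (∀ c ∈ S, c ≤ x → c ≤ a₀) →
      ∀ a ∈ S', a ≠ a₀ → 0 ≤ (x - a) * (x - z a) := by
    intro x hx a₀ ha₀ hax hmax a ha hne
    obtain ⟨h1, h2, -, -⟩ := hS'mem a ha
    obtain ⟨z1, -, z3⟩ := hz a h1 h2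
    rcases lt_or_ge x a with h | h
    · exact mul_nonneg_of_nonpos_of_nonpos (by linarith) (by linarith)
    · have := z3 a₀ ha₀ (lt_of_le_of_ne (hmax a h1 h) hne)
      exact mul_nonneg (by linarith) (by linarith)
  have hfirst : ∀ x ∈ Ioo (-1 : ℝ) 1, ∀ a₀ ∈ S, a₀ ≤ x → a₀ ≠ -1 → 0 ≤ x - z (-1) := by
    intro x hx a₀ ha₀ hax hne
    obtain ⟨-, -, z3⟩ := hz (-1) R.neg_one_mem (by norm_num)
    have := z3 a₀ ha₀ (lt_of_le_of_ne (R.subset a₀ ha₀).1 hne.symm)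
    linarith
  have hKb : ∀ x, b ≤ x → (∀ c ∈ S, c ≤ x → c ≤ b) → 0 < quadKernel S w x := by
    intro x hx h
    have : ∑ c ∈ S, (if c ≤ x then w c else 0) = ∑ c ∈ S, (if c ≤ b then w c else 0) :=
      Finset.sum_congr rfl fun c hc => if_congr ⟨h c hc, fun h => h.trans hx⟩ rfl rfl
    rw [quadKernel, this]; rw [quadKernel] at hK; linarith
  have hsign : ∀ x ∈ Ioo (-1 : ℝ) 1, 0 ≤ quadKernel S w x * p.eval x := by
    intro x hx
    obtain ⟨a₀, ha₀, hax, hmax⟩ := hlast x hx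
    have ha₀1 : a₀ ≠ 1 := fun h => by linarith [hx.2]
    obtain ⟨-, z2, -⟩ := hz a₀ ha₀ ha₀1
    have z2 := z2 x hax hmax
    rw [hpe]
    by_cases hm : a₀ = -1
    · subst hm
      rw [← mul_assoc]
      exact mul_nonneg z2 (Finset.prod_nonneg fun a ha =>
        hfac x hx _ ha₀ hax hmax a ha (hS'mem a ha).2.2.1)
    · have hf := hfirst x hx a₀ ha₀ hax hm
      by_cases hb0 : a₀ = b
      · subst hb0
        exact mul_nonneg (hKb x hax hmax).le (mul_nonneg hf (Finset.prod_nonneg fun a ha =>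
          hfac x hx _ ha₀ hax hmax a ha (hS'mem a ha).2.2.2))
      · have hmem : a₀ ∈ S' := by simp [hS', ha₀, ha₀1, hm, hb0]
        rw [← Finset.mul_prod_erase _ _ hmem]
        have h3 : 0 ≤ ∏ a ∈ S'.erase a₀, ((x - a) * (x - z a)) :=
          Finset.prod_nonneg fun a ha => hfac x hx _ ha₀ hax hmax a (Finset.mem_of_mem_erase ha)
            (Finset.ne_of_mem_erase ha)
        have h4 : 0 ≤ x - a₀ := by linarith
        have : quadKernel S w x * ((x - z (-1)) * (((x - a₀) * (x - z a₀)) *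
            ∏ a ∈ S'.erase a₀, ((x - a) * (x - z a)))) = (x - z (-1)) * (x - a₀) *
            (quadKernel S w x * (x - z a₀)) * ∏ a ∈ S'.erase a₀, ((x - a) * (x - z a)) := by ring
        rw [this]
        positivity
  have hzero := (integral_eq_zero_iff_of_nonneg_ae (ae_volI_of_forall hsign)
    (integrable_mul R.memLp_kernel (memLp_eval p 2))).1 hint
  -- the kernel is positive to the right of `b`
  have hne : (S.filter (b < ·)).Nonempty :=
    ⟨1, Finset.mem_filter.2 ⟨R.one_mem, lt_of_le_of_ne (R.subset b hb).2 hb1⟩⟩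
  set ν := (S.filter (b < ·)).min' hne
  have hν := Finset.mem_filter.1 (Finset.min'_mem _ hne)
  have hνle : ∀ c ∈ S, b < c → ν ≤ c := fun c hc h =>
    Finset.min'_le _ _ (Finset.mem_filter.2 ⟨hc, h⟩)
  have hbI := R.subset b hb
  have hνI := R.subset ν hν.1
  have hsubset : Ioo b ν ⊆ Ioo (-1 : ℝ) 1 := Ioo_subset_Ioo hbI.1 hνI.2
  have h5 : ∀ᵐ x ∂(volume.restrict (Ioo b ν)), p.eval x = 0 := by
    have h6 := ae_restrict_of_ae_restrict_of_subset hsubset hzero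
    filter_upwards [h6, ae_restrict_mem measurableSet_Ioo] with x hx hx'
    refine (mul_eq_zero.1 hx).resolve_left (hKb x hx'.1.le fun c hc hcx => ?_).ne'
    by_contra hcb
    linarith [hνle c hc (not_le.1 hcb), hx'.2]
  have h6 : volume (Ioo b ν) ≤ volume (p.roots.toFinset : Set ℝ) := by
    rw [ae_restrict_iff' measurableSet_Ioo] at h5
    refine measure_mono_ae (h5.mono fun x hx hx' => ?_)
    have : x ∈ p.roots.toFinset := by simpa [hpm.ne_zero] using hx hx'
    exact this
  rw [p.roots.toFinset.finite_toSet.measure_zero, Real.volume_Ioo] at h6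
  have hbν : b < ν := hν.2
  simp at h6
  linarith

/-- The reflected rule turns the lower bound for partial sums of weights from the left into one for
sums from the right. -/
lemma LobattoRule.reflect {N : ℕ} {S : Finset ℝ} {w : ℝ → ℝ} (R : LobattoRule N S w) :
    LobattoRule N (S.image (fun a => -a)) (fun a => w (-a)) := by
  have hinj : Set.InjOn (fun a : ℝ => -a) S := fun a _ b _ h => neg_injective h
  refine ⟨R.one_le, fun a ha => ?_, ?_, ?_, ?_, fun a ha => ?_, fun p hp => ?_⟩
  · obtain ⟨b, hb, rfl⟩ := Finset.mem_image.1 ha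
    have := R.subset b hb
    exact ⟨by linarith [this.2], by linarith [this.1]⟩
  · exact Finset.mem_image.2 ⟨1, R.one_mem, rfl⟩
  · exact Finset.mem_image.2 ⟨-1, R.neg_one_mem, by norm_num⟩
  · rw [Finset.card_image_of_injOn hinj, R.card]
  · obtain ⟨b, hb, rfl⟩ := Finset.mem_image.1 ha
    simpa using R.pos b hb
  · rw [Finset.sum_image hinj]
    have h1 := R.exact (p.comp (-X)) (by
      rw [natDegree_comp, natDegree_neg, natDegree_X, mul_one]; exact hp)
    simp only [eval_comp, eval_neg, eval_X] at h1
    simp only [neg_neg]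
    rw [h1, integral_volI, integral_volI]
    simpa using intervalIntegral.integral_comp_neg (a := -1) (b := 1) (fun x => p.eval x)

/-- The Chebyshev-Markov-Stieltjes inequality is applied at the nodes adjacent to x: at the next
node on the right for the upper bound, and, for the reflected rule, at the last node a₀ ≤ x for the
lower bound. Each comparison is off by the weight of one node. -/
lemma LobattoRule.abs_quadKernel_le_of_weights_le {N : ℕ} {S : Finset ℝ} {w : ℝ → ℝ}
    (R : LobattoRule N S w) {W : ℝ} (hW : ∀ a ∈ S, w a ≤ W) {x : ℝ} (hx : x ∈ Ioo (-1 : ℝ) 1) :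
    |quadKernel S w x| ≤ W := by
  rw [abs_le]
  constructor
  · have hne : (S.filter (· ≤ x)).Nonempty :=
      ⟨-1, Finset.mem_filter.2 ⟨R.neg_one_mem, hx.1.le⟩⟩
    set a₀ := (S.filter (· ≤ x)).max' hne
    have h1 : a₀ ∈ S ∧ a₀ ≤ x := Finset.mem_filter.1 (Finset.max'_mem _ hne)
    have hmax : ∀ c ∈ S, c ≤ x → c ≤ a₀ := fun c hc h =>
      Finset.le_max' _ _ (Finset.mem_filter.2 ⟨hc, h⟩)
    have h2 := R.reflect.add_one_le_sum (b := -a₀) (Finset.mem_image.2 ⟨a₀, h1.1, rfl⟩)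
    rw [Finset.sum_image fun a _ b _ h => neg_injective h] at h2
    simp only [neg_neg, neg_le_neg_iff] at h2
    have h3 : ∑ c ∈ S, (if c ≤ x then w c else 0) + ∑ c ∈ S, (if a₀ ≤ c then w c else 0) =
        ∑ c ∈ S, (w c + if c = a₀ then w c else 0) := by
      rw [← Finset.sum_add_distrib]
      refine Finset.sum_congr rfl fun c hc => ?_
      rcases lt_trichotomy c a₀ with h | h | h
      · rw [if_pos (h.le.trans h1.2), if_neg (not_le.2 h), if_neg h.ne]
      · rw [if_pos (h.le.trans h1.2), if_pos h.ge, if_pos h]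
      · rw [if_neg (fun hcx => absurd (hmax c hc hcx) (not_le.2 h)), if_pos h.le, if_neg h.ne']
        ring
    rw [Finset.sum_add_distrib, R.sum_weights, Finset.sum_ite_eq' S a₀ w, if_pos h1.1] at h3
    have := hW a₀ h1.1
    rw [quadKernel]
    linarith
  · have hne : (S.filter (x < ·)).Nonempty := ⟨1, Finset.mem_filter.2 ⟨R.one_mem, hx.2⟩⟩
    set b₀ := (S.filter (x < ·)).min' hne
    have h1 : b₀ ∈ S ∧ x < b₀ := Finset.mem_filter.1 (Finset.min'_mem _ hne)
    have hmin : ∀ c ∈ S, x < c → b₀ ≤ c := fun c hc h =>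
      Finset.min'_le _ _ (Finset.mem_filter.2 ⟨hc, h⟩)
    have h2 := R.add_one_le_sum h1.1
    have h3 : ∑ c ∈ S, (if c ≤ b₀ then w c else 0) =
        ∑ c ∈ S, ((if c ≤ x then w c else 0) + if c = b₀ then w c else 0) := by
      refine Finset.sum_congr rfl fun c hc => ?_
      rcases lt_trichotomy c b₀ with h | h | h
      · rw [if_pos h.le, if_pos (not_lt.1 fun hcx => absurd (hmin c hc hcx) (not_le.2 h)),
          if_neg h.ne, add_zero]
      · rw [if_pos h.le, if_neg (not_le.2 (h ▸ h1.2)), if_pos h, zero_add]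
      · rw [if_neg (not_le.2 h), if_neg (not_le.2 (h1.2.trans h)), if_neg h.ne', zero_add]
    rw [Finset.sum_add_distrib, Finset.sum_ite_eq' S b₀ w, if_pos h1.1] at h3
    have := hW b₀ h1.1
    rw [quadKernel]
    linarith [h1.2]

/-- The discrete norm is controlled by the `L²` norm and a small multiple of the derivative. -/
lemma LobattoRule.sum_sq_le {N : ℕ} {S : Finset ℝ} {w : ℝ → ℝ}
    (R : LobattoRule N S w) {W : ℝ} (hW : ∀ a ∈ S, w a ≤ W) {e e' : ℝ → ℝ} (he : IsPrim e e') :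
    ∑ a ∈ S, w a * e a ^ 2 ≤ normL2 e ^ 2 + 2 * W * (normL2 e * normL2 e') := by
  have hsq := he.mul he
  have h1 := R.sum_eq_integral_add hsq
  have hW0 : 0 ≤ W := (R.pos _ R.one_mem).le.trans (hW _ R.one_mem)
  have h2 : |∫ x, quadKernel S w x * (e' x * e x + e x * e' x) ∂volI| ≤
      2 * W * ∫ x, |e x| * |e' x| ∂volI := by
    rw [← integral_const_mul]
    refine abs_integral_le_integral_abs.trans (integral_mono_of_nonneg
      (ae_of_all _ fun _ => abs_nonneg _) ((integrable_mul he.memLp_self.abs he.memLp.abs).const_mul _)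
      (ae_volI_of_forall fun x hx => ?_))
    have h3 := R.abs_quadKernel_le_of_weights_le hW hx
    simp only
    rw [show e' x * e x + e x * e' x = 2 * (e x * e' x) by ring, abs_mul, abs_mul, abs_mul, abs_two]
    have := mul_nonneg (abs_nonneg (e x)) (abs_nonneg (e' x))
    nlinarith
  have h4 : ∫ x, |e x| * |e' x| ∂volI ≤ normL2 e * normL2 e' := by
    have := abs_integral_mul_le he.memLp_self.abs he.memLp.abs
    have h5 : ∀ f : ℝ → ℝ, normL2 |f| = normL2 f := fun f => by simp [normL2, sq_abs]
    rw [h5, h5] at this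
    exact (le_abs_self _).trans this
  have h6 : ∫ x, e x * e x ∂volI = normL2 e ^ 2 := by rw [normL2_sq]; simp only [sq]
  simp only [sq (e _)]
  rw [h1, h6]
  have := (abs_le.1 h2).2
  have := mul_le_mul_of_nonneg_left h4 (by positivity : 0 ≤ 2 * W)
  linarith

/-! ### Size of the weights -/

open Polynomial.Chebyshev in
-- With y = T_n(b)² one has T_n² + T_{2n}² = y + (2y - 1)² ≥ 7/16, minimal at y = 3/8. Summing over
-- n < (N+1)/2 keeps both indices below N and counts each square at most twice.
lemma exists_chebyshev_sum_sq_ge (N : ℕ) (b : ℝ) :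
    (7 / 64 : ℝ) * N ≤ ∑ n ∈ Finset.range N, (T ℝ n).eval b ^ 2 := by
  have hT : ∀ n : ℕ, (T ℝ (2 * n)).eval b = 2 * (T ℝ n).eval b ^ 2 - 1 := by
    intro n
    have := congrArg (eval b) (T_mul_T (R := ℝ) (n : ℤ) (n : ℤ))
    simp only [sub_self, T_zero, ← two_mul, eval_mul, eval_add, eval_one, eval_ofNat] at this
    linarith
  set M := (N + 1) / 2 with hM
  have h1 : (7 / 16 : ℝ) * M ≤ ∑ n ∈ Finset.range M, ((T ℝ n).eval b ^ 2
      + (T ℝ ((2 * n : ℕ) : ℤ)).eval b ^ 2) := by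
    rw [mul_comm, ← nsmul_eq_mul, ← Finset.card_range M, ← Finset.sum_const]
    rw [Finset.card_range]
    refine Finset.sum_le_sum fun n _ => ?_
    push_cast
    rw [hT]
    nlinarith [sq_nonneg ((T ℝ n).eval b ^ 2 - 3 / 8)]
  have h2 : ∑ n ∈ Finset.range M, (T ℝ n).eval b ^ 2 ≤ ∑ n ∈ Finset.range N, (T ℝ n).eval b ^ 2 :=
    Finset.sum_le_sum_of_subset_of_nonneg (Finset.range_subset_range.2 (by omega))
      fun _ _ _ => sq_nonneg _
  have h3 : ∑ n ∈ Finset.range M, (T ℝ ((2 * n : ℕ) : ℤ)).eval b ^ 2 ≤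
      ∑ n ∈ Finset.range N, (T ℝ n).eval b ^ 2 := by
    rw [← Finset.sum_image (s := Finset.range M) (g := fun n => 2 * n)
      (f := fun n : ℕ => (T ℝ (n : ℤ)).eval b ^ 2) (fun a _ c _ h => by simpa using h)]
    refine Finset.sum_le_sum_of_subset_of_nonneg (fun n hn => ?_) fun _ _ _ => sq_nonneg _
    obtain ⟨m, hm, rfl⟩ := Finset.mem_image.1 hn
    rw [Finset.mem_range] at hm ⊢
    omega
  rw [Finset.sum_add_distrib] at h1
  have h4 : (N : ℝ) ≤ 2 * M := by
    have : N ≤ 2 * M := by omega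
    exact_mod_cast this
  linarith

open Polynomial.Chebyshev in
-- The Chebyshev weight is at least 1 on I, and the T_n are orthogonal for it with squared norms at
-- most π.
lemma integral_chebyshev_sum_sq_le (N : ℕ) (a : ℕ → ℝ) :
    ∫ x, (∑ n ∈ Finset.range N, a n • T ℝ n).eval x ^ 2 ∂volI ≤
      Real.pi * ∑ n ∈ Finset.range N, a n ^ 2 := by
  set p : ℝ[X] := ∑ n ∈ Finset.range N, a n • T ℝ n with hp
  have h1 : ∫ x, p.eval x ^ 2 ∂volI ≤ ∫ x, p.eval x ^ 2 ∂measureT := by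
    rw [integral_measureT, integral_volI]
    refine intervalIntegral.integral_mono_on_of_le_Ioo (by norm_num)
      ((p.continuous.pow 2).intervalIntegrable _ _)
      (intervalIntegrable_sqrt_one_sub_sq_inv.continuousOn_mul (p.continuous.pow 2).continuousOn)
      fun x hx => le_mul_of_one_le_right (sq_nonneg _) ?_
    have h0 : 0 < 1 - x ^ 2 := by nlinarith [hx.1, hx.2]
    have h2 : (1 : ℝ) ≤ (√(1 - x ^ 2))⁻¹ := (one_le_inv₀ (Real.sqrt_pos.2 h0)).2
      (Real.sqrt_le_one.2 (by nlinarith [sq_nonneg x]))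
    simpa using h2
  refine h1.trans ?_
  have hi : ∀ q : ℝ[X], Integrable (fun x => q.eval x) measureT := fun q =>
    integrable_measureT q.continuous.continuousOn
  have hc : ∀ n m : ℕ, ∫ x, (T ℝ n).eval x * (T ℝ m).eval x ∂measureT ≤
      if n = m then Real.pi else 0 := by
    intro n m
    split_ifs with h
    · subst h
      rcases Nat.eq_zero_or_pos n with rfl | hn
      · exact integral_eval_T_real_mul_self_measureT_zero.le
      · rw [integral_T_real_mul_self_measureT_of_ne_zero hn.ne']
        linarith [Real.pi_pos]
    · exact (integral_eval_T_real_mul_eval_T_real_measureT_of_ne h).le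
  have h3 : ∫ x, p.eval x ^ 2 ∂measureT = ∑ n ∈ Finset.range N, ∑ m ∈ Finset.range N,
      a n * a m * ∫ x, (T ℝ n).eval x * (T ℝ m).eval x ∂measureT := by
    have h4 : ∀ x, p.eval x ^ 2 = ∑ n ∈ Finset.range N, ∑ m ∈ Finset.range N,
        a n * a m * ((T ℝ n).eval x * (T ℝ m).eval x) := by
      intro x
      rw [hp, eval_finsetSum, sq, Finset.sum_mul_sum]
      refine Finset.sum_congr rfl fun n _ => Finset.sum_congr rfl fun m _ => ?_
      simp only [eval_smul, smul_eq_mul]; ring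
    have h5 : ∀ n m : ℕ, Integrable (fun x => a n * a m * ((T ℝ n).eval x * (T ℝ m).eval x))
        measureT := fun n m => by
      simpa using (hi (T ℝ n * T ℝ m)).const_mul (a n * a m)
    simp only [h4]
    rw [integral_finsetSum _ fun n _ => integrable_finsetSum _ fun m _ => h5 n m]
    refine Finset.sum_congr rfl fun n _ => ?_
    rw [integral_finsetSum _ fun m _ => h5 n m]
    simp only [integral_const_mul]
  rw [h3, Finset.mul_sum]
  refine Finset.sum_le_sum fun n hn => ?_
  rw [Finset.sum_eq_single_of_mem n hn]
  · have := hc n n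
    rw [if_pos rfl] at this
    nlinarith [sq_nonneg (a n)]
  · intro m _ hm
    rw [integral_eval_T_real_mul_eval_T_real_measureT_of_ne hm.symm, mul_zero]

open Polynomial.Chebyshev in
-- The rule is exact on the square of q = ∑ T_n(b) T_n, for which q(b) = A and ∫ q² ≤ π A. Dropping
-- all nodes but b gives w_b A ≤ π, and A ≥ 7N/64; π is then rounded up to 7.
lemma LobattoRule.weight_le {N : ℕ} {S : Finset ℝ} {w : ℝ → ℝ} (R : LobattoRule N S w)
    {b : ℝ} (hb : b ∈ S) : w b ≤ 64 / N := by
  set A := ∑ n ∈ Finset.range N, (T ℝ n).eval b ^ 2 with hA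
  have hN : (0 : ℝ) < N := by exact_mod_cast R.one_le
  have hA1 : (7 / 64 : ℝ) * N ≤ A := exists_chebyshev_sum_sq_ge N b
  have hA0 : 0 < A := lt_of_lt_of_le (by positivity) hA1
  set q : ℝ[X] := ∑ n ∈ Finset.range N, (T ℝ n).eval b • T ℝ n with hq
  have hqb : q.eval b = A := by
    rw [hq, eval_finsetSum, hA]
    simp only [eval_smul, smul_eq_mul, sq]
  have hqd : q.natDegree ≤ N - 1 := by
    refine natDegree_sum_le_of_forall_le _ _ fun n hn => (natDegree_smul_le _ _).trans ?_
    rw [natDegree_T, Int.natAbs_natCast]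
    have := Finset.mem_range.1 hn
    omega
  have hN1 := R.one_le
  have h1 := R.exact (q ^ 2) (natDegree_pow_le.trans (by omega))
  simp only [eval_pow] at h1
  have h2 : w b * A ^ 2 ≤ ∑ a ∈ S, w a * q.eval a ^ 2 := by
    rw [← hqb]
    exact Finset.single_le_sum (f := fun a => w a * q.eval a ^ 2)
      (fun a ha => mul_nonneg (R.pos a ha).le (sq_nonneg _)) hb
  have h3 := integral_chebyshev_sum_sq_le N (fun n => (T ℝ n).eval b)
  rw [← hA, ← hq, ← h1] at h3
  have h4 : w b * A ≤ Real.pi := by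
    refine le_of_mul_le_mul_right ?_ hA0
    linarith
  have h5 : w b * ((7 / 64 : ℝ) * N) ≤ 7 := by
    have := mul_le_mul_of_nonneg_left hA1 (R.pos b hb).le
    linarith [Real.pi_lt_four]
  rw [le_div_iff₀ hN]
  linarith

/-! ### The Legendre--Gauss--Lobatto rule -/

lemma lglNodes_eq (N : ℕ) : lglNodes N = (lobatto N).roots.toFinset := rfl

lemma derivative_legendre_ne_zero {N : ℕ} (hN : 1 ≤ N) : derivative (legendre N) ≠ 0 := by
  intro h
  have := derivative_eq_zero.1 h
  rw [natDegree_legendre] at this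
  omega

lemma natDegree_derivative_legendre {N : ℕ} : (derivative (legendre N)).natDegree = N - 1 := by
  rcases Nat.eq_zero_or_pos N with rfl | h
  · rw [derivative_of_natDegree_zero (natDegree_legendre 0)]; simp
  · rw [natDegree_derivative, natDegree_legendre]

lemma one_sub_X_sq_ne_zero : (1 - X ^ 2 : ℝ[X]) ≠ 0 := by
  intro h
  have := natDegree_one_sub_X_sq
  rw [h] at this
  simp at this

lemma one_sub_X_sq_eq : (1 - X ^ 2 : ℝ[X]) = -((X - C 1) * (X - C (-1))) := by
  simp only [map_one, map_neg]; ring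

lemma lobatto_ne_zero {N : ℕ} (hN : 1 ≤ N) : lobatto N ≠ 0 :=
  mul_ne_zero one_sub_X_sq_ne_zero (derivative_legendre_ne_zero hN)

lemma natDegree_lobatto {N : ℕ} (hN : 1 ≤ N) : (lobatto N).natDegree = N + 1 := by
  rw [lobatto, natDegree_mul one_sub_X_sq_ne_zero (derivative_legendre_ne_zero hN),
    natDegree_one_sub_X_sq, natDegree_derivative_legendre]
  omega

lemma eval_lobatto_of_sq_eq {N : ℕ} {a : ℝ} (ha : a ^ 2 = 1) : (lobatto N).eval a = 0 := by
  simp [lobatto, ha]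

/-- Orthogonality of the nodal polynomial, from Legendre's equation after one integration by parts;
this is what raises the exactness of the rule to degree 2N - 1. -/
lemma innerL2_lobatto {N : ℕ} {q : ℝ[X]} (hN : 1 ≤ N) (hq : q ∈ degreeLT ℝ (N - 1)) :
    innerL2 (lobatto N) q = 0 := by
  have h1 : primitive q ∈ degreeLT ℝ N := by
    have := primitive_mem hq
    rwa [Nat.sub_add_cancel hN] at this
  conv_lhs => rw [← derivative_primitive q]
  rw [innerL2_derivative_right, eval_lobatto_of_sq_eq (by norm_num),
    eval_lobatto_of_sq_eq (by norm_num), derivative_lobatto, innerL2_neg_left, innerL2_smul_left,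
    innerL2_comm, innerL2_legendre_of_degree_lt h1]
  ring

lemma mem_degreeLT_of_mul_eq {N : ℕ} (hN : 1 ≤ N) {s q : ℝ[X]} (hs : s.Monic)
    (hs1 : 1 ≤ s.natDegree) (h : derivative (legendre N) = s * q) : q ∈ degreeLT ℝ (N - 1) := by
  have hq0 : q ≠ 0 := by
    rintro rfl
    exact derivative_legendre_ne_zero hN (by simpa using h)
  have h1 := congrArg natDegree h
  rw [natDegree_derivative_legendre, hs.natDegree_mul' hq0] at h1
  rw [mem_degreeLT, degree_eq_natDegree hq0]
  have : q.natDegree < N - 1 := by omega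
  exact_mod_cast this

/-- If `P_N' = s q` with `s` of one sign on `I`, then `s` is constant. -/
lemma false_of_derivative_legendre_eq_mul {N : ℕ} (hN : 1 ≤ N) {s q : ℝ[X]} {ε : ℝ} (hε : ε ≠ 0)
    (hs : s.Monic) (hs1 : 1 ≤ s.natDegree) (h : derivative (legendre N) = s * q)
    (hsign : ∀ x ∈ Ioo (-1 : ℝ) 1, 0 ≤ ε * s.eval x) : False := by
  have h1 := innerL2_lobatto hN (mem_degreeLT_of_mul_eq hN hs hs1 h)
  have hq0 : q ≠ 0 := by
    rintro rfl
    exact derivative_legendre_ne_zero hN (by simpa using h)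
  have hpos := integral_eval_pos (p := C ε * s * (1 - X ^ 2) * q ^ 2)
    (mul_ne_zero (mul_ne_zero (mul_ne_zero (by simpa using hε) hs.ne_zero)
      one_sub_X_sq_ne_zero) (pow_ne_zero 2 hq0)) fun x hx => by
      simp only [eval_mul, eval_C, eval_sub, eval_one, eval_pow, eval_X]
      have := hsign x hx
      have : 0 ≤ 1 - x ^ 2 := by nlinarith [hx.1, hx.2]
      positivity
  have h2 : ∫ x, (C ε * s * (1 - X ^ 2) * q ^ 2).eval x ∂volI = ε * innerL2 (lobatto N) q := by
    rw [innerL2, ← integral_const_mul, lobatto, h]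
    simp only [eval_mul, eval_C, eval_sub, eval_one, eval_pow, eval_X]
    congr 1; ext x; ring
  rw [h2, h1, mul_zero] at hpos
  exact lt_irrefl _ hpos

lemma mem_Ioo_of_isRoot {N : ℕ} (hN : 1 ≤ N) {a : ℝ} (ha : (derivative (legendre N)).IsRoot a) :
    a ∈ Ioo (-1 : ℝ) 1 := by
  obtain ⟨q, hq⟩ := dvd_iff_isRoot.2 ha
  by_contra hcon
  have hd : 1 ≤ (X - C a).natDegree := by rw [natDegree_X_sub_C]
  rw [mem_Ioo, not_and_or, not_lt, not_lt] at hcon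
  rcases hcon with h | h
  · exact false_of_derivative_legendre_eq_mul hN one_ne_zero (monic_X_sub_C a) hd hq
      fun x hx => by simp; linarith [hx.1]
  · exact false_of_derivative_legendre_eq_mul hN (ε := -1) (by norm_num) (monic_X_sub_C a) hd hq
      fun x hx => by simp; linarith [hx.2]

lemma nodup_roots_derivative_legendre {N : ℕ} (hN : 1 ≤ N) :
    (derivative (legendre N)).roots.Nodup := by
  rw [Multiset.nodup_iff_count_le_one]
  intro a
  rw [count_roots]
  by_contra hcon
  rw [not_le] at hcon
  obtain ⟨q, hq⟩ := (le_rootMultiplicity_iff (derivative_legendre_ne_zero hN)).1 hcon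
  refine false_of_derivative_legendre_eq_mul hN one_ne_zero ((monic_X_sub_C a).pow 2) ?_ hq
    fun x hx => by simp; positivity
  rw [(monic_X_sub_C a).natDegree_pow, natDegree_X_sub_C]
  norm_num

lemma card_roots_iterate_derivative_ge (p : ℝ[X]) (k : ℕ) :
    p.roots.card ≤ (derivative^[k] p).roots.card + k := by
  induction k with
  | zero => simp
  | succ k ih =>
    rw [Function.iterate_succ_apply']
    have := card_roots_le_derivative (derivative^[k] p)
    omega

/-- By Rolle, each differentiation loses at most one real root counted with multiplicity; (X² - 1)^N
starts with 2N of them and is differentiated N + 1 times. -/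
lemma card_roots_derivative_legendre {N : ℕ} (hN : 1 ≤ N) :
    (derivative (legendre N)).roots.card = N - 1 := by
  refine le_antisymm ((card_roots' _).trans natDegree_derivative_legendre.le) ?_
  have h1 : derivative (legendre N) = C (1 / (2 ^ N * (N.factorial : ℝ))) *
      derivative^[N + 1] ((X ^ 2 - 1) ^ N) := by
    rw [legendre, derivative_C_mul, Function.iterate_succ_apply']
  have h2 := card_roots_iterate_derivative_ge ((X ^ 2 - 1 : ℝ[X]) ^ N) (N + 1)
  have h3 : ((X ^ 2 - 1 : ℝ[X]) ^ N).roots.card = 2 * N := by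
    have : (X ^ 2 - 1 : ℝ[X]) = (X - C 1) * (X - C (-1)) := by
      simp only [map_one, map_neg]; ring
    rw [this, roots_pow, roots_mul (mul_ne_zero (X_sub_C_ne_zero _) (X_sub_C_ne_zero _)),
      roots_X_sub_C, roots_X_sub_C]
    simp [mul_comm]
  rw [h1, roots_C_mul _ (by positivity)]
  omega

lemma mem_lglNodes {N : ℕ} (hN : 1 ≤ N) {a : ℝ} :
    a ∈ lglNodes N ↔ a = 1 ∨ a = -1 ∨ (derivative (legendre N)).IsRoot a := by
  rw [lglNodes_eq, Multiset.mem_toFinset, mem_roots (lobatto_ne_zero hN), lobatto, one_sub_X_sq_eq]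
  simp only [IsRoot, eval_mul, eval_neg, eval_sub, eval_X, eval_C, mul_eq_zero, neg_eq_zero,
    sub_eq_zero, or_assoc]

lemma card_lglNodes {N : ℕ} (hN : 1 ≤ N) : (lglNodes N).card = N + 1 := by
  have h : lglNodes N = insert 1 (insert (-1) (derivative (legendre N)).roots.toFinset) := by
    ext a
    rw [mem_lglNodes hN]
    simp [derivative_legendre_ne_zero hN]
  have h1 : (-1 : ℝ) ∉ (derivative (legendre N)).roots.toFinset := fun hm => by
    have := mem_Ioo_of_isRoot hN (isRoot_of_mem_roots (Multiset.mem_toFinset.1 hm))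
    exact lt_irrefl _ this.1
  have h2 : (1 : ℝ) ∉ (derivative (legendre N)).roots.toFinset := fun hm => by
    have := mem_Ioo_of_isRoot hN (isRoot_of_mem_roots (Multiset.mem_toFinset.1 hm))
    exact lt_irrefl _ this.2
  rw [h, Finset.card_insert_of_notMem (by simp only [Finset.mem_insert, h2, or_false]; norm_num),
    Finset.card_insert_of_notMem h1,
    Multiset.toFinset_card_of_nodup (nodup_roots_derivative_legendre hN),
    card_roots_derivative_legendre hN]
  omega

/-- The weights of the Legendre--Gauss--Lobatto rule. -/
def lglWeight (N : ℕ) (a : ℝ) : ℝ := ∫ x, (Lagrange.basis (lglNodes N) id a).eval x ∂volI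

lemma integral_lglInterp (N : ℕ) (v : ℝ → ℝ) :
    ∫ x, (lglInterp N v).eval x ∂volI = ∑ a ∈ lglNodes N, lglWeight N a * v a := by
  rw [lglInterp, Lagrange.interpolate_apply]
  simp only [eval_finsetSum, eval_mul, eval_C]
  rw [integral_finsetSum _ fun a _ => (integrable_eval _).const_mul _]
  simp only [integral_const_mul, lglWeight, mul_comm]

lemma lglInterp_eval_self {N : ℕ} (hN : 1 ≤ N) {p : ℝ[X]} (hp : p ∈ degreeLT ℝ (N + 1)) :
    lglInterp N (fun x => p.eval x) = p := by
  have := Lagrange.eq_interpolate (s := lglNodes N) (v := id) (Set.injOn_id _) (f := p) (by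
    rw [card_lglNodes hN]; exact mem_degreeLT.1 hp)
  exact this.symm

/-- Division by the nodal polynomial: the quotient is of degree below N - 1, so its product with the
nodal polynomial has integral zero, and the remainder is reproduced by interpolation. -/
lemma lglWeight_exact {N : ℕ} (hN : 1 ≤ N) {p : ℝ[X]} (hp : p.natDegree ≤ 2 * N - 1) :
    ∑ a ∈ lglNodes N, lglWeight N a * p.eval a = ∫ x, p.eval x ∂volI := by
  set Q := lobatto N
  have hQ0 := lobatto_ne_zero hN
  have hmod : p % Q ∈ degreeLT ℝ (N + 1) := by
    rw [mem_degreeLT]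
    refine (degree_mod_lt p hQ0).trans_le ?_
    rw [degree_eq_natDegree hQ0, natDegree_lobatto hN]
  have hdiv : p / Q ∈ degreeLT ℝ (N - 1) := by
    by_cases h0 : p / Q = 0
    · rw [h0]; exact Submodule.zero_mem _
    rw [mem_degreeLT, degree_eq_natDegree h0]
    have h1 : (Q * (p / Q)).natDegree = N + 1 + (p / Q).natDegree := by
      rw [natDegree_mul hQ0 h0, natDegree_lobatto hN]
    have h2 : Q * (p / Q) = p - p % Q := eq_sub_of_add_eq (EuclideanDomain.div_add_mod p Q)
    have h3 := natDegree_sub_le p (p % Q)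
    have h4 : (p % Q).natDegree ≤ N := natDegree_le_of_degree_le
      (Order.le_of_lt_succ (by exact_mod_cast mem_degreeLT.1 hmod))
    rw [← h2, h1] at h3
    have : (p / Q).natDegree < N - 1 := by omega
    exact_mod_cast this
  have hp' : p = Q * (p / Q) + p % Q := (EuclideanDomain.div_add_mod p Q).symm
  have h1 : ∀ a ∈ lglNodes N, lglWeight N a * p.eval a = lglWeight N a * (p % Q).eval a := by
    intro a ha
    have : Q.eval a = 0 := isRoot_of_mem_roots (Multiset.mem_toFinset.1 ha)
    conv_lhs => rw [hp']
    simp [this]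
  have h2 : ∫ x, p.eval x ∂volI = innerL2 Q (p / Q) + ∫ x, (p % Q).eval x ∂volI := by
    conv_lhs => rw [hp']
    simp only [eval_add, eval_mul]
    exact integral_add (integrable_eval_mul _ _) (integrable_eval _)
  rw [Finset.sum_congr rfl h1, h2, innerL2_lobatto hN hdiv, zero_add, ← integral_lglInterp,
    lglInterp_eval_self hN hmod]

/-- A nonnegative polynomial in the exactness range that vanishes at all nodes but a isolates the
weight of a. -/
lemma lglWeight_pos_of {N : ℕ} (hN : 1 ≤ N) {a : ℝ} (ha : a ∈ lglNodes N) {p : ℝ[X]}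
    (hp0 : p ≠ 0) (hd : p.natDegree ≤ 2 * N - 1) (hp : ∀ x ∈ Icc (-1 : ℝ) 1, 0 ≤ p.eval x)
    (haI : a ∈ Icc (-1 : ℝ) 1) (hne : ∀ b ∈ lglNodes N, b ≠ a → p.eval b = 0) :
    0 < lglWeight N a := by
  have h1 := integral_eval_pos hp0 fun x hx => hp x (Ioo_subset_Icc_self hx)
  rw [← lglWeight_exact hN hd, Finset.sum_eq_single_of_mem a ha fun b hb hba => by
    rw [hne b hb hba, mul_zero]] at h1
  exact pos_of_mul_pos_left h1 (hp a haI)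

lemma lglNodes_subset {N : ℕ} (hN : 1 ≤ N) {a : ℝ} (ha : a ∈ lglNodes N) : a ∈ Icc (-1 : ℝ) 1 := by
  rcases (mem_lglNodes hN).1 ha with rfl | rfl | h
  · simp
  · simp
  · exact Ioo_subset_Icc_self (mem_Ioo_of_isRoot hN h)

lemma lglWeight_pos {N : ℕ} (hN : 1 ≤ N) {a : ℝ} (ha : a ∈ lglNodes N) : 0 < lglWeight N a := by
  have haI := lglNodes_subset hN ha
  have hP0 := derivative_legendre_ne_zero hN
  rcases (mem_lglNodes hN).1 ha with rfl | rfl | h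
  · refine lglWeight_pos_of hN ha (p := (X + 1) * derivative (legendre N) ^ 2)
      (mul_ne_zero (X_add_C_ne_zero 1) (pow_ne_zero 2 hP0)) ?_ (fun x hx => ?_) haI
      fun b hb hb1 => ?_
    · refine natDegree_mul_le.trans ?_
      have : (X + 1 : ℝ[X]).natDegree = 1 := natDegree_X_add_C 1
      rw [this, natDegree_pow, natDegree_derivative_legendre]
      omega
    · simp only [eval_mul, eval_add, eval_X, eval_one, eval_pow]
      exact mul_nonneg (by linarith [hx.1]) (sq_nonneg _)
    · rcases (mem_lglNodes hN).1 hb with rfl | rfl | h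
      · exact absurd rfl hb1
      · simp
      · simp [h.eq_zero]
  · refine lglWeight_pos_of hN ha (p := (C 1 - X) * derivative (legendre N) ^ 2)
      (mul_ne_zero (by rw [← neg_ne_zero, neg_sub]; exact X_sub_C_ne_zero 1) (pow_ne_zero 2 hP0)) ?_
      (fun x hx => ?_) haI fun b hb hb1 => ?_
    · refine natDegree_mul_le.trans ?_
      have : (C 1 - X : ℝ[X]).natDegree = 1 := by
        rw [← natDegree_neg, neg_sub]; exact natDegree_X_sub_C 1
      rw [this, natDegree_pow, natDegree_derivative_legendre]
      omega
    · simp only [eval_mul, eval_sub, eval_X, eval_C, eval_pow]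
      exact mul_nonneg (by linarith [hx.2]) (sq_nonneg _)
    · rcases (mem_lglNodes hN).1 hb with rfl | rfl | h
      · simp
      · exact absurd rfl hb1
      · simp [h.eq_zero]
  · obtain ⟨q, hq⟩ := dvd_iff_isRoot.2 h
    have hq0 : q ≠ 0 := by rintro rfl; exact hP0 (by simpa using hq)
    have hqd := mem_degreeLT_of_mul_eq hN (monic_X_sub_C a) (natDegree_X_sub_C a).ge hq
    rw [mem_degreeLT, degree_eq_natDegree hq0] at hqd
    have hqd' : q.natDegree < N - 1 := by exact_mod_cast hqd
    refine lglWeight_pos_of hN ha (p := (1 - X ^ 2) * q ^ 2)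
      (mul_ne_zero one_sub_X_sq_ne_zero (pow_ne_zero 2 hq0)) ?_ (fun x hx => ?_) haI
      fun b hb hba => ?_
    · refine natDegree_mul_le.trans ?_
      rw [natDegree_one_sub_X_sq, natDegree_pow]
      omega
    · simp only [eval_mul, eval_sub, eval_one, eval_X, eval_pow]
      exact mul_nonneg (by nlinarith [hx.1, hx.2]) (sq_nonneg _)
    · rcases (mem_lglNodes hN).1 hb with rfl | rfl | h
      · simp
      · simp
      · have := h.eq_zero
        rw [hq, eval_mul, mul_eq_zero] at this
        rcases this with h1 | h1
        · simp [sub_eq_zero] at h1; exact absurd h1 hba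
        · simp [h1]

lemma lobattoRule_lgl {N : ℕ} (hN : 1 ≤ N) : LobattoRule N (lglNodes N) (lglWeight N) where
  one_le := hN
  subset _ ha := lglNodes_subset hN ha
  neg_one_mem := (mem_lglNodes hN).2 (by simp)
  one_mem := (mem_lglNodes hN).2 (by simp)
  card := card_lglNodes hN
  pos _ ha := lglWeight_pos hN ha
  exact _ hp := lglWeight_exact hN hp

/-- The discrete norm of the Legendre--Gauss--Lobatto rule dominates the `L²` norm. -/
lemma innerL2_self_le_sum_lgl {N : ℕ} (hN : 1 ≤ N) {φ : ℝ[X]} (hφ : φ.natDegree ≤ N) :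
    innerL2 φ φ ≤ ∑ a ∈ lglNodes N, lglWeight N a * φ.eval a ^ 2 := by
  set P' := derivative (legendre N) with hP'
  have hP0 : P' ≠ 0 := derivative_legendre_ne_zero hN
  -- The coefficient γ is chosen so that adding a multiple of (1 - x²) P_N'² cancels the leading
  -- term of φ². The correction vanishes at the nodes, brings the degree into the exactness range,
  -- and has a nonnegative integral.
  set γ := φ.coeff N ^ 2 / P'.leadingCoeff ^ 2 with hγ
  set D := φ ^ 2 + C γ * (lobatto N * P') with hD
  have hl : (lobatto N * P').natDegree = 2 * N := by
    rw [natDegree_mul (lobatto_ne_zero hN) hP0, natDegree_lobatto hN, natDegree_derivative_legendre]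
    omega
  have hlc : (lobatto N * P').coeff (2 * N) = -P'.leadingCoeff ^ 2 := by
    rw [← hl, coeff_natDegree, leadingCoeff_mul, lobatto, leadingCoeff_mul, one_sub_X_sq_eq,
      leadingCoeff_neg, ((monic_X_sub_C _).mul (monic_X_sub_C _)).leadingCoeff, ← hP']
    ring
  have hDd : D.natDegree ≤ 2 * N - 1 := by
    have h1 : D.natDegree ≤ 2 * N := by
      refine natDegree_add_le_of_degree_le (natDegree_pow_le.trans (by omega))
        ((natDegree_C_mul_le _ _).trans hl.le)
    have h2 : D.coeff (2 * N) = 0 := by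
      have h3 : (φ ^ 2).coeff (2 * N) = φ.coeff N ^ 2 := coeff_pow_of_natDegree_le hφ
      rw [hD, coeff_add, coeff_C_mul, hlc, h3, hγ]
      have := leadingCoeff_ne_zero.2 hP0
      field_simp
      ring
    by_contra h3
    have h4 : D.natDegree = 2 * N := by omega
    have h5 : D.leadingCoeff = 0 := by rw [leadingCoeff, h4, h2]
    rw [leadingCoeff_eq_zero] at h5
    rw [h5] at h4
    simp at h4
    omega
  have h1 := lglWeight_exact hN hDd
  have h2 : ∀ a ∈ lglNodes N, lglWeight N a * D.eval a = lglWeight N a * φ.eval a ^ 2 := by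
    intro a ha
    have : (lobatto N).eval a = 0 := isRoot_of_mem_roots (Multiset.mem_toFinset.1 ha)
    simp [hD, this]
  have h3 : ∫ x, D.eval x ∂volI = innerL2 φ φ + γ * ∫ x, (lobatto N * P').eval x ∂volI := by
    rw [← integral_const_mul, innerL2, ← integral_add (integrable_eval_mul _ _)
      ((integrable_eval _).const_mul _)]
    congr 1; ext x
    simp only [hD, eval_add, eval_pow, eval_mul, eval_C]; ring
  have h4 : 0 ≤ ∫ x, (lobatto N * P').eval x ∂volI := by
    refine integral_nonneg_of_ae (ae_volI_of_forall fun x hx => ?_)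
    have : 0 ≤ 1 - x ^ 2 := by nlinarith [hx.1, hx.2]
    simp only [lobatto, ← hP', eval_mul, eval_sub, eval_one, eval_pow, eval_X, Pi.zero_apply]
    nlinarith [mul_nonneg this (mul_self_nonneg (P'.eval x))]
  rw [Finset.sum_congr rfl h2, h3] at h1
  rw [h1]
  have : 0 ≤ γ := by positivity
  nlinarith [mul_nonneg this h4]

lemma natDegree_lglInterp_le {N : ℕ} (hN : 1 ≤ N) (v : ℝ → ℝ) : (lglInterp N v).natDegree ≤ N := by
  refine natDegree_le_of_degree_le ((Lagrange.degree_interpolate_le v (Set.injOn_id _)).trans ?_)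
  rw [card_lglNodes hN]
  simp

lemma eval_lglInterp {N : ℕ} {v : ℝ → ℝ} {a : ℝ} (ha : a ∈ lglNodes N) :
    (lglInterp N v).eval a = v a :=
  Lagrange.eval_interpolate_at_node (v := id) v (Set.injOn_id _) ha

lemma normL2_lglInterp_sq_le {N : ℕ} (hN : 1 ≤ N) {e e' : ℝ → ℝ} (he : IsPrim e e') :
    normL2 (fun x => (lglInterp N e).eval x) ^ 2 ≤
      normL2 e ^ 2 + 2 * (64 / N) * (normL2 e * normL2 e') := by
  rw [← innerL2_self]
  refine (innerL2_self_le_sum_lgl hN (natDegree_lglInterp_le hN e)).trans ?_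
  rw [Finset.sum_congr rfl fun a ha => by rw [eval_lglInterp ha]]
  exact (lobattoRule_lgl hN).sum_sq_le (fun a ha => (lobattoRule_lgl hN).weight_le ha) he

lemma lglInterp_sub (N : ℕ) (v w : ℝ → ℝ) :
    lglInterp N (fun x => v x - w x) = lglInterp N v - lglInterp N w :=
  map_sub (Lagrange.interpolate (lglNodes N) id) v w

/-- The error of Legendre--Gauss--Lobatto interpolation. -/
lemma exists_lglInterp_error_le (k : ℕ) : ∃ C : ℝ, 0 ≤ C ∧
    ∀ (h : ℕ → ℝ → ℝ) (B : ℝ) (N : ℕ), SobChain (k + 1) h B → 1 ≤ N →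
      (N : ℝ) ^ (k + 1) * normL2 (fun x => h 0 x - (lglInterp N (h 0)).eval x) ≤ C * B := by
  obtain ⟨C, hC, hp⟩ := exists_ellProj_error_le k
  refine ⟨13 * C, by positivity, fun h B N H hN => ?_⟩
  obtain ⟨h1, h2⟩ := hp h B N H hN
  have hB := H.nonneg
  have hN0 : (0 : ℝ) < N := by exact_mod_cast hN
  have H0 := H.prim 0 (by omega)
  set E := ellProj N (h 0) with hE
  have he := H0.sub (isPrim_eval E)
  simp only [zero_add] at he
  set e := fun x => h 0 x - E.eval x with hedef
  set e' := fun x => h 1 x - (derivative E).eval x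
  have h3 : lglInterp N e = lglInterp N (h 0) - E := by
    rw [hedef, lglInterp_sub, lglInterp_eval_self hN (ellProj_mem N _)]
  have h4 : normL2 (fun x => h 0 x - (lglInterp N (h 0)).eval x) ≤
      normL2 e + normL2 (fun x => (lglInterp N e).eval x) := by
    refine (normL2_congr (ae_of_all _ fun x => ?_)).le.trans
      (normL2_sub_le he.memLp_self (memLp_eval (lglInterp N e) 2))
    rw [h3, eval_sub]
    simp only [hedef]
    ring
  have h5 := normL2_lglInterp_sq_le hN he
  -- The mixed term carries ‖e‖ ‖e'‖, one power of N short of ‖e‖²; the bound 64/N on the weights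
  -- restores it. The sum 1 + 128 is rounded up to 12².
  have h6 : (N : ℝ) ^ (k + 1) * normL2 (fun x => (lglInterp N e).eval x) ≤ 12 * (C * B) := by
    refine abs_le_of_sq_le_sq' ?_ (by positivity) |>.2
    have e1 := normL2_nonneg e
    have e2 := normL2_nonneg e'
    have hx : 0 ≤ (N : ℝ) ^ (k + 1) * normL2 e := by positivity
    have hy : 0 ≤ (N : ℝ) ^ k * normL2 e' := by positivity
    calc ((N : ℝ) ^ (k + 1) * normL2 (fun x => (lglInterp N e).eval x)) ^ 2
        = ((N : ℝ) ^ (k + 1)) ^ 2 * normL2 (fun x => (lglInterp N e).eval x) ^ 2 := by ring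
      _ ≤ ((N : ℝ) ^ (k + 1)) ^ 2 *
          (normL2 e ^ 2 + 2 * (64 / N) * (normL2 e * normL2 e')) := by gcongr
      _ = ((N : ℝ) ^ (k + 1) * normL2 e) ^ 2 +
          128 * (((N : ℝ) ^ (k + 1) * normL2 e) * (N ^ k * normL2 e')) := by
          field_simp
          ring
      _ ≤ (C * B) ^ 2 + 128 * ((C * B) * (C * B)) := by gcongr
      _ ≤ (12 * (C * B)) ^ 2 := by nlinarith [sq_nonneg (C * B)]
  calc _ ≤ (N : ℝ) ^ (k + 1) * (normL2 e + normL2 (fun x => (lglInterp N e).eval x)) := by gcongr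
    _ ≤ 13 * C * B := by rw [mul_add]; linarith


/-! ### Weak derivatives -/

/-- The test functions on `I`. -/
structure IsTest (φ : ℝ → ℝ) : Prop where
  contDiff : ContDiff ℝ ∞ φ
  compact : HasCompactSupport φ
  subset : tsupport φ ⊆ Ioo (-1 : ℝ) 1

lemma IsTest.eq_zero {φ : ℝ → ℝ} (h : IsTest φ) {x : ℝ} (hx : x ∉ Ioo (-1 : ℝ) 1) : φ x = 0 :=
  image_eq_zero_of_notMem_tsupport fun hx' => hx (h.subset hx')

lemma IsTest.memLp {φ : ℝ → ℝ} (h : IsTest φ) : MemLp φ 2 volI :=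
  h.contDiff.continuous.continuousOn.memLp_volI 2

lemma IsTest.deriv {φ : ℝ → ℝ} (h : IsTest φ) : IsTest (deriv φ) :=
  ⟨(contDiff_infty_iff_deriv.1 h.contDiff).2, h.compact.deriv,
    (tsupport_deriv_subset).trans h.subset⟩

lemma IsTest.sub {φ ψ : ℝ → ℝ} (h : IsTest φ) (h' : IsTest ψ) : IsTest (fun x => φ x - ψ x) :=
  ⟨h.contDiff.sub h'.contDiff, h.compact.sub h'.compact,
    (tsupport_sub φ ψ).trans (union_subset h.subset h'.subset)⟩

lemma IsTest.const_mul {φ : ℝ → ℝ} (h : IsTest φ) (a : ℝ) : IsTest (fun x => a * φ x) :=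
  ⟨contDiff_const.mul h.contDiff, h.compact.mul_left,
    (tsupport_mul_subset_right (f := fun _ => a)).trans h.subset⟩

lemma isPrim_of_contDiff {φ : ℝ → ℝ} (h : ContDiff ℝ 1 φ) : IsPrim φ (deriv φ) := by
  refine ⟨(h.continuous_deriv le_rfl).continuousOn.memLp_volI 2, fun x _ => ?_⟩
  rw [intervalIntegral.integral_deriv_eq_sub (fun t _ => h.differentiable one_ne_zero t)
    ((h.continuous_deriv le_rfl).intervalIntegrable _ _)]
  ring

lemma IsTest.isPrim {φ : ℝ → ℝ} (h : IsTest φ) : IsPrim φ (_root_.deriv φ) :=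
  isPrim_of_contDiff (h.contDiff.of_le (by exact_mod_cast le_top))

lemma IsPrim.integral_mul_deriv_test {f f' φ : ℝ → ℝ} (hf : IsPrim f f') (h : IsTest φ) :
    ∫ x, f x * deriv φ x ∂volI = -∫ x, f' x * φ x ∂volI := by
  rw [hf.integral_mul_deriv h.isPrim, h.eq_zero (by simp), h.eq_zero (by simp)]
  ring

lemma exists_isTest_integral_eq_one : ∃ η : ℝ → ℝ, IsTest η ∧ ∫ x, η x ∂volI = 1 := by
  let b : ContDiffBump (0 : ℝ) := ⟨1 / 4, 1 / 2, by norm_num, by norm_num⟩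
  have hs : tsupport (b.normed volume) ⊆ Ioo (-1 : ℝ) 1 := by
    rw [b.tsupport_normed_eq, Real.closedBall_eq_Icc]
    exact Icc_subset_Ioo (by norm_num [b]) (by norm_num [b])
  refine ⟨b.normed volume, ⟨b.contDiff_normed, b.hasCompactSupport_normed, hs⟩, ?_⟩
  rw [← b.integral_normed (μ := volume), volI]
  exact setIntegral_eq_integral_of_forall_compl_eq_zero fun x hx =>
    image_eq_zero_of_notMem_tsupport fun hx' => hx (hs hx')

/-- A test function with vanishing integral is the derivative of a test function. -/
lemma IsTest.exists_deriv_eq {χ : ℝ → ℝ} (h : IsTest χ) (h0 : ∫ x, χ x ∂volI = 0) :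
    ∃ Φ : ℝ → ℝ, IsTest Φ ∧ _root_.deriv Φ = χ := by
  obtain ⟨a, b, ha, hb, hab⟩ : ∃ a b : ℝ, -1 < a ∧ b < 1 ∧ tsupport χ ⊆ Icc a b := by
    rcases (tsupport χ).eq_empty_or_nonempty with he | hne
    · exact ⟨0, 0, by norm_num, by norm_num, by simp [he]⟩
    · obtain ⟨a, ha⟩ := h.compact.isCompact.exists_isLeast hne
      obtain ⟨b, hb⟩ := h.compact.isCompact.exists_isGreatest hne
      exact ⟨a, b, (h.subset ha.1).1, (h.subset hb.1).2, fun x hx => ⟨ha.2 hx, hb.2 hx⟩⟩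
  have hz : ∀ x ∉ Icc a b, χ x = 0 := fun x hx =>
    image_eq_zero_of_notMem_tsupport fun hx' => hx (hab hx')
  have hc := h.contDiff.continuous
  have hder : ∀ x, HasDerivAt (fun x => ∫ t in (-1 : ℝ)..x, χ t) (χ x) x := fun x =>
    intervalIntegral.integral_hasDerivAt_right (hc.intervalIntegrable _ _)
      (hc.stronglyMeasurableAtFilter _ _) hc.continuousAt
  have hd : _root_.deriv (fun x => ∫ t in (-1 : ℝ)..x, χ t) = χ := funext fun x => (hder x).deriv
  have hΦ : ∀ x ∉ Icc a b, ∫ t in (-1 : ℝ)..x, χ t = 0 := by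
    intro x hx
    rw [mem_Icc, not_and_or, not_le, not_le] at hx
    rcases hx with hx | hx
    · rw [intervalIntegral.integral_congr (g := fun _ => (0 : ℝ))]
      · simp
      · intro t ht
        refine hz t fun ht' => ?_
        have := ht.2
        rcases le_total (-1) x with h1 | h1
        · rw [max_eq_right h1] at this; linarith [ht'.1]
        · rw [max_eq_left h1] at this; linarith [ht'.1]
    · have h1 : ∫ t in (-1 : ℝ)..1, χ t = 0 := by rw [← integral_volI]; exact h0
      have h2 := intervalIntegral.integral_add_adjacent_intervals
        (hc.intervalIntegrable (μ := volume) (-1) 1) (hc.intervalIntegrable 1 x)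
      rw [← h2, h1, zero_add, intervalIntegral.integral_congr (g := fun _ => (0 : ℝ))]
      · simp
      · intro t ht
        refine hz t fun ht' => ?_
        have := ht.1
        rcases le_total 1 x with h1 | h1
        · rw [min_eq_left h1] at this; linarith [ht'.2]
        · rw [min_eq_right h1] at this; linarith [ht'.2]
  have hts : tsupport (fun x => ∫ t in (-1 : ℝ)..x, χ t) ⊆ Icc a b :=
    closure_minimal (fun x hx => by
      by_contra hx'
      exact hx (hΦ x hx')) isClosed_Icc
  refine ⟨fun x => ∫ t in (-1 : ℝ)..x, χ t, ⟨?_, ?_, hts.trans (Icc_subset_Ioo ha hb)⟩, hd⟩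
  · rw [contDiff_infty_iff_deriv, hd]
    exact ⟨fun x => (hder x).differentiableAt, h.contDiff⟩
  · exact isCompact_Icc.of_isClosed_subset (isClosed_tsupport _) hts

lemma ae_eq_zero_of_integral_mul_test {d : ℝ → ℝ} (hd : MemLp d 2 volI)
    (h : ∀ φ, IsTest φ → ∫ x, d x * φ x ∂volI = 0) : ∀ᵐ x ∂volI, d x = 0 := by
  have hi : IntegrableOn d (Ioo (-1 : ℝ) 1) volume := hd.integrable (by norm_num)
  have h1 := IsOpen.ae_eq_zero_of_integral_contDiff_smul_eq_zero (μ := volume)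
    (isOpen_Ioo (a := (-1 : ℝ)) (b := 1)) hi.locallyIntegrableOn fun φ h1 h2 h3 => by
      have ht : IsTest φ := ⟨h1, h2, h3⟩
      rw [← h φ ht, volI]
      refine Eq.trans (setIntegral_eq_integral_of_forall_compl_eq_zero (s := Ioo (-1 : ℝ) 1)
        fun x hx => ?_).symm ?_
      · rw [ht.eq_zero hx, zero_smul]
      · simp only [smul_eq_mul, mul_comm]
  rw [volI, ae_restrict_iff' measurableSet_Ioo]
  exact h1

/-- The lemma of du Bois-Reymond. -/
lemma exists_ae_eq_const {d : ℝ → ℝ} (hd : MemLp d 2 volI)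
    (h : ∀ φ, IsTest φ → ∫ x, d x * deriv φ x ∂volI = 0) : ∃ c : ℝ, ∀ᵐ x ∂volI, d x = c := by
  obtain ⟨η, hη, hη1⟩ := exists_isTest_integral_eq_one
  refine ⟨∫ x, d x * η x ∂volI, ?_⟩
  set c := ∫ x, d x * η x ∂volI with hc
  have := ae_eq_zero_of_integral_mul_test (hd.sub (memLp_const c)) fun ψ hψ => ?_
  · filter_upwards [this] with x hx
    exact sub_eq_zero.1 hx
  · set s := ∫ x, ψ x ∂volI with hs
    have hψi : Integrable ψ volI := hψ.memLp.integrable (by norm_num)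
    have hηi : Integrable η volI := hη.memLp.integrable (by norm_num)
    -- Subtracting s η makes the integral vanish, so the difference is an admissible derivative of a
    -- test function.
    obtain ⟨Φ, hΦ, hΦ'⟩ := (hψ.sub (hη.const_mul s)).exists_deriv_eq (by
      rw [integral_sub hψi (hηi.const_mul s), integral_const_mul, hη1]; simp [hs])
    have h1 := h Φ hΦ
    rw [hΦ'] at h1
    have h2 : ∫ x, d x * (ψ x - s * η x) ∂volI = ∫ x, d x * ψ x ∂volI - s * c := by
      rw [hc, ← integral_const_mul, ← integral_sub (integrable_mul hd hψ.memLp)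
        ((integrable_mul hd hη.memLp).const_mul s)]
      congr 1; ext x; ring
    have h3 : ∫ x, (d - (fun _ => c : ℝ → ℝ)) x * ψ x ∂volI = ∫ x, d x * ψ x ∂volI - c * s := by
      rw [hs, ← integral_const_mul, ← integral_sub (integrable_mul hd hψ.memLp) (hψi.const_mul c)]
      congr 1; ext x; simp only [Pi.sub_apply]; ring
    rw [h3]
    linarith

lemma exists_isPrim_of_weak_deriv {g g' : ℝ → ℝ} (hg : MemLp g 2 volI) (hg' : MemLp g' 2 volI)
    (h : ∀ φ, IsTest φ → ∫ x, g x * deriv φ x ∂volI = -∫ x, g' x * φ x ∂volI) :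
    ∃ w, IsPrim w g' ∧ ∀ᵐ x ∂volI, g x = w x := by
  set J := fun x => ∫ t in (-1 : ℝ)..x, g' t with hJ
  have hJp : IsPrim J g' := isPrim_of_eq (a := 0) hg' fun x _ => by simp [hJ]
  obtain ⟨c, hc⟩ := exists_ae_eq_const (hg.sub hJp.memLp_self) fun φ hφ => by
    have h1 := hJp.integral_mul_deriv_test hφ
    simp only [Pi.sub_apply, sub_mul]
    rw [integral_sub (integrable_mul hg hφ.deriv.memLp)
      (integrable_mul hJp.memLp_self hφ.deriv.memLp), h φ hφ, h1, sub_self]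
  refine ⟨fun x => c + J x, isPrim_of_eq (a := c) hg' fun x _ => rfl, ?_⟩
  filter_upwards [hc] with x hx
  rw [Pi.sub_apply] at hx
  linarith

lemma IsPrim.congr_right {w g g' : ℝ → ℝ} (h : IsPrim w g) (hg : ∀ᵐ x ∂volI, g x = g' x) :
    IsPrim w g' := by
  refine ⟨h.memLp.ae_eq hg, fun x hx => ?_⟩
  rw [h.eq_add x hx]
  congr 1
  refine intervalIntegral.integral_congr_ae ?_
  rw [volI_eq_restrict_Icc, ae_restrict_iff' measurableSet_Icc] at hg
  filter_upwards [hg] with t ht ht'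
  rw [uIoc_of_le hx.1] at ht'
  exact ht ⟨ht'.1.le, ht'.2.trans hx.2⟩

lemma eqOn_Icc_of_ae_eq {v w : ℝ → ℝ} (hv : ContinuousOn v (Icc (-1) 1))
    (hw : ContinuousOn w (Icc (-1) 1)) (h : ∀ᵐ x ∂volI, v x = w x) : EqOn v w (Icc (-1) 1) := by
  rw [volI_eq_restrict_Icc] at h
  exact Measure.eqOn_Icc_of_ae_eq volume (by norm_num) h hv hw

lemma IsPrim.congr_left {w v g : ℝ → ℝ} (h : IsPrim w g) (hv : EqOn v w (Icc (-1) 1)) :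
    IsPrim v g := by
  refine ⟨h.memLp, fun x hx => ?_⟩
  rw [hv hx, hv neg_one_mem_Icc, h.eq_add x hx]

/-- Each level of the tower is defined by testing `v` only; using level j with φ' and level j + 1
with φ links consecutive levels. -/
lemma IsWeakDerivTower.weak_deriv_succ {k : ℕ} {v : ℝ → ℝ} {g : ℕ → ℝ → ℝ}
    (H : IsWeakDerivTower k v g) {j : ℕ} (hj : j < k) {φ : ℝ → ℝ} (hφ : IsTest φ) :
    ∫ x, g j x * deriv φ x ∂volI = -∫ x, g (j + 1) x * φ x ∂volI := by
  have h1 := (H.2 j hj.le).2 _ hφ.deriv.contDiff hφ.deriv.compact hφ.deriv.subset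
  have h2 := (H.2 (j + 1) hj).2 _ hφ.contDiff hφ.compact hφ.subset
  rw [iteratedDeriv_succ', h1, pow_succ] at h2
  have h3 : ((-1 : ℝ) ^ j) * (-1) ^ j = 1 := by rw [← mul_pow]; simp
  have h4 := congrArg (fun y => (-1 : ℝ) ^ j * y) h2
  simp only [← mul_assoc, h3, one_mul] at h4
  linarith

/-- The strict inequality provides a tower whose norms are below B; its members are then replaced by
continuous representatives, each a primitive of the next. Only the integer part of the order is
used, and the Gagliardo term is discarded. -/
lemma exists_sobChain {m B : ℝ} {k : ℕ} (hk : k ≤ ⌊m⌋₊) {v : ℝ → ℝ}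
    (hv : ContinuousOn v (Icc (-1) 1)) (hB : sobolevNorm m v < ENNReal.ofReal B) :
    ∃ h, SobChain k h B ∧ h 0 = v := by
  rw [sobolevNorm, iInf_lt_iff] at hB
  obtain ⟨g, hB⟩ := hB
  rw [iInf_lt_iff] at hB
  obtain ⟨H, hB⟩ := hB
  have hB0 : 0 < B := by
    by_contra h
    rw [ENNReal.ofReal_of_nonpos (not_lt.1 h)] at hB
    exact not_lt_zero hB
  have hbound : ∀ j ≤ ⌊m⌋₊, normL2 (g j) ≤ B := by
    intro j hj
    have h1 : (∫⁻ x, ENNReal.ofReal ((g j x) ^ 2) ∂volI) ^ (1 / 2 : ℝ) ≤ ENNReal.ofReal B := by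
      refine le_trans (ENNReal.rpow_le_rpow ?_ (by norm_num)) hB.le
      refine le_trans ?_ le_self_add
      exact Finset.single_le_sum (f := fun j => ∫⁻ x, ENNReal.ofReal ((g j x) ^ 2) ∂volI)
        (fun _ _ => zero_le) (Finset.mem_range.2 (Nat.lt_succ_of_le hj))
    rw [normL2, integral_eq_lintegral_of_nonneg_ae (ae_of_all _ fun _ => sq_nonneg _)
      (H.2 j hj).1.integrable_sq.aestronglyMeasurable, Real.sqrt_eq_rpow, ENNReal.toReal_rpow]
    exact ENNReal.toReal_le_of_le_ofReal hB0.le h1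
  have hw : ∀ i, ∃ w, i < ⌊m⌋₊ → IsPrim w (g (i + 1)) ∧ ∀ᵐ x ∂volI, g i x = w x := by
    intro i
    by_cases hi : i < ⌊m⌋₊
    · obtain ⟨w, hw⟩ := exists_isPrim_of_weak_deriv (H.2 i hi.le).1 (H.2 (i + 1) hi).1
        fun φ hφ => H.weak_deriv_succ hi hφ
      exact ⟨w, fun _ => hw⟩
    · exact ⟨0, fun h => absurd h hi⟩
  choose w hw using hw
  have hvw : 0 < ⌊m⌋₊ → EqOn v (w 0) (Icc (-1) 1) := fun h0 =>
    eqOn_Icc_of_ae_eq hv (hw 0 h0).1.continuousOn (by rw [← H.1]; exact (hw 0 h0).2)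
  -- Index 0 must be `v` itself, intermediate indices take the continuous representatives, and the
  -- top derivative is only in L².
  set h : ℕ → ℝ → ℝ := fun i => if i = 0 then v else if i < ⌊m⌋₊ then w i else g i with hh
  have hae : ∀ i, ∀ᵐ x ∂volI, g i x = h i x := by
    intro i
    simp only [hh]
    split_ifs with h1 h2
    · subst h1; rw [H.1]; exact ae_of_all _ fun _ => rfl
    · exact (hw i h2).2
    · exact ae_of_all _ fun _ => rfl
  refine ⟨h, ⟨fun i hi => ?_, fun i hi => ?_, fun i hi => ?_⟩, by simp [hh]⟩
  · have hi' : i < ⌊m⌋₊ := lt_of_lt_of_le hi hk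
    refine IsPrim.congr_right ?_ (hae (i + 1))
    simp only [hh]
    split_ifs with h1
    · subst h1
      exact (hw 0 hi').1.congr_left (hvw hi')
    · exact (hw i hi').1
  · exact (H.2 i (hi.trans hk)).1.ae_eq (hae i)
  · rw [← normL2_congr (hae i)]
    exact hbound i (hi.trans hk)

/-! ### Operations on chains of derivatives, and bounds uniform in time -/

lemma SobChain.add {k : ℕ} {h h' : ℕ → ℝ → ℝ} {B B' : ℝ} (H : SobChain k h B)
    (H' : SobChain k h' B') : SobChain k (fun i x => h i x + h' i x) (B + B') :=
  ⟨fun i hi => (H.prim i hi).add (H'.prim i hi), fun i hi => (H.memLp i hi).add (H'.memLp i hi),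
    fun i hi => (normL2_add_le (H.memLp i hi) (H'.memLp i hi)).trans
      (add_le_add (H.bound i hi) (H'.bound i hi))⟩

lemma SobChain.const_mul {k : ℕ} {h : ℕ → ℝ → ℝ} {B : ℝ} (H : SobChain k h B) (a : ℝ) :
    SobChain k (fun i x => a * h i x) (|a| * B) :=
  ⟨fun i hi => (H.prim i hi).const_mul a, fun i hi => (H.memLp i hi).const_mul a,
    fun i hi => by
      rw [normL2_const_mul]
      exact mul_le_mul_of_nonneg_left (H.bound i hi) (abs_nonneg a)⟩

lemma SobChain.mono {k : ℕ} {h : ℕ → ℝ → ℝ} {B B' : ℝ} (H : SobChain k h B) (hB : B ≤ B') :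
    SobChain k h B' :=
  ⟨H.prim, H.memLp, fun i hi => (H.bound i hi).trans hB⟩

lemma SobChain.abs_le {k : ℕ} {h : ℕ → ℝ → ℝ} {B : ℝ} (H : SobChain (k + 1) h B) {x : ℝ}
    (hx : x ∈ Icc (-1 : ℝ) 1) : |h 0 x| ≤ 5 * B := by
  have := (H.prim 0 (by omega)).abs_le hx
  have := H.bound 0 (by omega)
  have := H.bound 1 (by omega)
  simp only [zero_add] at *
  linarith

/-- A uniform Sobolev bound for a function in `C([0, T]; H^m(I))`. -/
lemma ContinuousInSobolev.exists_bound {T m : ℝ} {w : ℝ → ℝ → ℝ} (hw : ContinuousInSobolev T m w)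
    {k : ℕ} (hk : k ≤ ⌊m⌋₊) : ∃ B : ℝ, ∀ t ∈ Icc 0 T, ∃ h, SobChain k h B ∧ h 0 = w t := by
  refine (isCompact_Icc (a := (0 : ℝ)) (b := T)).induction_on
    (p := fun s => ∃ B : ℝ, ∀ t ∈ s, t ∈ Icc 0 T → ∃ h, SobChain k h B ∧ h 0 = w t)
    ⟨0, fun _ h => absurd h (notMem_empty _)⟩ (fun s t hst ⟨B, hB⟩ => ⟨B, fun x hx => hB x (hst hx)⟩)
    (fun s t ⟨B, hB⟩ ⟨B', hB'⟩ => ⟨max B B', fun x hx hxT => ?_⟩) (fun t ht => ?_) |>.imp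
    fun B hB t ht => hB t ht ht
  · rcases hx with hx | hx
    · obtain ⟨h, H, H0⟩ := hB x hx hxT
      exact ⟨h, H.mono (le_max_left _ _), H0⟩
    · obtain ⟨h, H, H0⟩ := hB' x hx hxT
      exact ⟨h, H.mono (le_max_right _ _), H0⟩
  · obtain ⟨hc, hlt⟩ := hw.1 t ht
    obtain ⟨h, H, H0⟩ := exists_sobChain hk hc (B := (sobolevNorm m (w t)).toReal + 1) (by
      refine (ENNReal.lt_ofReal_iff_toReal_lt hlt.ne).2 (by linarith))
    -- Near t the increment has norm below 1, so the bound at t plus 1 serves locally; compactness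
    -- then makes it global.
    have h1 : ∀ᶠ s in 𝓝[Icc 0 T] t, sobolevNorm m (w s - w t) < ENNReal.ofReal 1 :=
      (hw.2 t ht).eventually_lt_const (by simp)
    refine ⟨{s | s ∈ Icc 0 T ∧ sobolevNorm m (w s - w t) < ENNReal.ofReal 1}, ?_,
      1 + ((sobolevNorm m (w t)).toReal + 1), fun s hs hsT => ?_⟩
    · filter_upwards [h1, self_mem_nhdsWithin] with s hs hs' using ⟨hs', hs⟩
    · obtain ⟨h', H', H0'⟩ := exists_sobChain hk ((hw.1 s hsT).1.sub hc) hs.2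
      refine ⟨_, H'.add H, ?_⟩
      ext x
      simp [H0, H0']

/-- Convergence in `C([0, T]; H^m(I))` implies uniform convergence on `[-1, 1]`. -/
lemma ContinuousInSobolev.eventually_abs_sub_le {T m : ℝ} {w : ℝ → ℝ → ℝ}
    (hw : ContinuousInSobolev T m w) (hm : 1 ≤ ⌊m⌋₊) {t : ℝ} (ht : t ∈ Icc 0 T) {ε : ℝ}
    (hε : 0 < ε) : ∀ᶠ s in 𝓝[Icc 0 T] t, ∀ x ∈ Icc (-1 : ℝ) 1, |w s x - w t x| ≤ ε := by
  have h1 : ∀ᶠ s in 𝓝[Icc 0 T] t, sobolevNorm m (w s - w t) < ENNReal.ofReal (ε / 5) :=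
    (hw.2 t ht).eventually_lt_const (by simpa using hε)
  filter_upwards [h1, self_mem_nhdsWithin] with s hs hs' x hx
  obtain ⟨h, H, H0⟩ := exists_sobChain (k := 1) hm ((hw.1 s hs').1.sub (hw.1 t ht).1) hs
  have := H.abs_le hx
  rw [H0] at this
  simp only [Pi.sub_apply] at this
  linarith

/-- Two integrations by parts with the weak second derivative. -/
lemma integral_weakDeriv_two_mul {k : ℕ} {h : ℕ → ℝ → ℝ} {B : ℝ} (H : SobChain (k + 2) h B)
    (h1 : h 0 1 = 0) (h2 : h 0 (-1) = 0) {w : ℝ → ℝ} (hw : MemLp w 2 volI)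
    (hweak : IsWeakDeriv 2 (h 0) w) {q : ℝ[X]} (hq1 : q.eval 1 = 0) (hq2 : q.eval (-1) = 0) :
    ∫ x, w x * q.eval x ∂volI = ∫ x, h 0 x * (derivative (derivative q)).eval x ∂volI := by
  have p0 := H.prim 0 (by omega)
  have p1 := H.prim 1 (by omega)
  simp only [zero_add] at p0
  have e1 : ∀ᵐ x ∂volI, w x = h 2 x := by
    have := ae_eq_zero_of_integral_mul_test (hw.sub p1.memLp) fun φ hφ => by
      have h3 := hweak φ hφ.contDiff hφ.compact hφ.subset
      rw [iteratedDeriv_succ, iteratedDeriv_one, p0.integral_mul_deriv_test hφ.deriv,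
        p1.integral_mul_deriv_test hφ] at h3
      simp only [Pi.sub_apply, sub_mul]
      rw [integral_sub (integrable_mul hw hφ.memLp) (integrable_mul p1.memLp hφ.memLp)]
      norm_num at h3
      simp [h3]
    filter_upwards [this] with x hx
    exact sub_eq_zero.1 hx
  have e2 : ∫ x, w x * q.eval x ∂volI = ∫ x, h 2 x * q.eval x ∂volI :=
    integral_congr_ae (e1.mono fun x hx => by simp only [hx])
  have e3 := p1.integral_mul_deriv (isPrim_eval q)
  have e4 := p0.integral_mul_deriv (isPrim_eval (derivative q))
  rw [hq1, hq2] at e3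
  rw [h1, h2] at e4
  simp only [one_add_one_eq_two] at e3
  rw [e2, e4, e3]
  ring


/-! ### The weights of the convolution quadrature -/

lemma cqWeight_zero (β : ℝ) : cqWeight β 0 = 1 := by simp [cqWeight]

lemma cqWeight_succ (β : ℝ) (n : ℕ) :
    cqWeight β (n + 1) * (n + 1) = cqWeight β n * (n - β) := by
  have h1 := Ring.choose_smul_choose β (Nat.le_succ n)
  have h2 : n.succ - n = 1 := by omega
  rw [Nat.choose_succ_self_right, h2, Ring.choose_one_right, nsmul_eq_mul] at h1
  simp only [cqWeight, pow_succ]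
  push_cast at h1
  linear_combination (-(-1) ^ n) * h1

/-- The partial sums of the weights. -/
def cqSum (β : ℝ) (n : ℕ) : ℝ := ∑ i ∈ Finset.range (n + 1), cqWeight β i

lemma cqSum_zero (β : ℝ) : cqSum β 0 = 1 := by simp [cqSum, cqWeight_zero]

lemma cqSum_succ' (β : ℝ) (n : ℕ) : cqSum β (n + 1) = cqSum β n + cqWeight β (n + 1) := by
  rw [cqSum, Finset.sum_range_succ, ← cqSum]

lemma cqWeight_succ_eq (β : ℝ) (n : ℕ) : cqWeight β (n + 1) * (n + 1) = -β * cqSum β n := by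
  induction n with
  | zero => have := cqWeight_succ β 0; simp [cqWeight_zero, cqSum_zero] at *; linarith
  | succ n ih =>
    have h1 := cqWeight_succ β (n + 1)
    have h2 : (n + 1 : ℝ) ≠ 0 := by positivity
    rw [cqSum_succ']
    push_cast at *
    refine mul_right_cancel₀ h2 ?_
    linear_combination (n + 1 : ℝ) * h1 + (n + 1 : ℝ) * ih

/-- The partial sums are the coefficients of (1 - z)^(β-1); this recurrence governs their positivity
and their asymptotics. -/
lemma cqSum_succ (β : ℝ) (n : ℕ) : cqSum β (n + 1) * (n + 1) = cqSum β n * (n + 1 - β) := by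
  rw [cqSum_succ']
  linear_combination cqWeight_succ_eq β n

lemma cqSum_pos {β : ℝ} (hβ : β < 1) (n : ℕ) : 0 < cqSum β n := by
  induction n with
  | zero => simp [cqSum_zero]
  | succ n ih =>
    have h1 := cqSum_succ β n
    have h2 : 0 < cqSum β n * (n + 1 - β) := mul_pos ih (by have := n.cast_nonneg (α := ℝ); linarith)
    rw [← h1] at h2
    exact pos_of_mul_pos_left h2 (by positivity)

lemma cqSum_antitone {β : ℝ} (hβ₀ : 0 ≤ β) (hβ : β < 1) : Antitone (cqSum β) := by
  refine antitone_nat_of_succ_le fun n => ?_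
  have h1 := cqWeight_succ_eq β n
  have h2 := cqSum_pos hβ n
  rw [cqSum_succ']
  have h3 : cqWeight β (n + 1) * (n + 1) ≤ 0 := by rw [h1]; nlinarith
  have : cqWeight β (n + 1) ≤ 0 := nonpos_of_mul_nonpos_left h3 (by positivity)
  linarith

/-- With ϖ_0 = 1 and positive partial sums, this sign pattern underlies both the comparison
principle and the coercivity. -/
lemma cqWeight_succ_nonpos {β : ℝ} (hβ₀ : 0 ≤ β) (hβ : β < 1) (n : ℕ) :
    cqWeight β (n + 1) ≤ 0 := by
  have := cqSum_antitone hβ₀ hβ (Nat.le_succ n)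
  rw [cqSum_succ'] at this
  linarith

/-- Exact value of the quadrature on a linear function, as the coefficient of z (1 - z)^(β-2).
Together with the quadratic case it reduces all needed moments of the weights to their partial sums.
-/
lemma sum_cqWeight_mul_sub (β : ℝ) (n : ℕ) :
    (1 - β) * ∑ i ∈ Finset.range (n + 1), cqWeight β i * ((n : ℝ) - i) = n * cqSum β n := by
  induction n with
  | zero => simp
  | succ n ih =>
    rw [Finset.sum_range_succ]
    have h1 : ∑ i ∈ Finset.range (n + 1), cqWeight β i * (((n + 1 : ℕ) : ℝ) - i)
        = (∑ i ∈ Finset.range (n + 1), cqWeight β i * ((n : ℝ) - i)) + cqSum β n := by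
      rw [cqSum, ← Finset.sum_add_distrib]
      refine Finset.sum_congr rfl fun i _ => ?_
      push_cast; ring
    rw [h1]
    push_cast
    linear_combination ih - cqSum_succ β n

lemma sum_cqWeight_mul_sub_sq (β : ℝ) (n : ℕ) :
    (1 - β) * (2 - β) * ∑ i ∈ Finset.range (n + 1), cqWeight β i * ((n : ℝ) - i) ^ 2
      = n * (2 * n - β) * cqSum β n := by
  induction n with
  | zero => simp
  | succ n ih =>
    rw [Finset.sum_range_succ]
    have h1 : ∑ i ∈ Finset.range (n + 1), cqWeight β i * (((n + 1 : ℕ) : ℝ) - i) ^ 2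
        = (∑ i ∈ Finset.range (n + 1), cqWeight β i * ((n : ℝ) - i) ^ 2)
          + 2 * (∑ i ∈ Finset.range (n + 1), cqWeight β i * ((n : ℝ) - i)) + cqSum β n := by
      rw [cqSum, Finset.mul_sum, ← Finset.sum_add_distrib, ← Finset.sum_add_distrib]
      refine Finset.sum_congr rfl fun i _ => ?_
      push_cast; ring
    rw [h1]
    push_cast
    linear_combination ih + 2 * (2 - β) * sum_cqWeight_mul_sub β n
      - (2 * n + 2 - β) * cqSum_succ β n

/-! ### Asymptotics of the partial sums -/

/-- Second-order Taylor bound for `(1 + h) ^ a`. -/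
lemma exists_abs_one_add_rpow_sub_le (a : ℝ) : ∃ C : ℝ, 0 ≤ C ∧ ∀ h : ℝ, |h| ≤ 1 / 2 →
    |(1 + h) ^ a - 1| ≤ C * |h| ∧ |(1 + h) ^ a - 1 - a * h| ≤ C * h ^ 2 := by
  have key : ∀ (a : ℝ), ∃ C : ℝ, 0 ≤ C ∧ ∀ h : ℝ, |h| ≤ 1 / 2 → |(1 + h) ^ a - 1| ≤ C * |h| := by
    intro a
    have hc : ContinuousOn (fun h : ℝ => a * (1 + h) ^ (a - 1)) (Icc (-(1 / 2)) (1 / 2)) := by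
      refine continuousOn_const.mul (ContinuousOn.rpow_const (by fun_prop) fun x hx => Or.inl ?_)
      have := hx.1
      linarith
    obtain ⟨C, hC⟩ := isCompact_Icc.exists_bound_of_continuousOn hc
    refine ⟨C, (norm_nonneg _).trans (hC 0 (by norm_num)), fun h hh => ?_⟩
    have h1 := (convex_Icc (-(1 / 2) : ℝ) (1 / 2)).norm_image_sub_le_of_norm_hasDerivWithin_le
      (f := fun h : ℝ => (1 + h) ^ a) (f' := fun h => a * (1 + h) ^ (a - 1)) (C := C)
      (x := 0) (y := h) (fun x hx => by
        have h2 : HasDerivAt (fun h : ℝ => 1 + h) 1 x := (hasDerivAt_id x).const_add 1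
        have h3 := h2.rpow_const (p := a) (Or.inl (by have := hx.1; linarith))
        simpa using h3.hasDerivWithinAt) hC (by norm_num) (abs_le.1 hh)
    simpa using h1
  obtain ⟨C, hC, h1⟩ := key a
  obtain ⟨C', hC', h2⟩ := key (a - 1)
  refine ⟨max C (|a| * C'), le_max_of_le_left hC, fun h hh => ⟨(h1 h hh).trans
    (mul_le_mul_of_nonneg_right (le_max_left _ _) (abs_nonneg h)), ?_⟩⟩
  have hsub : ∀ x ∈ Icc (-|h|) |h|, |x| ≤ |h| := fun x hx => abs_le.2 hx
  have h3 := (convex_Icc (-|h|) |h|).norm_image_sub_le_of_norm_hasDerivWithin_le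
      (f := fun h : ℝ => (1 + h) ^ a - a * h) (f' := fun h => a * (1 + h) ^ (a - 1) - a)
      (C := |a| * C' * |h|)
      (x := 0) (y := h) (fun x hx => by
        have h2 : HasDerivAt (fun h : ℝ => 1 + h) 1 x := (hasDerivAt_id x).const_add 1
        have h3 := h2.rpow_const (p := a) (Or.inl (by
          have := (abs_le.1 ((hsub x hx).trans hh)).1; linarith))
        have h4 : HasDerivAt (fun h : ℝ => a * h) a x := by
          simpa using (hasDerivAt_id x).const_mul a
        exact (h3.sub h4).hasDerivWithinAt.congr_deriv (by ring)) (fun x hx => by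
          have := h2 x ((hsub x hx).trans hh)
          rw [show a * (1 + x) ^ (a - 1) - a = a * ((1 + x) ^ (a - 1) - 1) by ring, norm_mul,
            mul_assoc]
          exact mul_le_mul_of_nonneg_left (this.trans
            (mul_le_mul_of_nonneg_left (hsub x hx) hC')) (norm_nonneg a))
        (by simp) ⟨neg_abs_le h, le_abs_self h⟩
  have h4 : |(1 + h) ^ a - 1 - a * h| ≤ |a| * C' * |h| * |h| := by
    simpa [sub_right_comm] using h3
  refine h4.trans ?_
  rw [mul_assoc, ← sq, sq_abs]
  exact mul_le_mul_of_nonneg_right (le_max_right _ _) (sq_nonneg h)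

/-- In a difference symmetric about m the even Taylor terms cancel, so the error is cubic. -/
lemma abs_log_add_sub_log_sub_le {a m : ℝ} (ha : 0 ≤ a) (ha' : a ≤ 1 / 2) (hm : 1 ≤ m) :
    |Real.log (m + a) - Real.log (m - a) - 2 * (a / m)| ≤ 1 / (2 * m ^ 3) := by
  have hm0 : 0 < m := by linarith
  set t := a / m with ht
  have ht0 : 0 ≤ t := by positivity
  have ht1 : t ≤ 1 / 2 := by
    rw [ht, div_le_iff₀ hm0]; nlinarith
  have habs : |t| = t := abs_of_nonneg ht0
  have e1 : Real.log (m + a) = Real.log m + Real.log (1 + t) := by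
    rw [← Real.log_mul hm0.ne' (by linarith)]
    congr 1
    rw [ht]; field_simp
  have e2 : Real.log (m - a) = Real.log m + Real.log (1 - t) := by
    rw [← Real.log_mul hm0.ne' (by linarith)]
    congr 1
    rw [ht]; field_simp
  have h1 := Real.abs_log_sub_add_sum_range_le (x := t) (by rw [habs]; linarith) 2
  have h2 := Real.abs_log_sub_add_sum_range_le (x := -t) (by rw [abs_neg, habs]; linarith) 2
  simp only [Finset.sum_range_succ, Finset.sum_range_zero, abs_neg, habs, sub_neg_eq_add] at h1 h2
  have h3 : t ^ (2 + 1) / (1 - t) ≤ 1 / (4 * m ^ 3) := by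
    have h5 : t ^ 3 ≤ 1 / (8 * m ^ 3) := by
      rw [ht, div_pow, div_le_div_iff₀ (by positivity) (by positivity)]
      have : a ^ 3 ≤ (1 / 2) ^ 3 := pow_le_pow_left₀ ha ha' 3
      have hm3 : 0 < m ^ 3 := by positivity
      nlinarith
    rw [div_le_iff₀ (by linarith)]
    have h6 : (1 : ℝ) / (8 * m ^ 3) = 1 / (4 * m ^ 3) * (1 / 2) := by field_simp; norm_num
    rw [h6] at h5
    refine h5.trans (mul_le_mul_of_nonneg_left (by linarith) (by positivity))
  rw [e1, e2]
  have h4 : (1 : ℝ) / (2 * m ^ 3) = 1 / (4 * m ^ 3) + 1 / (4 * m ^ 3) := by field_simp; norm_num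
  rw [h4]
  rw [abs_le] at h1 h2 ⊢
  norm_num at h1 h2 h3 ⊢
  constructor <;> nlinarith [h1.1, h1.2, h2.1, h2.2]

/-- The sequences y + c g and y - c g are monotone in opposite directions with the common limit L.
-/
lemma abs_sub_le_of_abs_sub_succ_le {y g : ℕ → ℝ} {L c : ℝ} (hy : Tendsto y atTop (𝓝 L))
    (hg : Tendsto g atTop (𝓝 0)) (h : ∀ n, |y (n + 1) - y n| ≤ c * (g n - g (n + 1))) (n : ℕ) :
    |y n - L| ≤ c * g n := by
  have h1 : Antitone fun n => y n + c * g n :=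
    antitone_nat_of_succ_le fun n => by have := (abs_le.1 (h n)).2; linarith
  have h2 : Monotone fun n => y n - c * g n :=
    monotone_nat_of_le_succ fun n => by have := (abs_le.1 (h n)).1; linarith
  have h3 := h1.le_of_tendsto (by simpa using hy.add (hg.const_mul c)) n
  have h4 := h2.ge_of_tendsto (by simpa using hy.sub (hg.const_mul c)) n
  rw [abs_le]
  constructor <;> linarith

lemma prod_range_eq_cqSum (β : ℝ) (n : ℕ) :
    ∏ j ∈ Finset.range (n + 1), (1 - β + j) = cqSum β (n + 1) * (n + 1) * (n.factorial : ℝ) := by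
  induction n with
  | zero => have := cqSum_succ β 0; simp [cqSum_zero] at *; linarith
  | succ n ih =>
    rw [Finset.prod_range_succ, ih, Nat.factorial_succ]
    have := cqSum_succ β (n + 1)
    push_cast at *
    linear_combination (-(n + 1) * (n.factorial : ℝ)) * this

/-- Euler's limit formula for Γ(1 - β). The shift (1 - β)/2 does not affect the limit; it is the one
that removes the first-order correction in `exists_abs_cqSum_sub_le`. -/
lemma tendsto_cqSum_mul {β : ℝ} (hβ₀ : 0 < β) (hβ : β < 1) :
    Tendsto (fun n : ℕ => cqSum β n * (n + (1 - β) / 2) ^ β) atTop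
      (𝓝 (1 / Real.Gamma (1 - β))) := by
  have hG : Real.Gamma (1 - β) ≠ 0 := (Real.Gamma_pos_of_pos (by linarith)).ne'
  rw [← tendsto_add_atTop_iff_nat 1]
  have h0 : Tendsto (fun n : ℕ => (1 : ℝ) / (n + 1)) atTop (𝓝 0) :=
    tendsto_one_div_add_atTop_nhds_zero_nat
  have h1 : Tendsto (fun n : ℕ => ((1 : ℝ) - 1 / (n + 1)) ^ (1 - β)) atTop (𝓝 1) := by
    have := (h0.const_sub 1).rpow_const (p := 1 - β) (Or.inr (by linarith))
    simpa using this
  have h2 : Tendsto (fun n : ℕ => ((1 : ℝ) + (1 - β) / 2 * (1 / (n + 1))) ^ β) atTop (𝓝 1) := by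
    have := ((h0.const_mul ((1 - β) / 2)).const_add 1).rpow_const (p := β) (Or.inr hβ₀.le)
    simpa using this
  have h3 := ((Real.GammaSeq_tendsto_Gamma (1 - β)).inv₀ hG).mul (h1.mul h2)
  rw [mul_one, mul_one, ← one_div] at h3
  refine h3.congr' ?_
  filter_upwards [eventually_ge_atTop 1] with n hn
  have hn0 : (0 : ℝ) < n := by exact_mod_cast hn
  have hb := cqSum_pos hβ (n + 1)
  have hf : (0 : ℝ) < n.factorial := by exact_mod_cast n.factorial_pos
  rw [Real.GammaSeq, prod_range_eq_cqSum]
  have e1 : (1 : ℝ) - 1 / (n + 1) = n / (n + 1) := by field_simp; ring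
  have e2 : (1 : ℝ) + (1 - β) / 2 * (1 / (n + 1)) = (n + 1 + (1 - β) / 2) / (n + 1) := by
    field_simp
  have hd : (0 : ℝ) ≤ n + 1 + (1 - β) / 2 := by linarith
  rw [e1, e2, Real.div_rpow hn0.le (by positivity), Real.div_rpow hd (by positivity),
    inv_div]
  have hp1 : (0 : ℝ) < (n : ℝ) ^ (1 - β) := by positivity
  have hp2 : (0 : ℝ) < ((n : ℝ) + 1) ^ β := by positivity
  have e3 : ((n : ℝ) + 1) ^ (1 - β) * ((n : ℝ) + 1) ^ β = n + 1 := by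
    rw [← Real.rpow_add (by positivity), sub_add_cancel, Real.rpow_one]
  have hp3 : (0 : ℝ) < ((n : ℝ) + 1) ^ (1 - β) := by positivity
  push_cast
  field_simp
  linear_combination (-((((n : ℝ) + 1) * 2 + (1 - β)) / 2) ^ β) * e3

lemma abs_exp_sub_one_le {d c : ℝ} (hd : |d| ≤ c) : |Real.exp d - 1| ≤ |d| * Real.exp c := by
  have hc : 1 ≤ Real.exp c := Real.one_le_exp ((abs_nonneg d).trans hd)
  have hd' : Real.exp d ≤ Real.exp c := Real.exp_le_exp.2 ((le_abs_self d).trans hd)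
  have h1 := Real.add_one_le_exp d
  have h2 := Real.add_one_le_exp (-d)
  have h3 : Real.exp d * Real.exp (-d) = 1 := by rw [← Real.exp_add]; simp
  have h4 : Real.exp d - 1 ≤ d * Real.exp d := by nlinarith [Real.exp_pos d]
  rw [abs_le]
  constructor
  · nlinarith [neg_abs_le d, abs_nonneg d]
  · nlinarith [le_abs_self d, abs_nonneg d, Real.exp_pos d]

/-- The expansion `Γ(1 - β) n^β b_n = 1 - β(1 - β) / (2n) + O(n⁻²)`. -/
lemma exists_abs_cqSum_sub_le {β : ℝ} (hβ₀ : 0 < β) (hβ : β < 1) : ∃ C : ℝ, 0 ≤ C ∧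
    ∀ n : ℕ, 1 ≤ n →
      |Real.Gamma (1 - β) * (n : ℝ) ^ β * cqSum β n - (1 - β * (1 - β) / (2 * n))|
        ≤ C / (n : ℝ) ^ 2 := by
  have hG : 0 < Real.Gamma (1 - β) := Real.Gamma_pos_of_pos (by linarith)
  set δ := (1 - β) / 2 with hδ
  have hδ0 : 0 < δ := by rw [hδ]; linarith
  have hδ1 : δ ≤ 1 / 2 := by rw [hδ]; linarith
  set x : ℕ → ℝ := fun n => cqSum β n * (n + δ) ^ β with hx
  have hx0 : ∀ n, 0 < x n := fun n => mul_pos (cqSum_pos hβ n) (by positivity)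
  have hlim : Tendsto (fun n => Real.log (x (n + 1))) atTop
      (𝓝 (Real.log (1 / Real.Gamma (1 - β)))) :=
    (((tendsto_cqSum_mul hβ₀ hβ).comp (tendsto_add_atTop_nat 1)).log (by positivity))
  have hlogx : ∀ n : ℕ, Real.log (x n) = Real.log (cqSum β n) + β * Real.log (n + δ) := fun n => by
    rw [hx]
    simp only
    rw [Real.log_mul (cqSum_pos hβ n).ne' (by positivity), Real.log_rpow (by positivity)]
  have hdiff : ∀ n : ℕ, |Real.log (x (n + 1 + 1)) - Real.log (x (n + 1))|
      ≤ 1 * (1 / ((n : ℝ) + 1) ^ 2 - 1 / (((n + 1 : ℕ) : ℝ) + 1) ^ 2) := by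
    intro n
    have hn := n.cast_nonneg (α := ℝ)
    -- Common centre of the two ratios: the quotient of successive partial sums is (m - β/2)/(m +
    -- β/2), and that of the shifted arguments is (m + 1/2)/(m - 1/2). Their first-order logarithmic
    -- terms cancel once the second is multiplied by β.
    set m : ℝ := n + 2 - β / 2 with hm
    have hm1 : 1 ≤ m := by rw [hm]; linarith
    have l1 := abs_log_add_sub_log_sub_le (a := β / 2) (m := m) (by linarith) (by linarith) hm1
    have l2 := abs_log_add_sub_log_sub_le (a := 1 / 2) (m := m) (by norm_num) le_rfl hm1
    have l3 : Real.log (cqSum β (n + 1 + 1)) + Real.log (m + β / 2)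
        = Real.log (cqSum β (n + 1)) + Real.log (m - β / 2) := by
      rw [← Real.log_mul (cqSum_pos hβ _).ne' (by linarith),
        ← Real.log_mul (cqSum_pos hβ _).ne' (by linarith)]
      have := cqSum_succ β (n + 1)
      push_cast at this
      congr 1
      rw [hm]
      linear_combination this
    have e1 : ((n + 1 + 1 : ℕ) : ℝ) + δ = m + 1 / 2 := by rw [hm, hδ]; push_cast; ring
    have e2 : ((n + 1 : ℕ) : ℝ) + δ = m - 1 / 2 := by rw [hm, hδ]; push_cast; ring
    rw [hlogx, hlogx, e1, e2]
    -- The cubic error is dominated by a telescoping difference, which sums to O(n^(-2)).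
    have hM : (1 : ℝ) / (2 * m ^ 3) + 1 / (2 * m ^ 3) ≤ 1 / ((n : ℝ) + 1) ^ 2
        - 1 / (((n + 1 : ℕ) : ℝ) + 1) ^ 2 := by
      have h1 : (n : ℝ) + 3 / 2 ≤ m := by rw [hm]; linarith
      have h2 : (1 : ℝ) / m ^ 3 ≤ 1 / ((n : ℝ) + 3 / 2) ^ 3 :=
        one_div_le_one_div_of_le (by positivity) (pow_le_pow_left₀ (by positivity) h1 3)
      have h3 : (1 : ℝ) / (2 * m ^ 3) + 1 / (2 * m ^ 3) = 1 / m ^ 3 := by field_simp; norm_num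
      rw [h3]
      refine h2.trans ?_
      push_cast
      rw [div_sub_div _ _ (by positivity) (by positivity), div_le_div_iff₀ (by positivity)
        (by positivity)]
      generalize (n : ℝ) = y at hn
      nlinarith [pow_nonneg hn 2, pow_nonneg hn 3, pow_nonneg hn 4, hn]
    have hβm : β * (1 / (2 * m ^ 3)) ≤ 1 / (2 * m ^ 3) :=
      mul_le_of_le_one_left (by positivity) hβ.le
    have l4 : |β * (Real.log (m + 1 / 2) - Real.log (m - 1 / 2) - 2 * (1 / 2 / m))|
        ≤ 1 / (2 * m ^ 3) := by
      rw [abs_mul, abs_of_pos hβ₀]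
      exact (mul_le_mul_of_nonneg_left l2 hβ₀.le).trans hβm
    rw [one_mul]
    refine le_trans ?_ hM
    have e3 : Real.log (cqSum β (n + 1 + 1)) + β * Real.log (m + 1 / 2) -
        (Real.log (cqSum β (n + 1)) + β * Real.log (m - 1 / 2))
        = β * (Real.log (m + 1 / 2) - Real.log (m - 1 / 2) - 2 * (1 / 2 / m))
          - (Real.log (m + β / 2) - Real.log (m - β / 2) - 2 * (β / 2 / m)) := by
      linear_combination l3
    rw [e3]
    exact (abs_sub _ _).trans (add_le_add l4 l1)
  have hg : Tendsto (fun n : ℕ => 1 / ((n : ℝ) + 1) ^ 2) atTop (𝓝 0) := by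
    have := (tendsto_one_div_add_atTop_nhds_zero_nat (𝕜 := ℝ)).pow 2
    simpa [div_pow] using this
  have hlog := abs_sub_le_of_abs_sub_succ_le hlim hg hdiff
  obtain ⟨C, hC, hT⟩ := exists_abs_one_add_rpow_sub_le (-β)
  refine ⟨Real.exp 1 + C, by positivity, fun n hn => ?_⟩
  obtain ⟨l, rfl⟩ : ∃ l, n = l + 1 := ⟨n - 1, by omega⟩
  have hn0 : (0 : ℝ) < ((l + 1 : ℕ) : ℝ) := by positivity
  have hn1 : (1 : ℝ) ≤ ((l + 1 : ℕ) : ℝ) := by exact_mod_cast hn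
  have h1 := hlog l
  rw [one_mul] at h1
  have hcast : (l : ℝ) + 1 = ((l + 1 : ℕ) : ℝ) := by push_cast; ring
  rw [hcast] at h1
  generalize l + 1 = n at *
  set d := Real.log (x n) - Real.log (1 / Real.Gamma (1 - β)) with hd
  have h2 : |d| ≤ 1 := h1.trans (by
    rw [div_le_one (by positivity)]; exact one_le_pow₀ hn1)
  have h3 := abs_exp_sub_one_le h2
  have h4 : Real.exp d = x n * Real.Gamma (1 - β) := by
    rw [hd, Real.exp_sub, Real.exp_log (hx0 n), Real.exp_log (by positivity)]
    field_simp
  have hh : |δ / n| ≤ 1 / 2 := by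
    rw [abs_of_pos (by positivity), div_le_iff₀ hn0]; nlinarith
  have h5 := (hT (δ / n) hh).2
  have h6 : Real.Gamma (1 - β) * (n : ℝ) ^ β * cqSum β n = Real.exp d * (1 + δ / n) ^ (-β) := by
    have e1 : 1 + δ / n = (n + δ) / n := by field_simp
    rw [h4, e1, Real.rpow_neg (by positivity), Real.div_rpow (by positivity) hn0.le]
    have : (0 : ℝ) < (n + δ) ^ β := by positivity
    simp only [hx]
    field_simp
  have h7 : (1 + δ / n) ^ (-β) ≤ 1 :=
    Real.rpow_le_one_of_one_le_of_nonpos (by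
      have : 0 < δ / n := by positivity
      linarith) (by linarith)
  have h8 : 0 ≤ (1 + δ / n) ^ (-β) := by positivity
  -- The remaining 1/n term comes only from undoing the shift: -β δ/n = -β(1-β)/(2n).
  have e4 : Real.exp d * (1 + δ / n) ^ (-β) - (1 - β * (1 - β) / (2 * n))
      = (Real.exp d - 1) * (1 + δ / n) ^ (-β) + ((1 + δ / n) ^ (-β) - 1 - -β * (δ / n)) := by
    rw [hδ]; field_simp; ring
  rw [h6, e4]
  refine (abs_add_le _ _).trans ?_
  rw [add_div, abs_mul, abs_of_nonneg h8]
  refine add_le_add ?_ ?_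
  · calc |Real.exp d - 1| * (1 + δ / n) ^ (-β) ≤ |Real.exp d - 1| :=
        mul_le_of_le_one_right (abs_nonneg _) h7
      _ ≤ |d| * Real.exp 1 := h3
      _ ≤ 1 / (n : ℝ) ^ 2 * Real.exp 1 := by gcongr
      _ = Real.exp 1 / (n : ℝ) ^ 2 := by ring
  · refine h5.trans ?_
    rw [div_pow, ← mul_div_assoc]
    gcongr
    exact mul_le_of_le_one_right hC (by nlinarith)


/-! ### Riemann--Liouville kernels -/

/-- The kernel `x_+^a / Γ(a + 1)`. -/
def rlKernel (a x : ℝ) : ℝ := if 0 < x then x ^ a / Real.Gamma (a + 1) else 0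

lemma rlKernel_of_pos (a : ℝ) {x : ℝ} (hx : 0 < x) :
    rlKernel a x = x ^ a / Real.Gamma (a + 1) := if_pos hx

lemma rlKernel_of_nonpos (a : ℝ) {x : ℝ} (hx : x ≤ 0) : rlKernel a x = 0 := if_neg hx.not_gt

lemma rlKernel_nonneg {a : ℝ} (ha : -1 < a) (x : ℝ) : 0 ≤ rlKernel a x := by
  unfold rlKernel
  split_ifs with h
  · exact div_nonneg (Real.rpow_nonneg h.le _) (Real.Gamma_pos_of_pos (by linarith)).le
  · exact le_rfl

lemma rlKernel_mono {a : ℝ} (ha : 0 ≤ a) : Monotone (rlKernel a) := by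
  intro x y hxy
  rcases le_or_gt x 0 with h | h
  · rw [rlKernel_of_nonpos a h]
    exact rlKernel_nonneg (by linarith) y
  · rw [rlKernel_of_pos a h, rlKernel_of_pos a (h.trans_le hxy)]
    exact div_le_div_of_nonneg_right (Real.rpow_le_rpow h.le hxy ha)
      (Real.Gamma_pos_of_pos (by linarith)).le

lemma gamma_mul_rlKernel {s x : ℝ} (hs : 0 < s) (hx : 0 ≤ x) :
    Real.Gamma (s + 1) * rlKernel s x = x ^ s := by
  rcases hx.eq_or_lt with rfl | hx
  · rw [rlKernel_of_nonpos s le_rfl, Real.zero_rpow hs.ne', mul_zero]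
  · rw [rlKernel_of_pos s hx, mul_div_cancel₀ _ (Real.Gamma_pos_of_pos (by linarith)).ne']

lemma intervalIntegrable_rlKernel {a : ℝ} (ha : -1 < a) (b c : ℝ) :
    IntervalIntegrable (rlKernel a) volume b c := by
  have h1 : IntervalIntegrable (fun x : ℝ => x ^ a / Real.Gamma (a + 1)) volume b c :=
    (intervalIntegral.intervalIntegrable_rpow' ha).div_const _
  rw [intervalIntegrable_iff] at h1 ⊢
  refine (Integrable.indicator h1 measurableSet_Ioi (s := Ioi (0 : ℝ))).congr (ae_of_all _ fun x => ?_)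
  simp [indicator, rlKernel]

lemma integral_rpow_mul_rpow {a b t : ℝ} (ha : -1 < a) (hb : -1 < b) (ht : 0 < t) :
    ∫ z in (0 : ℝ)..t, (t - z) ^ a * z ^ b
      = t ^ (a + b + 1) * (Real.Gamma (a + 1) * Real.Gamma (b + 1) / Real.Gamma (a + b + 2)) := by
  have h1 := Complex.betaIntegral_scaled ((b + 1 : ℝ) : ℂ) ((a + 1 : ℝ) : ℂ) ht
  rw [Complex.betaIntegral_eq_Gamma_mul_div _ _ (by rw [Complex.ofReal_re]; linarith)
    (by rw [Complex.ofReal_re]; linarith), ← Complex.ofReal_add, Complex.Gamma_ofReal,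
    Complex.Gamma_ofReal, Complex.Gamma_ofReal, ← Complex.ofReal_one, ← Complex.ofReal_sub,
    ← Complex.ofReal_sub, ← Complex.ofReal_sub, ← Complex.ofReal_cpow ht.le] at h1
  have h2 : ∫ x in (0 : ℝ)..t, (x : ℂ) ^ ((b + 1 - 1 : ℝ) : ℂ)
        * ((t : ℂ) - x) ^ ((a + 1 - 1 : ℝ) : ℂ)
      = ∫ x in (0 : ℝ)..t, (((t - x) ^ a * x ^ b : ℝ) : ℂ) := by
    refine intervalIntegral.integral_congr fun x hx => ?_
    rw [uIcc_of_le ht.le] at hx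
    rw [← Complex.ofReal_sub, ← Complex.ofReal_cpow hx.1, ← Complex.ofReal_cpow (by linarith [hx.2]),
      ← Complex.ofReal_mul, mul_comm, add_sub_cancel_right, add_sub_cancel_right]
  rw [h2, intervalIntegral.integral_ofReal] at h1
  have h3 := Complex.ofReal_injective (h1.trans (by push_cast; rfl :
    _ = (((t ^ (b + 1 + (a + 1) - 1) * (Real.Gamma (b + 1) * Real.Gamma (a + 1)
      / Real.Gamma (b + 1 + (a + 1))) : ℝ)) : ℂ)))
  rw [h3, show b + 1 + (a + 1) - 1 = a + b + 1 by ring, show b + 1 + (a + 1) = a + b + 2 by ring,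
    mul_comm (Real.Gamma (b + 1))]

lemma intervalIntegrable_rpow_mul_rpow {a b t : ℝ} (ha : -1 < a) (hb : -1 < b) (ht : 0 < t) :
    IntervalIntegrable (fun z => (t - z) ^ a * z ^ b) volume 0 t := by
  -- A non-integrable function would have integral zero by convention, whereas the Beta value is
  -- positive.
  refine intervalIntegral.intervalIntegrable_of_integral_ne_zero ?_
  rw [integral_rpow_mul_rpow ha hb ht]
  have h1 := Real.Gamma_pos_of_pos (show 0 < a + 1 by linarith)
  have h2 := Real.Gamma_pos_of_pos (show 0 < b + 1 by linarith)
  have h3 := Real.Gamma_pos_of_pos (show 0 < a + b + 2 by linarith)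
  positivity

lemma rlKernel_conv_eqOn {a b t : ℝ} (ht : 0 ≤ t) : EqOn
    (fun z => rlKernel a (t - z) * rlKernel b z) (fun z => (t - z) ^ a * z ^ b *
      (1 / (Real.Gamma (a + 1) * Real.Gamma (b + 1)))) (uIoo 0 t) := by
  intro z hz
  rw [uIoo_of_le ht] at hz
  simp only
  rw [rlKernel_of_pos a (by linarith [hz.2]), rlKernel_of_pos b hz.1, div_mul_div_comm,
    ← mul_div_assoc, mul_one]

lemma rlKernel_conv_eqOn_zero {a b t k : ℝ} (htk : t ≤ k) : EqOn
    (fun z => rlKernel a (t - z) * rlKernel b z) (fun _ => 0) (uIoo t k) := by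
  intro z hz
  rw [uIoo_of_le htk] at hz
  simp only
  rw [rlKernel_of_nonpos a (by linarith [hz.1]), zero_mul]

/-- The upper limit k may exceed t, beyond which the first factor vanishes; thus all shifts k - i
share the interval [0, k]. -/
lemma intervalIntegrable_rlKernel_conv {a b t k : ℝ} (ha : -1 < a) (hb : -1 < b) (ht : 0 ≤ t)
    (htk : t ≤ k) :
    IntervalIntegrable (fun z => rlKernel a (t - z) * rlKernel b z) volume 0 k := by
  refine IntervalIntegrable.trans (b := t) ?_ ?_
  · rcases ht.eq_or_lt with rfl | ht'
    · exact IntervalIntegrable.refl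
    · exact ((intervalIntegrable_rpow_mul_rpow ha hb ht').mul_const _).congr_uIoo
        (rlKernel_conv_eqOn ht).symm
  · exact intervalIntegrable_const.congr_uIoo (rlKernel_conv_eqOn_zero htk).symm

/-- The semigroup property of the Riemann--Liouville kernels. -/
lemma integral_rlKernel_conv {a b t k : ℝ} (ha : -1 < a) (hb : -1 < b) (ht : 0 ≤ t)
    (htk : t ≤ k) :
    ∫ z in (0 : ℝ)..k, rlKernel a (t - z) * rlKernel b z = rlKernel (a + b + 1) t := by
  have hi := intervalIntegrable_rlKernel_conv ha hb ht htk
  have h0t : IntervalIntegrable (fun z => rlKernel a (t - z) * rlKernel b z) volume 0 t :=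
    hi.mono_set (by rw [uIcc_of_le ht, uIcc_of_le (ht.trans htk)]; exact Icc_subset_Icc_right htk)
  have htk' : IntervalIntegrable (fun z => rlKernel a (t - z) * rlKernel b z) volume t k :=
    hi.mono_set (by rw [uIcc_of_le htk, uIcc_of_le (ht.trans htk)]; exact Icc_subset_Icc_left ht)
  rw [← intervalIntegral.integral_add_adjacent_intervals h0t htk',
    intervalIntegral.integral_congr_uIoo (rlKernel_conv_eqOn_zero htk),
    intervalIntegral.integral_congr_uIoo (rlKernel_conv_eqOn ht)]
  rcases ht.eq_or_lt with rfl | ht'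
  · simp [rlKernel_of_nonpos]
  · have h1 := Real.Gamma_pos_of_pos (show 0 < a + 1 by linarith)
    have h2 := Real.Gamma_pos_of_pos (show 0 < b + 1 by linarith)
    rw [intervalIntegral.integral_mul_const, integral_rpow_mul_rpow ha hb ht',
      rlKernel_of_pos _ ht', show a + b + 1 + 1 = a + b + 2 by ring]
    simp only [intervalIntegral.integral_zero, add_zero]
    field_simp

/-! ### The truncation error of the convolution quadrature on powers of `t` -/

/-- `∑ ϖ_{k-j} j^s - Γ(s + 1) / Γ(s + 1 - β) (θ k^(s-β) + (1 - θ) (k - 1)^(s-β))`. -/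
def powerDefect (β θ : ℝ) (k : ℕ) (s : ℝ) : ℝ :=
  ∑ j ∈ Finset.range (k + 1), cqWeight β (k - j) * (j : ℝ) ^ s
    - Real.Gamma (s + 1) / Real.Gamma (s + 1 - β)
      * (θ * (k : ℝ) ^ (s - β) + (1 - θ) * ((k : ℝ) - 1) ^ (s - β))

/-- The Peano kernel of order `l` of `powerDefect`. -/
def peanoKernel (β θ : ℝ) (l k : ℕ) (y : ℝ) : ℝ :=
  ∑ i ∈ Finset.range (k + 1), cqWeight β i * rlKernel l (y - i)
    - θ * rlKernel (l - β) y - (1 - θ) * rlKernel (l - β) (y - 1)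

lemma powerDefect_eq_rlKernel {β θ s : ℝ} {k : ℕ} (hβ : 0 < β) (hs : β < s) (hk : 1 ≤ k) :
    powerDefect β θ k s = Real.Gamma (s + 1) *
      (∑ i ∈ Finset.range (k + 1), cqWeight β i * rlKernel s ((k : ℝ) - i)
        - θ * rlKernel (s - β) k - (1 - θ) * rlKernel (s - β) ((k : ℝ) - 1)) := by
  have hk1 : (1 : ℝ) ≤ k := by exact_mod_cast hk
  have hG := (Real.Gamma_pos_of_pos (show 0 < s + 1 - β by linarith)).ne'
  have h1 := gamma_mul_rlKernel (s := s - β) (x := k) (by linarith) (by linarith)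
  have h2 := gamma_mul_rlKernel (s := s - β) (x := (k : ℝ) - 1) (by linarith) (by linarith)
  rw [show s - β + 1 = s + 1 - β by ring] at h1 h2
  rw [powerDefect, ← h1, ← h2, ← Finset.sum_range_reflect, mul_sub, mul_sub, Finset.mul_sum]
  have h3 : ∑ j ∈ Finset.range (k + 1), cqWeight β (k - (k + 1 - 1 - j))
        * ((k + 1 - 1 - j : ℕ) : ℝ) ^ s
      = ∑ i ∈ Finset.range (k + 1), Real.Gamma (s + 1) * (cqWeight β i * rlKernel s ((k : ℝ) - i)) := by
    refine Finset.sum_congr rfl fun i hi => ?_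
    have hik : i ≤ k := Nat.lt_succ_iff.1 (Finset.mem_range.1 hi)
    have hik' : (i : ℝ) ≤ k := by exact_mod_cast hik
    rw [Nat.add_sub_cancel, Nat.sub_sub_self hik, Nat.cast_sub hik,
      ← gamma_mul_rlKernel (by linarith : 0 < s) (by linarith : 0 ≤ (k : ℝ) - i)]
    ring
  rw [h3]
  field_simp
  ring

lemma intervalIntegrable_peanoKernel_mul {β θ ν : ℝ} {l k : ℕ} (hβ : β < 1) (hν : 0 < ν)
    (hk : 1 ≤ k) : IntervalIntegrable
      (fun z => peanoKernel β θ l k (k - z) * rlKernel (ν - 1) z) volume 0 k ∧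
    ∫ z in (0 : ℝ)..k, peanoKernel β θ l k (k - z) * rlKernel (ν - 1) z
      = ∑ i ∈ Finset.range (k + 1), cqWeight β i * rlKernel (l + ν) ((k : ℝ) - i)
        - θ * rlKernel (l + ν - β) k - (1 - θ) * rlKernel (l + ν - β) ((k : ℝ) - 1) := by
  have hk1 : (1 : ℝ) ≤ k := by exact_mod_cast hk
  have hl := l.cast_nonneg (α := ℝ)
  have e : (fun z => peanoKernel β θ l k (k - z) * rlKernel (ν - 1) z) = fun z =>
      ∑ i ∈ Finset.range (k + 1), cqWeight β i * (rlKernel l ((k - i) - z) * rlKernel (ν - 1) z)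
        - θ * (rlKernel (l - β) (k - z) * rlKernel (ν - 1) z)
        - (1 - θ) * (rlKernel (l - β) ((k - 1) - z) * rlKernel (ν - 1) z) := by
    ext z
    rw [peanoKernel, sub_mul, sub_mul, Finset.sum_mul]
    congr 1
    · congr 1
      · refine Finset.sum_congr rfl fun i _ => ?_
        rw [mul_assoc, show (k : ℝ) - z - i = k - i - z by ring]
      · ring
    · rw [mul_assoc, show (k : ℝ) - z - 1 = k - 1 - z by ring]
  have hik : ∀ i ∈ Finset.range (k + 1), (0 : ℝ) ≤ (k : ℝ) - i := fun i hi => by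
    have : (i : ℝ) ≤ k := by exact_mod_cast Nat.lt_succ_iff.1 (Finset.mem_range.1 hi)
    linarith
  have hi1 : ∀ i ∈ Finset.range (k + 1), IntervalIntegrable (fun z => cqWeight β i *
      (rlKernel l ((k - i) - z) * rlKernel (ν - 1) z)) volume 0 k := fun i hi =>
    (intervalIntegrable_rlKernel_conv (by linarith) (by linarith) (hik i hi)
      (by linarith [i.cast_nonneg (α := ℝ)])).const_mul _
  have hi2 : IntervalIntegrable (fun z => θ * (rlKernel (l - β) (k - z) * rlKernel (ν - 1) z))
      volume 0 k :=
    (intervalIntegrable_rlKernel_conv (by linarith) (by linarith) (by linarith) le_rfl).const_mul _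
  have hi3 : IntervalIntegrable (fun z => (1 - θ) *
      (rlKernel (l - β) ((k - 1) - z) * rlKernel (ν - 1) z)) volume 0 k :=
    (intervalIntegrable_rlKernel_conv (by linarith) (by linarith) (by linarith)
      (by linarith)).const_mul _
  have hsum : IntervalIntegrable (fun z => ∑ i ∈ Finset.range (k + 1), cqWeight β i *
      (rlKernel l ((k - i) - z) * rlKernel (ν - 1) z)) volume 0 k := by
    have := IntervalIntegrable.sum (Finset.range (k + 1)) hi1
    simpa [Finset.sum_fn] using this
  rw [e]
  refine ⟨(hsum.sub hi2).sub hi3, ?_⟩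
  rw [intervalIntegral.integral_sub (hsum.sub hi2) hi3, intervalIntegral.integral_sub hsum hi2,
    intervalIntegral.integral_finsetSum hi1, intervalIntegral.integral_const_mul,
    intervalIntegral.integral_const_mul, integral_rlKernel_conv (by linarith) (by linarith)
      (by linarith) le_rfl, integral_rlKernel_conv (by linarith) (by linarith)
      (by linarith) (by linarith)]
  rw [show (l : ℝ) - β + (ν - 1) + 1 = l + ν - β by ring]
  congr 2
  refine Finset.sum_congr rfl fun i hi => ?_
  rw [intervalIntegral.integral_const_mul, integral_rlKernel_conv (by linarith) (by linarith)
    (hik i hi) (by linarith [i.cast_nonneg (α := ℝ)]), show (l : ℝ) + (ν - 1) + 1 = l + ν by ring]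

/-- By the semigroup property t^s is a superposition of truncated powers of order l, so its defect
is the same superposition of theirs. The order l is free below s, which later allows a choice
adapted to s. -/
lemma powerDefect_eq_integral {β θ s : ℝ} {l k : ℕ} (hβ₀ : 0 < β) (hβ : β < 1) (hs : β < s)
    (hls : (l : ℝ) < s) (hk : 1 ≤ k) :
    powerDefect β θ k s = Real.Gamma (s + 1) *
      ∫ z in (0 : ℝ)..k, peanoKernel β θ l k (k - z) * rlKernel (s - l - 1) z := by
  rw [powerDefect_eq_rlKernel hβ₀ hs hk,
    (intervalIntegrable_peanoKernel_mul hβ (sub_pos.2 hls) hk).2,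
    show (l : ℝ) + (s - l) = s by ring]

/-! ### Bounds for the Peano kernels -/

/-- On the cell (n, n + 1] only the nodes i ≤ n contribute, and the truncated powers become
polynomials in x: the sum is a moment of the weights. -/
lemma sum_cqWeight_mul_rlKernel {β x : ℝ} {l n k : ℕ} (hnk : n ≤ k) (hx : 0 < x) (hx1 : x ≤ 1) :
    ∑ i ∈ Finset.range (k + 1), cqWeight β i * rlKernel l ((n + x) - i)
      = (∑ i ∈ Finset.range (n + 1), cqWeight β i * ((n : ℝ) - i + x) ^ l) / l.factorial := by
  have hsub : Finset.range (n + 1) ⊆ Finset.range (k + 1) := Finset.range_mono (by omega)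
  rw [← Finset.sum_subset hsub, Finset.sum_div]
  · refine Finset.sum_congr rfl fun i hi => ?_
    have : (i : ℝ) ≤ n := by exact_mod_cast Nat.lt_succ_iff.1 (Finset.mem_range.1 hi)
    rw [rlKernel_of_pos _ (by linarith), Real.Gamma_nat_eq_factorial, Real.rpow_natCast,
      mul_div_assoc, show (n : ℝ) + x - i = n - i + x by ring]
  · intro i _ hi
    have : n + 1 ≤ i := by simpa using hi
    have : (n : ℝ) + 1 ≤ i := by exact_mod_cast this
    rw [rlKernel_of_nonpos _ (by linarith), mul_zero]


/-- Common Taylor expansion in 1/n for the orders l = 0, 1, 2. The averaged powers contribute a (x -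
(1 - θ))/n and the weights g₁/n - β(1-β)/(2n); second order holds exactly when these match, which
for l = 1, 2 forces θ = 1 - β/2. -/
lemma exists_abs_cell_defect_le {β : ℝ} (hβ₀ : 0 < β) (hβ : β < 1) (a θ : ℝ) :
    ∃ C : ℝ, 0 ≤ C ∧ ∀ n : ℕ, 2 ≤ n → ∀ x ∈ Icc (0 : ℝ) 1, ∀ g₁ g₂ : ℝ, |g₁| ≤ 2 → |g₂| ≤ 1 →
      |Real.Gamma (1 - β) * (n : ℝ) ^ β * cqSum β n * (1 + g₁ / n + g₂ / (n : ℝ) ^ 2)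
        - θ * (1 + x / n) ^ a - (1 - θ) * (1 + (x - 1) / n) ^ a
        - (g₁ - β * (1 - β) / 2 - a * (x - (1 - θ))) / n| ≤ C / (n : ℝ) ^ 2 := by
  obtain ⟨C₁, hC₁, h1⟩ := exists_abs_cqSum_sub_le hβ₀ hβ
  obtain ⟨C₂, hC₂, h2⟩ := exists_abs_one_add_rpow_sub_le a
  refine ⟨4 + 4 * C₁ + |θ| * C₂ + |1 - θ| * C₂, by positivity, fun n hn x hx g₁ g₂ hg₁ hg₂ => ?_⟩
  have hn2 : (2 : ℝ) ≤ n := by exact_mod_cast hn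
  set h : ℝ := 1 / n with hh
  have hh0 : 0 < h := by positivity
  have hh1 : h ≤ 1 / 2 := one_div_le_one_div_of_le (by norm_num) hn2
  have e : ∀ y : ℝ, y / n = y * h := fun y => by rw [hh]; ring
  have e2 : ∀ y : ℝ, y / (n : ℝ) ^ 2 = y * h ^ 2 := fun y => by rw [hh]; ring
  set κ := β * (1 - β) / 2 with hκ
  have hκ0 : 0 ≤ κ := by rw [hκ]; nlinarith
  have hκ1 : κ ≤ 1 / 2 := by rw [hκ]; nlinarith
  have r1 := h1 n (by omega)
  rw [show β * (1 - β) / (2 * n) = κ / n by rw [hκ]; field_simp] at r1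
  rw [e2, e] at r1
  have r2 := (h2 (x * h) (by rw [abs_le]; constructor <;> nlinarith [hx.1, hx.2])).2
  have r3 := (h2 ((x - 1) * h) (by rw [abs_le]; constructor <;> nlinarith [hx.1, hx.2])).2
  simp only [e, e2]
  set A := Real.Gamma (1 - β) * (n : ℝ) ^ β * cqSum β n
  have hx1 : (x * h) ^ 2 ≤ h ^ 2 := by
    rw [mul_pow]; exact mul_le_of_le_one_left (sq_nonneg h) (by nlinarith [hx.1, hx.2])
  have hx2 : ((x - 1) * h) ^ 2 ≤ h ^ 2 := by
    rw [mul_pow]; exact mul_le_of_le_one_left (sq_nonneg h) (by nlinarith [hx.1, hx.2])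
  have r2' := r2.trans (mul_le_mul_of_nonneg_left hx1 hC₂)
  have r3' := r3.trans (mul_le_mul_of_nonneg_left hx2 hC₂)
  set R₁ := A - (1 - κ * h)
  set R₂ := (1 + x * h) ^ a - 1 - a * (x * h) with hR₂
  set R₃ := (1 + (x - 1) * h) ^ a - 1 - a * ((x - 1) * h) with hR₃
  have key : A * (1 + g₁ * h + g₂ * h ^ 2) - θ * (1 + x * h) ^ a - (1 - θ) * (1 + (x - 1) * h) ^ a
        - (g₁ - κ - a * (x - (1 - θ))) * h
      = (-κ * g₁ + g₂ - κ * g₂ * h) * h ^ 2 + R₁ * (1 + g₁ * h + g₂ * h ^ 2) - θ * R₂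
        - (1 - θ) * R₃ := by
    simp only [R₁, hR₂, hR₃]; ring
  rw [key]
  have b1 : |(-κ * g₁ + g₂ - κ * g₂ * h) * h ^ 2| ≤ 4 * h ^ 2 := by
    rw [abs_mul, abs_of_nonneg (sq_nonneg h)]
    refine mul_le_mul_of_nonneg_right ?_ (sq_nonneg h)
    have t1 : |κ * g₁| ≤ 1 / 2 * 2 := by
      rw [abs_mul, abs_of_nonneg hκ0]; exact mul_le_mul hκ1 hg₁ (abs_nonneg _) (by norm_num)
    have t2 : |κ * g₂| ≤ 1 / 2 * 1 := by
      rw [abs_mul, abs_of_nonneg hκ0]; exact mul_le_mul hκ1 hg₂ (abs_nonneg _) (by norm_num)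
    have t3 : |κ * g₂ * h| ≤ 1 / 2 * 1 * (1 / 2) := by
      rw [abs_mul, abs_of_pos hh0]; exact mul_le_mul t2 hh1 hh0.le (by norm_num)
    rw [abs_le] at *
    constructor <;> linarith [t1.1, t1.2, t3.1, t3.2, hg₂.1, hg₂.2]
  have b2 : |R₁ * (1 + g₁ * h + g₂ * h ^ 2)| ≤ C₁ * h ^ 2 * 4 := by
    rw [abs_mul]
    refine mul_le_mul r1 ?_ (abs_nonneg _) (by positivity)
    have t1 : |g₁ * h| ≤ 2 * (1 / 2) := by
      rw [abs_mul, abs_of_pos hh0]; exact mul_le_mul hg₁ hh1 hh0.le (by norm_num)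
    have t2 : |g₂ * h ^ 2| ≤ 1 * 1 := by
      rw [abs_mul, abs_of_pos (pow_pos hh0 2)]
      exact mul_le_mul hg₂ (by nlinarith) (by positivity) (by norm_num)
    rw [abs_le] at *
    constructor <;> linarith [t1.1, t1.2, t2.1, t2.2]
  have b3 : |θ * R₂| ≤ |θ| * (C₂ * h ^ 2) := by
    rw [abs_mul]; exact mul_le_mul_of_nonneg_left r2' (abs_nonneg θ)
  have b4 : |(1 - θ) * R₃| ≤ |1 - θ| * (C₂ * h ^ 2) := by
    rw [abs_mul]; exact mul_le_mul_of_nonneg_left r3' (abs_nonneg _)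
  refine (abs_sub _ _).trans ?_
  refine (add_le_add ((abs_sub _ _).trans (add_le_add ((abs_add_le _ _).trans
    (add_le_add b1 b2)) b3)) b4).trans (le_of_eq (by ring))

/-- Factoring out the power of n leaves a bracket that depends on 1/n and x only. -/
lemma peanoKernel_cell {β θ x : ℝ} {l n k : ℕ} (hn : 2 ≤ n) (hnk : n ≤ k) (hx : 0 < x)
    (hx1 : x ≤ 1) : peanoKernel β θ l k (n + x)
      = (∑ i ∈ Finset.range (n + 1), cqWeight β i * ((n : ℝ) - i + x) ^ l) / l.factorial
        - (n : ℝ) ^ (l - β) / Real.Gamma (l - β + 1) *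
          (θ * (1 + x / n) ^ (l - β) + (1 - θ) * (1 + (x - 1) / n) ^ (l - β)) := by
  have hn2 : (2 : ℝ) ≤ n := by exact_mod_cast hn
  have hn0 : (0 : ℝ) < n := by linarith
  rw [peanoKernel, sum_cqWeight_mul_rlKernel hnk hx hx1, rlKernel_of_pos _ (by linarith),
    rlKernel_of_pos _ (by linarith), show (n : ℝ) + x = n * (1 + x / n) by field_simp,
    show (n : ℝ) * (1 + x / n) - 1 = n * (1 + (x - 1) / n) by field_simp; ring,
    Real.mul_rpow hn0.le (by positivity), Real.mul_rpow hn0.le (by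
      have : -1 ≤ (x - 1) / n := by rw [le_div_iff₀ hn0]; linarith
      linarith)]
  ring

/-- From a bound for the rescaled kernel on a cell to a bound for the kernel. -/
lemma abs_peanoKernel_cell_le {β θ x D C : ℝ} {l n k r : ℕ} (hβ : β < 1) (hn : 2 ≤ n) (hnk : n ≤ k)
    (hx : 0 < x) (hx1 : x ≤ 1)
    (hD : (∑ i ∈ Finset.range (n + 1), cqWeight β i * ((n : ℝ) - i + x) ^ l) / l.factorial
      = (n : ℝ) ^ (l - β) / Real.Gamma (l - β + 1) * D)
    (h : |D - θ * (1 + x / n) ^ (l - β) - (1 - θ) * (1 + (x - 1) / n) ^ (l - β)|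
      ≤ C / (n : ℝ) ^ r) :
    |peanoKernel β θ l k (n + x)| ≤ C / Real.Gamma (l - β + 1) * (n : ℝ) ^ (-(r + β - l)) := by
  have hl := l.cast_nonneg (α := ℝ)
  have hG := Real.Gamma_pos_of_pos (show 0 < (l : ℝ) - β + 1 by linarith)
  have hn0 : (0 : ℝ) < n := by exact_mod_cast (by omega : 0 < n)
  rw [peanoKernel_cell hn hnk hx hx1, hD, ← mul_sub, abs_mul, abs_of_pos (by positivity),
    ← sub_sub, show (n : ℝ) ^ (-((r : ℝ) + β - l)) = (n : ℝ) ^ (l - β) / (n : ℝ) ^ r by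
      rw [← Real.rpow_natCast, ← Real.rpow_sub hn0]; congr 1; ring]
  refine (mul_le_mul_of_nonneg_left h (by positivity)).trans (le_of_eq (by ring))

/-- This and the two lemmas after it put the moments of order 0, 1 and 2 into the form Γ(1-β) n^β
b_n (1 + g₁/n + g₂/n²) required by the cell estimate. -/
lemma gamma_rpow_zero {β : ℝ} {n : ℕ} (hβ : β < 1) (hn : 2 ≤ n) (x : ℝ) :
    (∑ i ∈ Finset.range (n + 1), cqWeight β i * ((n : ℝ) - i + x) ^ 0) / (Nat.factorial 0)
      = (n : ℝ) ^ (((0 : ℕ) : ℝ) - β) / Real.Gamma (((0 : ℕ) : ℝ) - β + 1) *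
        (Real.Gamma (1 - β) * (n : ℝ) ^ β * cqSum β n * (1 + 0 / n + 0 / (n : ℝ) ^ 2)) := by
  have hn0 : (0 : ℝ) < n := by exact_mod_cast (by omega : 0 < n)
  have hG := Real.Gamma_pos_of_pos (show 0 < 1 - β by linarith)
  have : (0 : ℝ) < (n : ℝ) ^ β := by positivity
  simp only [pow_zero, mul_one, Nat.factorial_zero, Nat.cast_one, div_one, Nat.cast_zero, zero_sub,
    zero_div, add_zero]
  rw [Real.rpow_neg hn0.le, show -β + 1 = 1 - β by ring, ← cqSum]
  field_simp

lemma gamma_rpow_one {β : ℝ} {n : ℕ} (hβ : β < 1) (hn : 2 ≤ n) (x : ℝ) :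
    (∑ i ∈ Finset.range (n + 1), cqWeight β i * ((n : ℝ) - i + x) ^ 1) / (Nat.factorial 1)
      = (n : ℝ) ^ (((1 : ℕ) : ℝ) - β) / Real.Gamma (((1 : ℕ) : ℝ) - β + 1) *
        (Real.Gamma (1 - β) * (n : ℝ) ^ β * cqSum β n
          * (1 + (1 - β) * x / n + 0 / (n : ℝ) ^ 2)) := by
  have hn0 : (0 : ℝ) < n := by exact_mod_cast (by omega : 0 < n)
  have hG := Real.Gamma_pos_of_pos (show 0 < 1 - β by linarith)
  have : (0 : ℝ) < (n : ℝ) ^ β := by positivity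
  have hb : 0 < 1 - β := by linarith
  have h1 := sum_cqWeight_mul_sub β n
  have h2 : ∑ i ∈ Finset.range (n + 1), cqWeight β i * ((n : ℝ) - i + x) ^ 1
      = ∑ i ∈ Finset.range (n + 1), cqWeight β i * ((n : ℝ) - i) + x * cqSum β n := by
    rw [cqSum, Finset.mul_sum, ← Finset.sum_add_distrib]
    exact Finset.sum_congr rfl fun i _ => by ring
  rw [h2, eq_div_of_mul_eq hb.ne' ((mul_comm _ _).trans h1)]
  simp only [Nat.factorial_one, Nat.cast_one, div_one, zero_div, add_zero]
  rw [Real.rpow_sub hn0, Real.rpow_one, Real.Gamma_add_one hb.ne']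
  field_simp

lemma gamma_rpow_two {β : ℝ} {n : ℕ} (hβ : β < 1) (hn : 2 ≤ n) (x : ℝ) :
    (∑ i ∈ Finset.range (n + 1), cqWeight β i * ((n : ℝ) - i + x) ^ 2) / (Nat.factorial 2)
      = (n : ℝ) ^ (((2 : ℕ) : ℝ) - β) / Real.Gamma (((2 : ℕ) : ℝ) - β + 1) *
        (Real.Gamma (1 - β) * (n : ℝ) ^ β * cqSum β n
          * (1 + (-β / 2 + (2 - β) * x) / n + (1 - β) * (2 - β) * x ^ 2 / 2 / (n : ℝ) ^ 2)) := by
  have hn0 : (0 : ℝ) < n := by exact_mod_cast (by omega : 0 < n)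
  have hG := Real.Gamma_pos_of_pos (show 0 < 1 - β by linarith)
  have : (0 : ℝ) < (n : ℝ) ^ β := by positivity
  have hb : 0 < 1 - β := by linarith
  have hb2 : 0 < 2 - β := by linarith
  have h1 := sum_cqWeight_mul_sub β n
  have h3 := sum_cqWeight_mul_sub_sq β n
  have h2 : ∑ i ∈ Finset.range (n + 1), cqWeight β i * ((n : ℝ) - i + x) ^ 2
      = ∑ i ∈ Finset.range (n + 1), cqWeight β i * ((n : ℝ) - i) ^ 2
        + 2 * x * ∑ i ∈ Finset.range (n + 1), cqWeight β i * ((n : ℝ) - i) + x ^ 2 * cqSum β n := by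
    rw [cqSum, Finset.mul_sum, Finset.mul_sum, ← Finset.sum_add_distrib, ← Finset.sum_add_distrib]
    exact Finset.sum_congr rfl fun i _ => by ring
  rw [h2, eq_div_of_mul_eq hb.ne' ((mul_comm _ _).trans h1),
    eq_div_of_mul_eq (by positivity : (1 - β) * (2 - β) ≠ 0) ((mul_comm _ _).trans h3)]
  simp only [Nat.factorial_two, Nat.cast_ofNat]
  rw [Real.rpow_sub hn0, Real.rpow_two, Real.Gamma_add_one hb2.ne',
    show (2 : ℝ) - β = 1 - β + 1 by ring, Real.Gamma_add_one hb.ne']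
  field_simp
  ring

/-- Decay of the Peano kernel on `(2, ∞)`. -/
def PeanoDecay (β θ : ℝ) (l : ℕ) (δ : ℝ) : Prop :=
  ∃ C : ℝ, 0 ≤ C ∧ ∀ (k : ℕ) (y : ℝ), 2 < y → y ≤ k → |peanoKernel β θ l k y| ≤ C * y ^ (-δ)

lemma peanoDecay_of_cell {β θ C δ : ℝ} {l : ℕ} (hδ : 0 ≤ δ) (hC : 0 ≤ C)
    (h : ∀ (n k : ℕ) (x : ℝ), 2 ≤ n → n ≤ k → 0 < x → x ≤ 1 →
      |peanoKernel β θ l k (n + x)| ≤ C * (n : ℝ) ^ (-δ)) : PeanoDecay β θ l δ := by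
  -- On a cell with n ≥ 2 one has y ≤ n + 1 ≤ 3n/2, so n may be replaced by 2y/3.
  refine ⟨C * (2 / 3) ^ (-δ), by positivity, fun k y hy hyk => ?_⟩
  obtain ⟨n, hn⟩ : ∃ n : ℕ, ⌈y⌉₊ = n + 1 := ⟨⌈y⌉₊ - 1, by
    have : 0 < ⌈y⌉₊ := Nat.ceil_pos.2 (by linarith)
    omega⟩
  have h1 : y ≤ n + 1 := by
    have := Nat.le_ceil y
    rw [hn] at this
    exact_mod_cast this
  have h2 : (n : ℝ) < y := Nat.lt_ceil.1 (by omega)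
  have h3 : 2 ≤ n := by
    have : (1 : ℝ) < n := by linarith
    exact_mod_cast this
  have h4 : n ≤ k := by
    have : (n : ℝ) < k := h2.trans_le hyk
    exact_mod_cast this.le
  have h5 := h n k (y - n) h3 h4 (by linarith) (by linarith)
  rw [add_sub_cancel] at h5
  refine h5.trans ?_
  rw [mul_assoc, ← Real.mul_rpow (by norm_num) (by linarith)]
  have hn2 : (2 : ℝ) ≤ n := by exact_mod_cast h3
  exact mul_le_mul_of_nonneg_left (Real.rpow_le_rpow_of_nonpos (by linarith) (by linarith)
    (by linarith)) hC

lemma abs_le_div_of_abs_sub_le {D c M C : ℝ} {n : ℕ} (hn : 2 ≤ n) (hc : |c| ≤ M) (hC : 0 ≤ C)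
    (h : |D - c / n| ≤ C / (n : ℝ) ^ 2) : |D| ≤ (M + C) / (n : ℝ) ^ 1 := by
  have hn1 : (1 : ℝ) ≤ n := by exact_mod_cast (by omega : 1 ≤ n)
  have h1 : |c / n| ≤ M / n := by
    rw [abs_div, abs_of_pos (by linarith : (0 : ℝ) < n)]; gcongr
  have h2 : C / (n : ℝ) ^ 2 ≤ C / n := by
    refine div_le_div_of_nonneg_left hC (by linarith) (by nlinarith)
  have h3 : |D| ≤ |D - c / n| + |c / n| := by
    have := abs_add_le (D - c / n) (c / n)
    rwa [sub_add_cancel] at this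
  rw [pow_one, add_div]
  linarith

/-- The prefactor n^(-β) and the first-order error 1/n already give an integrable tail, for every θ.
-/
lemma peanoDecay_zero {β : ℝ} (hβ₀ : 0 < β) (hβ : β < 1) (θ : ℝ) : PeanoDecay β θ 0 (1 + β) := by
  obtain ⟨C, hC, h⟩ := exists_abs_cell_defect_le hβ₀ hβ (((0 : ℕ) : ℝ) - β) θ
  have hG := Real.Gamma_pos_of_pos (show 0 < ((0 : ℕ) : ℝ) - β + 1 by
    rw [Nat.cast_zero]; linarith)
  refine peanoDecay_of_cell (C := (1 + β * (1 + |1 - θ|) + C) / Real.Gamma (((0 : ℕ) : ℝ) - β + 1))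
    (by linarith) (by positivity) fun n k x hn hnk hx hx1 => ?_
  have h1 := abs_le_div_of_abs_sub_le (M := 1 + β * (1 + |1 - θ|)) hn (by
    have t1 : |x - (1 - θ)| ≤ 1 + |1 - θ| :=
      (abs_sub _ _).trans (add_le_add_left (by rw [abs_of_pos hx]; exact hx1) _)
    have t2 : |β * (x - (1 - θ))| ≤ β * (1 + |1 - θ|) := by
      rw [abs_mul, abs_of_pos hβ₀]; exact mul_le_mul_of_nonneg_left t1 hβ₀.le
    rw [Nat.cast_zero]
    rw [abs_le] at t2 ⊢
    constructor <;> nlinarith [t2.1, t2.2]) hC (h n hn x ⟨hx.le, hx1⟩ 0 0 (by simp) (by simp))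
  have h2 := abs_peanoKernel_cell_le hβ hn hnk hx hx1 (gamma_rpow_zero hβ hn x) h1
  simpa using h2

/-- Without cancellation the kernel of order 1 decays only like n^(-β), which suffices for exponents
above 1 when p = 1. -/
lemma peanoDecay_one {β : ℝ} (hβ₀ : 0 < β) (hβ : β < 1) (θ : ℝ) : PeanoDecay β θ 1 β := by
  obtain ⟨C, hC, h⟩ := exists_abs_cell_defect_le hβ₀ hβ (((1 : ℕ) : ℝ) - β) θ
  have hG := Real.Gamma_pos_of_pos (show 0 < ((1 : ℕ) : ℝ) - β + 1 by
    rw [Nat.cast_one]; linarith)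
  refine peanoDecay_of_cell (C := (1 + |1 - θ| + C) / Real.Gamma (((1 : ℕ) : ℝ) - β + 1))
    hβ₀.le (by positivity) fun n k x hn hnk hx hx1 => ?_
  have h1 := abs_le_div_of_abs_sub_le (M := 1 + |1 - θ|) hn (by
    have t2 : |(1 - β) * (1 - θ)| ≤ |1 - θ| := by
      rw [abs_mul, abs_of_pos (by linarith)]
      exact mul_le_of_le_one_left (abs_nonneg _) (by linarith)
    rw [Nat.cast_one]
    rw [abs_le] at t2 ⊢
    constructor <;> nlinarith [t2.1, t2.2]) hC (h n hn x ⟨hx.le, hx1⟩ ((1 - β) * x) 0 (by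
      rw [abs_of_nonneg (by nlinarith)]; nlinarith) (by simp))
  have h2 := abs_peanoKernel_cell_le hβ hn hnk hx hx1 (gamma_rpow_one hβ hn x) h1
  simpa using h2

/-- For this θ the 1/n term vanishes identically in x, which gains one power and makes the kernel of
order 1 integrable. -/
lemma peanoDecay_one' {β : ℝ} (hβ₀ : 0 < β) (hβ : β < 1) :
    PeanoDecay β (1 - β / 2) 1 (1 + β) := by
  obtain ⟨C, hC, h⟩ := exists_abs_cell_defect_le hβ₀ hβ (((1 : ℕ) : ℝ) - β) (1 - β / 2)
  have hG := Real.Gamma_pos_of_pos (show 0 < ((1 : ℕ) : ℝ) - β + 1 by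
    rw [Nat.cast_one]; linarith)
  refine peanoDecay_of_cell (C := C / Real.Gamma (((1 : ℕ) : ℝ) - β + 1))
    (by linarith) (by positivity) fun n k x hn hnk hx hx1 => ?_
  have h1 := h n hn x ⟨hx.le, hx1⟩ ((1 - β) * x) 0 (by
      rw [abs_of_nonneg (by nlinarith)]; nlinarith) (by simp)
  rw [show ((1 - β) * x - β * (1 - β) / 2 - (((1 : ℕ) : ℝ) - β) * (x - (1 - (1 - β / 2)))) = 0 by
    push_cast; ring, zero_div (n : ℝ), sub_zero] at h1
  have h2 := abs_peanoKernel_cell_le hβ hn hnk hx hx1 (gamma_rpow_one hβ hn x) h1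
  convert h2 using 3
  push_cast; ring

/-- The same cancellation at order 2, where the prefactor n^(2-β) leaves decay n^(-β). -/
lemma peanoDecay_two {β : ℝ} (hβ₀ : 0 < β) (hβ : β < 1) :
    PeanoDecay β (1 - β / 2) 2 β := by
  obtain ⟨C, hC, h⟩ := exists_abs_cell_defect_le hβ₀ hβ (((2 : ℕ) : ℝ) - β) (1 - β / 2)
  have hG := Real.Gamma_pos_of_pos (show 0 < ((2 : ℕ) : ℝ) - β + 1 by
    push_cast; linarith)
  refine peanoDecay_of_cell (C := C / Real.Gamma (((2 : ℕ) : ℝ) - β + 1))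
    (by linarith) (by positivity) fun n k x hn hnk hx hx1 => ?_
  have hx2 : x ^ 2 ≤ 1 := by nlinarith
  have h1 := h n hn x ⟨hx.le, hx1⟩ (-β / 2 + (2 - β) * x) ((1 - β) * (2 - β) * x ^ 2 / 2) (by
      rw [abs_le]; constructor <;> nlinarith) (by
      have t1 : 0 ≤ (1 - β) * (2 - β) := by nlinarith
      have t2 : (1 - β) * (2 - β) ≤ 2 := by nlinarith
      rw [abs_of_nonneg (by positivity)]; nlinarith [sq_nonneg x])
  rw [show (-β / 2 + (2 - β) * x - β * (1 - β) / 2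
      - (((2 : ℕ) : ℝ) - β) * (x - (1 - (1 - β / 2)))) = 0 by
    push_cast; ring, zero_div (n : ℝ), sub_zero] at h1
  have h2 := abs_peanoKernel_cell_le hβ hn hnk hx hx1 (gamma_rpow_two hβ hn x) h1
  convert h2 using 3
  push_cast; ring

lemma sum_abs_cqWeight_le {β : ℝ} (hβ₀ : 0 ≤ β) (hβ : β < 1) (k : ℕ) :
    ∑ i ∈ Finset.range (k + 1), |cqWeight β i| ≤ 2 := by
  have h : ∀ k, ∑ i ∈ Finset.range (k + 1), |cqWeight β i| = 2 - cqSum β k := by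
    intro k
    induction k with
    | zero => simp [cqWeight_zero, cqSum_zero]; norm_num
    | succ k ih =>
      rw [Finset.sum_range_succ, ih, cqSum_succ', abs_of_nonpos (cqWeight_succ_nonpos hβ₀ hβ k)]
      ring
  rw [h]
  linarith [cqSum_pos hβ k]

/-- For l = 0 the last two terms are singular at 0 and 1, but integrably so; they are therefore kept
in the bound. -/
lemma abs_peanoKernel_le_of_le_two {β θ y : ℝ} (hβ₀ : 0 ≤ β) (hβ : β < 1) (l k : ℕ) (hy : y ≤ 2) :
    |peanoKernel β θ l k y| ≤ 2 * rlKernel l 2 + |θ| * rlKernel (l - β) y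
      + |1 - θ| * rlKernel (l - β) (y - 1) := by
  have hl := l.cast_nonneg (α := ℝ)
  have h1 : |∑ i ∈ Finset.range (k + 1), cqWeight β i * rlKernel l (y - i)| ≤ 2 * rlKernel l 2 := by
    refine (Finset.abs_sum_le_sum_abs _ _).trans ?_
    refine le_trans ?_ (mul_le_mul_of_nonneg_right (sum_abs_cqWeight_le hβ₀ hβ k)
      (rlKernel_nonneg (by linarith) _))
    rw [Finset.sum_mul]
    refine Finset.sum_le_sum fun i _ => ?_
    rw [abs_mul, abs_of_nonneg (rlKernel_nonneg (by linarith : (-1 : ℝ) < l) _)]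
    exact mul_le_mul_of_nonneg_left (rlKernel_mono hl (by linarith [i.cast_nonneg (α := ℝ)]))
      (abs_nonneg _)
  have h2 : |θ * rlKernel (l - β) y| = |θ| * rlKernel (l - β) y := by
    rw [abs_mul, abs_of_nonneg (rlKernel_nonneg (by linarith) _)]
  have h3 : |(1 - θ) * rlKernel (l - β) (y - 1)| = |1 - θ| * rlKernel (l - β) (y - 1) := by
    rw [abs_mul, abs_of_nonneg (rlKernel_nonneg (by linarith) _)]
  rw [peanoKernel]
  refine (abs_sub _ _).trans (add_le_add ((abs_sub _ _).trans (add_le_add h1 h2.le)) h3.le)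


/-! ### Consistency of the convolution quadrature -/

/-- In the Beta integral the factor (1 - z)^(β-1) is at least 1, so B(β, s+1-β) ≥ 1/(s - β + 1). The
linear growth in s matters, since the bound must be summable over the exponents. -/
lemma gamma_div_gamma_le {β s : ℝ} (hβ₀ : 0 < β) (hβ : β < 1) (hs : β < s) :
    Real.Gamma (s + 1) / Real.Gamma (s + 1 - β) ≤ Real.Gamma β * (1 + s) := by
  have h1 := integral_rpow_mul_rpow (a := β - 1) (b := s - β) (t := 1) (by linarith) (by linarith)
    one_pos
  rw [Real.one_rpow, one_mul, show β - 1 + 1 = β by ring, show s - β + 1 = s + 1 - β by ring,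
    show β - 1 + (s - β) + 2 = s + 1 by ring] at h1
  have h2 : ∫ z in (0 : ℝ)..1, z ^ (s - β) = 1 / (s - β + 1) := by
    rw [integral_rpow (Or.inl (by linarith)), Real.one_rpow, Real.zero_rpow (by linarith), sub_zero]
  have h3 : ∫ z in (0 : ℝ)..1, z ^ (s - β) ≤ ∫ z in (0 : ℝ)..1, (1 - z) ^ (β - 1) * z ^ (s - β) := by
    refine intervalIntegral.integral_mono_on_of_le_Ioo zero_le_one
      (intervalIntegral.intervalIntegrable_rpow' (by linarith))
      (intervalIntegrable_rpow_mul_rpow (by linarith) (by linarith) one_pos) fun z hz => ?_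
    exact le_mul_of_one_le_left (Real.rpow_nonneg hz.1.le _)
      (Real.one_le_rpow_of_pos_of_le_one_of_nonpos (by linarith [hz.2]) (by linarith [hz.1])
        (by linarith))
  rw [h2, h1] at h3
  have g1 := Real.Gamma_pos_of_pos (show 0 < s + 1 - β by linarith)
  have g2 := Real.Gamma_pos_of_pos (show 0 < s + 1 by linarith)
  have g3 := Real.Gamma_pos_of_pos hβ₀
  have hs1 : 0 < s - β + 1 := by linarith
  rw [div_le_div_iff₀ hs1 g2] at h3
  rw [div_le_iff₀ g1]
  have : Real.Gamma β * Real.Gamma (s + 1 - β) * (s - β + 1)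
      ≤ Real.Gamma β * Real.Gamma (s + 1 - β) * (1 + s) :=
    mul_le_mul_of_nonneg_left (by linarith) (by positivity)
  linarith

lemma gamma_div_gamma_nonneg {β s : ℝ} (hβ : β < 1) (hs : 0 < s) :
    0 ≤ Real.Gamma (s + 1) / Real.Gamma (s + 1 - β) :=
  div_nonneg (Real.Gamma_pos_of_pos (by linarith)).le (Real.Gamma_pos_of_pos (by linarith)).le

/-- Crude bound for a bounded number of steps. -/
lemma abs_powerDefect_le_of_le_two {β θ s : ℝ} {k : ℕ} (hβ₀ : 0 < β) (hβ : β < 1) (hs : β < s)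
    (hs2 : s ≤ 2) (hk : 1 ≤ k) (hk2 : k ≤ 2) :
    |powerDefect β θ k s| ≤ 8 + Real.Gamma β * 3 * ((|θ| + |1 - θ|) * 4) := by
  have hk1 : (1 : ℝ) ≤ k := by exact_mod_cast hk
  have hk2' : (k : ℝ) ≤ 2 := by exact_mod_cast hk2
  have hpow : ∀ x a : ℝ, 0 ≤ x → x ≤ 2 → 0 ≤ a → a ≤ 2 → |x ^ a| ≤ 4 := by
    intro x a hx hx2 ha ha2
    rw [abs_of_nonneg (Real.rpow_nonneg hx a)]
    calc x ^ a ≤ 2 ^ a := Real.rpow_le_rpow hx hx2 ha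
      _ ≤ 2 ^ (2 : ℝ) := Real.rpow_le_rpow_of_exponent_le (by norm_num) ha2
      _ = 4 := by norm_num
  have h1 : |∑ j ∈ Finset.range (k + 1), cqWeight β (k - j) * (j : ℝ) ^ s| ≤ 8 := by
    refine (Finset.abs_sum_le_sum_abs _ _).trans ?_
    have : ∑ j ∈ Finset.range (k + 1), |cqWeight β (k - j) * (j : ℝ) ^ s|
        ≤ ∑ j ∈ Finset.range (k + 1), |cqWeight β (k + 1 - 1 - j)| * 4 := by
      refine Finset.sum_le_sum fun j hj => ?_
      have hjk : j ≤ k := Nat.lt_succ_iff.1 (Finset.mem_range.1 hj)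
      rw [abs_mul, Nat.add_sub_cancel]
      exact mul_le_mul_of_nonneg_left (hpow _ _ (by positivity) (by exact_mod_cast hjk.trans hk2)
        (by linarith) hs2) (abs_nonneg _)
    refine this.trans ?_
    rw [Finset.sum_range_reflect (fun i => |cqWeight β i| * 4), ← Finset.sum_mul]
    have := sum_abs_cqWeight_le hβ₀.le hβ k
    linarith
  have h2 : |θ * (k : ℝ) ^ (s - β) + (1 - θ) * ((k : ℝ) - 1) ^ (s - β)|
      ≤ (|θ| + |1 - θ|) * 4 := by
    refine (abs_add_le _ _).trans ?_
    rw [abs_mul, abs_mul, add_mul]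
    exact add_le_add (mul_le_mul_of_nonneg_left (hpow _ _ (by linarith) hk2' (by linarith)
      (by linarith)) (abs_nonneg _)) (mul_le_mul_of_nonneg_left (hpow _ _ (by linarith)
      (by linarith) (by linarith) (by linarith)) (abs_nonneg _))
  have h3 : Real.Gamma (s + 1) / Real.Gamma (s + 1 - β) ≤ Real.Gamma β * 3 :=
    (gamma_div_gamma_le hβ₀ hβ hs).trans (mul_le_mul_of_nonneg_left (by linarith)
      (Real.Gamma_pos_of_pos hβ₀).le)
  rw [powerDefect]
  refine (abs_sub _ _).trans (add_le_add h1 ?_)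
  rw [abs_mul, abs_of_nonneg (gamma_div_gamma_nonneg hβ (by linarith))]
  exact mul_le_mul h3 h2 (abs_nonneg _) (by
    have := Real.Gamma_pos_of_pos hβ₀; positivity)

lemma intervalIntegrable_peanoKernel {β θ : ℝ} (hβ : β < 1) (l k : ℕ) (a b : ℝ) :
    IntervalIntegrable (peanoKernel β θ l k) volume a b := by
  have hl := l.cast_nonneg (α := ℝ)
  have h1 : IntervalIntegrable (fun y => ∑ i ∈ Finset.range (k + 1),
      cqWeight β i * rlKernel l (y - i)) volume a b := by
    have := IntervalIntegrable.sum (Finset.range (k + 1)) (f := fun i y =>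
      cqWeight β i * rlKernel l (y - i)) (μ := volume) (a := a) (b := b) fun i _ =>
      (((rlKernel_mono hl).comp (fun x y h => by simpa using h : Monotone fun y : ℝ => y - i)
        ).intervalIntegrable).const_mul _
    simpa [Finset.sum_fn] using this
  have h2 := (intervalIntegrable_rlKernel (a := l - β) (by linarith) a b).const_mul θ
  have h3 := ((intervalIntegrable_rlKernel (a := l - β) (by linarith) (a - 1) (b - 1)).comp_sub_right
    1).const_mul (1 - θ)
  rw [sub_add_cancel, sub_add_cancel] at h3
  exact (h1.sub h2).sub h3

/-- An L¹ bound uniform in k: integrable singularities up to y = 2, a tail of order y^(-1-β) beyond.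
-/
lemma exists_integral_abs_peanoKernel_le {β θ : ℝ} {l : ℕ} (hβ₀ : 0 < β) (hβ : β < 1)
    (h : PeanoDecay β θ l (1 + β)) : ∃ C : ℝ, 0 ≤ C ∧ ∀ k : ℕ, 2 ≤ k →
      (∫ y in (0 : ℝ)..k, |peanoKernel β θ l k y| ≤ C) ∧
        ∀ y : ℝ, 2 < y → y ≤ k → |peanoKernel β θ l k y| ≤ C := by
  obtain ⟨C, hC, h⟩ := h
  have hl := l.cast_nonneg (α := ℝ)
  set M : ℝ → ℝ := fun y => 2 * rlKernel l 2 + |θ| * rlKernel (l - β) y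
      + |1 - θ| * rlKernel (l - β) (y - 1) with hM
  have hMi : IntervalIntegrable M volume 0 2 := by
    have h2 := (intervalIntegrable_rlKernel (a := l - β) (by linarith) 0 2).const_mul |θ|
    have h3 := ((intervalIntegrable_rlKernel (a := l - β) (by linarith) (0 - 1)
      (2 - 1)).comp_sub_right 1).const_mul |1 - θ|
    rw [sub_add_cancel, sub_add_cancel] at h3
    exact (intervalIntegrable_const.add h2).add h3
  have hM0 : 0 ≤ ∫ y in (0 : ℝ)..2, M y := by
    refine intervalIntegral.integral_nonneg (by norm_num) fun y hy => ?_
    have t1 := rlKernel_nonneg (by linarith : (-1 : ℝ) < l) 2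
    have t2 := rlKernel_nonneg (by linarith : (-1 : ℝ) < l - β) y
    have t3 := rlKernel_nonneg (by linarith : (-1 : ℝ) < l - β) (y - 1)
    positivity
  refine ⟨(∫ y in (0 : ℝ)..2, M y) + C / β + C, by positivity, fun k hk => ⟨?_, fun y hy hyk => ?_⟩⟩
  · have hk2 : (2 : ℝ) ≤ k := by exact_mod_cast hk
    have hi := fun a b => (intervalIntegrable_peanoKernel (θ := θ) hβ l k a b).abs
    rw [← intervalIntegral.integral_add_adjacent_intervals (hi 0 2) (hi 2 k)]
    have i1 : ∫ y in (0 : ℝ)..2, |peanoKernel β θ l k y| ≤ ∫ y in (0 : ℝ)..2, M y :=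
      intervalIntegral.integral_mono_on (by norm_num) (hi 0 2) hMi fun y hy =>
        abs_peanoKernel_le_of_le_two hβ₀.le hβ l k hy.2
    have i3 : IntervalIntegrable (fun y : ℝ => C * y ^ (-(1 + β))) volume 2 k := by
      refine (intervalIntegral.intervalIntegrable_rpow (Or.inr ?_)).const_mul C
      rw [uIcc_of_le hk2]
      exact fun h => by linarith [h.1]
    have i2 : ∫ y in (2 : ℝ)..k, |peanoKernel β θ l k y| ≤ ∫ y in (2 : ℝ)..k, C * y ^ (-(1 + β)) :=
      intervalIntegral.integral_mono_on_of_le_Ioo hk2 (hi 2 k) i3 fun y hy => h k y hy.1 hy.2.le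
    have i4 : ∫ y in (2 : ℝ)..k, C * y ^ (-(1 + β)) ≤ C / β := by
      rw [intervalIntegral.integral_const_mul, integral_rpow (Or.inr ⟨by linarith, by
        rw [uIcc_of_le hk2]; exact fun h => by linarith [h.1]⟩), show -(1 + β) + 1 = -β by ring,
        div_eq_mul_one_div C β]
      refine mul_le_mul_of_nonneg_left ?_ hC
      rw [div_neg, ← neg_div, neg_sub]
      refine div_le_div_of_nonneg_right ?_ hβ₀.le
      have t1 : (2 : ℝ) ^ (-β) ≤ 1 := Real.rpow_le_one_of_one_le_of_nonpos (by norm_num)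
        (by linarith)
      have t2 : 0 ≤ (k : ℝ) ^ (-β) := by positivity
      linarith
    linarith
  · have h1 := h k y hy hyk
    have h2 : y ^ (-(1 + β)) ≤ 1 := Real.rpow_le_one_of_one_le_of_nonpos (by linarith)
        (by linarith)
    have h3 : C * y ^ (-(1 + β)) ≤ C := mul_le_of_le_one_right hC h2
    have h4 : 0 ≤ C / β := by positivity
    linarith

/-- Boundedness of the defect for exponents between `l` and `l + 1`. -/
lemma exists_abs_powerDefect_le_const {β θ : ℝ} {l : ℕ} (hβ₀ : 0 < β) (hβ : β < 1) (hl1 : l ≤ 1)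
    (h : PeanoDecay β θ l (1 + β)) : ∃ C : ℝ, 0 ≤ C ∧ ∀ (k : ℕ) (s : ℝ), 1 ≤ k → β < s → l < s →
      s ≤ l + 1 → |powerDefect β θ k s| ≤ C := by
  obtain ⟨C, hC, h⟩ := exists_integral_abs_peanoKernel_le hβ₀ hβ h
  have hGβ := Real.Gamma_pos_of_pos hβ₀
  refine ⟨8 + Real.Gamma β * 3 * ((|θ| + |1 - θ|) * 4) + 4 * C, by positivity,
    fun k s hk hβs hls hs => ?_⟩
  have hl1' : (l : ℝ) ≤ 1 := by exact_mod_cast hl1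
  have hl0 := l.cast_nonneg (α := ℝ)
  rcases le_or_gt k 2 with hk2 | hk2
  · have := abs_powerDefect_le_of_le_two (θ := θ) hβ₀ hβ hβs (by linarith) hk hk2
    linarith
  · obtain ⟨hint, hpt⟩ := h k hk2.le
    have hk3 : (3 : ℝ) ≤ k := by exact_mod_cast hk2
    have hs0 : 0 < s := by linarith
    have hν : 0 < s - l := by linarith
    have hGν := Real.Gamma_pos_of_pos hν
    have hG1 := Real.Gamma_pos_of_pos (show 0 < s + 1 by linarith)
    have hG1' : Real.Gamma (s + 1) = s * Real.Gamma s := Real.Gamma_add_one hs0.ne'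
    -- These ratios stay bounded as s decreases to l, where Γ(s - l) blows up.
    have hratio : Real.Gamma (s + 1) / Real.Gamma (s - l + 1) ≤ 2 := by
      rw [div_le_iff₀ (Real.Gamma_pos_of_pos (by linarith))]
      interval_cases l
      · simp only [Nat.cast_zero, sub_zero] at *
        linarith
      · simp only [Nat.cast_one, sub_add_cancel] at *
        rw [hG1']
        exact mul_le_mul_of_nonneg_right (by linarith) (Real.Gamma_pos_of_pos hs0).le
    have hνG : Real.Gamma (s - l + 1) = (s - l) * Real.Gamma (s - l) := Real.Gamma_add_one hν.ne'
    have hratio' : Real.Gamma (s + 1) / Real.Gamma (s - l) ≤ 2 := by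
      refine le_trans ?_ hratio
      refine div_le_div_of_nonneg_left hG1.le (by rw [hνG]; positivity) ?_
      rw [hνG]
      exact mul_le_of_le_one_left hGν.le (by linarith)
    have hi := (intervalIntegrable_peanoKernel_mul (θ := θ) (l := l) hβ hν hk).1
    have hsub : ∀ {g : ℝ → ℝ} {a b : ℝ}, IntervalIntegrable g volume 0 k → 0 ≤ a → a ≤ b → b ≤ k →
        IntervalIntegrable g volume a b := fun hg ha hab hb => hg.mono_set (by
      rw [uIcc_of_le hab, uIcc_of_le (by linarith)]; exact Icc_subset_Icc ha hb)
    -- For s near l the kernel of order s - l - 1 concentrates at z = 0, so the integral is split at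
    -- z = 1. On (0, 1) the pointwise bound of the Peano kernel applies, as k ≥ 3 gives k - z > 2;
    -- on (1, k) the other kernel is bounded and the L¹ bound is used.
    have i0 : |∫ z in (0 : ℝ)..1, peanoKernel β θ l k (k - z) * rlKernel (s - l - 1) z|
        ≤ C * rlKernel (s - l) 1 := by
      have e1 : ∫ z in (0 : ℝ)..1, rlKernel (s - l - 1) z = rlKernel (s - l) 1 := by
        have := integral_rlKernel_conv (a := 0) (b := s - l - 1) (t := 1) (k := 1) (by norm_num)
          (by linarith) zero_le_one le_rfl
        rw [show 0 + (s - l - 1) + 1 = s - l by ring] at this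
        rw [← this]
        refine intervalIntegral.integral_congr_uIoo fun z hz => ?_
        rw [uIoo_of_le zero_le_one] at hz
        rw [rlKernel_of_pos 0 (by linarith [hz.2])]
        simp
      rw [← e1, ← intervalIntegral.integral_const_mul]
      refine (intervalIntegral.abs_integral_le_integral_abs zero_le_one).trans ?_
      refine intervalIntegral.integral_mono_on_of_le_Ioo zero_le_one
        (hsub hi le_rfl zero_le_one (by linarith)).abs
        ((intervalIntegrable_rlKernel (by linarith) 0 1).const_mul C) fun z hz => ?_
      have t := rlKernel_nonneg (by linarith : (-1 : ℝ) < s - l - 1) z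
      rw [abs_mul, abs_of_nonneg t]
      exact mul_le_mul_of_nonneg_right (hpt _ (by linarith [hz.2]) (by linarith [hz.1])) t
    have i1 : |∫ z in (1 : ℝ)..k, peanoKernel β θ l k (k - z) * rlKernel (s - l - 1) z|
        ≤ C * (1 / Real.Gamma (s - l)) := by
      have hcomp : IntervalIntegrable (fun z => |peanoKernel β θ l k (k - z)|) volume 0 k := by
        have := ((intervalIntegrable_peanoKernel (θ := θ) hβ l k k 0).comp_sub_left k).abs
        simpa using this
      have e1 : ∫ z in (1 : ℝ)..k, |peanoKernel β θ l k (k - z)| ≤ C := by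
        refine le_trans ?_ hint
        have : ∫ y in (0 : ℝ)..k, |peanoKernel β θ l k y|
            = ∫ z in (0 : ℝ)..k, |peanoKernel β θ l k (k - z)| := by
          rw [intervalIntegral.integral_comp_sub_left (fun y => |peanoKernel β θ l k y|)]
          simp
        rw [this, ← intervalIntegral.integral_add_adjacent_intervals (a := 0) (b := 1)
          (hsub hcomp le_rfl zero_le_one (by linarith))
          (hsub hcomp zero_le_one (by linarith) le_rfl)]
        have := intervalIntegral.integral_nonneg (μ := volume) (a := 0) (b := 1) zero_le_one
          (f := fun z => |peanoKernel β θ l k (k - z)|) fun z _ => abs_nonneg _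
        linarith
      refine le_trans ?_ (mul_le_mul_of_nonneg_right e1 (by positivity))
      rw [← intervalIntegral.integral_mul_const]
      refine (intervalIntegral.abs_integral_le_integral_abs (by linarith)).trans ?_
      refine intervalIntegral.integral_mono_on (by linarith)
        (hsub hi zero_le_one (by linarith) le_rfl).abs
        ((hsub hcomp zero_le_one (by linarith) le_rfl).mul_const _) fun z hz => ?_
      rw [abs_mul]
      refine mul_le_mul_of_nonneg_left ?_ (abs_nonneg _)
      have hz0 : 0 < z := by linarith [hz.1]
      rw [rlKernel_of_pos _ hz0, sub_add_cancel, abs_of_nonneg (by positivity)]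
      exact div_le_div_of_nonneg_right
        (Real.rpow_le_one_of_one_le_of_nonpos hz.1 (by linarith)) hGν.le
    rw [powerDefect_eq_integral hβ₀ hβ hβs hls hk,
      ← intervalIntegral.integral_add_adjacent_intervals (a := 0) (b := 1)
        (hsub hi le_rfl zero_le_one (by linarith)) (hsub hi zero_le_one (by linarith) le_rfl),
      abs_mul, abs_of_pos hG1]
    have e2 : Real.Gamma (s + 1) * (C * rlKernel (s - l) 1) ≤ C * 2 := by
      rw [rlKernel_of_pos _ one_pos, Real.one_rpow]
      calc _ = C * (Real.Gamma (s + 1) / Real.Gamma (s - l + 1)) := by ring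
        _ ≤ _ := mul_le_mul_of_nonneg_left hratio hC
    have e3 : Real.Gamma (s + 1) * (C * (1 / Real.Gamma (s - l))) ≤ C * 2 := by
      calc _ = C * (Real.Gamma (s + 1) / Real.Gamma (s - l)) := by ring
        _ ≤ _ := mul_le_mul_of_nonneg_left hratio' hC
    have e4 := mul_le_mul_of_nonneg_left ((abs_add_le _ _).trans (add_le_add i0 i1)) hG1.le
    have e5 : 0 ≤ Real.Gamma β * 3 * ((|θ| + |1 - θ|) * 4) := by positivity
    refine e4.trans ?_
    rw [mul_add]
    linarith

/-- For l ≥ 1 the kernel is bounded near 0, so a multiple of the Riemann-Liouville kernel of order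
-β dominates it everywhere; the convolution is then explicit. -/
lemma PeanoDecay.exists_le {β θ : ℝ} {l : ℕ} (hβ₀ : 0 < β) (hβ : β < 1) (hl : 1 ≤ l)
    (h : PeanoDecay β θ l β) : ∃ C : ℝ, 0 ≤ C ∧ ∀ (k : ℕ) (y : ℝ), 0 < y → y ≤ k →
      |peanoKernel β θ l k y| ≤ C * rlKernel (-β) y := by
  obtain ⟨C, hC, h⟩ := h
  have hl1 : (1 : ℝ) ≤ l := by exact_mod_cast hl
  have hG := Real.Gamma_pos_of_pos (show 0 < -β + 1 by linarith)
  set M := 2 * rlKernel l 2 + |θ| * rlKernel (l - β) 2 + |1 - θ| * rlKernel (l - β) 2 with hM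
  have hM0 : 0 ≤ M := by
    have t1 := rlKernel_nonneg (by linarith : (-1 : ℝ) < l) 2
    have t2 := rlKernel_nonneg (by linarith : (-1 : ℝ) < l - β) 2
    positivity
  refine ⟨(C + M * 2) * Real.Gamma (-β + 1), by positivity, fun k y hy hyk => ?_⟩
  rw [rlKernel_of_pos _ hy, mul_div_assoc', mul_right_comm, mul_div_cancel_right₀ _ hG.ne']
  have hy0 : 0 < y ^ (-β) := by positivity
  rcases le_or_gt y 2 with hy2 | hy2
  · have h1 := abs_peanoKernel_le_of_le_two (θ := θ) hβ₀.le hβ l k hy2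
    have h2 : |peanoKernel β θ l k y| ≤ M := by
      refine h1.trans ?_
      have t1 := rlKernel_mono (by linarith : (0 : ℝ) ≤ l - β) hy2
      have t2 := rlKernel_mono (by linarith : (0 : ℝ) ≤ l - β) (show y - 1 ≤ 2 by linarith)
      rw [hM]
      gcongr
    have h3 : 1 ≤ 2 * y ^ (-β) := by
      have t1 : (2 : ℝ) ^ (-β) ≤ y ^ (-β) :=
        Real.rpow_le_rpow_of_nonpos hy hy2 (by linarith)
      have t2 : (2 : ℝ) ^ (-1 : ℝ) ≤ 2 ^ (-β) :=
        Real.rpow_le_rpow_of_exponent_le (by norm_num) (by linarith)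
      rw [Real.rpow_neg_one] at t2
      linarith
    have h4 : 0 ≤ C * y ^ (-β) := by positivity
    nlinarith
  · refine (h k y hy2 hyk).trans (mul_le_mul_of_nonneg_right (by linarith) hy0.le)

/-- Growth of the defect for large exponents. -/
lemma exists_abs_powerDefect_le_rpow {β θ : ℝ} {l : ℕ} (hβ₀ : 0 < β) (hβ : β < 1) (hl : 1 ≤ l)
    (h : PeanoDecay β θ l β) : ∃ C : ℝ, 0 ≤ C ∧ ∀ (k : ℕ) (s : ℝ), 1 ≤ k → l < s →
      |powerDefect β θ k s| ≤ C * (Real.Gamma (s + 1) / Real.Gamma (s + 1 - β - l))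
        * (k : ℝ) ^ (s - β - l) := by
  obtain ⟨C, hC, h⟩ := h.exists_le hβ₀ hβ hl
  refine ⟨C, hC, fun k s hk hls => ?_⟩
  have hk1 : (1 : ℝ) ≤ k := by exact_mod_cast hk
  have hl1 : (1 : ℝ) ≤ l := by exact_mod_cast hl
  have hν : 0 < s - l := by linarith
  have hG1 := Real.Gamma_pos_of_pos (show 0 < s + 1 by linarith)
  have hi := (intervalIntegrable_peanoKernel_mul (θ := θ) (l := l) hβ hν hk).1
  have e1 := integral_rlKernel_conv (a := -β) (b := s - l - 1) (t := k) (k := k) (by linarith)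
    (by linarith) (by linarith) le_rfl
  rw [show -β + (s - l - 1) + 1 = s - β - l by ring, rlKernel_of_pos _ (by linarith),
    show s - β - l + 1 = s + 1 - β - l by ring] at e1
  rw [powerDefect_eq_integral hβ₀ hβ (by linarith) hls hk, abs_mul, abs_of_pos hG1]
  have e2 : |∫ z in (0 : ℝ)..k, peanoKernel β θ l k (k - z) * rlKernel (s - l - 1) z|
      ≤ C * ((k : ℝ) ^ (s - β - l) / Real.Gamma (s + 1 - β - l)) := by
    rw [← e1, ← intervalIntegral.integral_const_mul]
    refine (intervalIntegral.abs_integral_le_integral_abs (by linarith)).trans ?_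
    refine intervalIntegral.integral_mono_on_of_le_Ioo (by linarith) hi.abs
      ((intervalIntegrable_rlKernel_conv (by linarith) (by linarith) (by linarith)
        le_rfl).const_mul C) fun z hz => ?_
    have t := rlKernel_nonneg (by linarith : (-1 : ℝ) < s - l - 1) z
    rw [abs_mul, abs_of_nonneg t, ← mul_assoc]
    exact mul_le_mul_of_nonneg_right (h k _ (by linarith [hz.2]) (by linarith [hz.1])) t
  refine (mul_le_mul_of_nonneg_left e2 hG1.le).trans (le_of_eq (by ring))

/-- The weight of `w^k` in `L_p`. -/
def averageWeight (β : ℝ) (p : ℕ) : ℝ := if p = 1 then 1 else 1 - β / 2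

/-- The consistency error of the quadrature for `t ^ s`. -/
lemma exists_abs_powerDefect_le {β : ℝ} {p : ℕ} (hβ₀ : 0 < β) (hβ : β < 1) (hp : p = 1 ∨ p = 2) :
    ∃ C : ℝ, 0 ≤ C ∧ ∀ (k : ℕ) (s : ℝ), 1 ≤ k → β < s →
      |powerDefect β (averageWeight β p) k s|
        ≤ C * (1 + s) ^ (p + 1) * max 1 ((k : ℝ) ^ (s - β - p)) := by
  have hGβ := Real.Gamma_pos_of_pos hβ₀
  obtain ⟨C₀, hC₀, h0⟩ := exists_abs_powerDefect_le_const (θ := averageWeight β p) hβ₀ hβ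
    (by norm_num) (peanoDecay_zero hβ₀ hβ _)
  -- Exponents up to p: order l = 0 covers s ≤ 1, and for p = 2 order l = 1 covers 1 < s ≤ 2, where
  -- the cancellation at θ = 1 - β/2 is needed.
  have hsmall : ∃ C₁ : ℝ, 0 ≤ C₁ ∧ ∀ (k : ℕ) (s : ℝ), 1 ≤ k → β < s → s ≤ p →
      |powerDefect β (averageWeight β p) k s| ≤ C₁ := by
    rcases hp with rfl | rfl
    · exact ⟨C₀, hC₀, fun k s hk hs hs1 => h0 k s hk hs (by simp; linarith) (by simpa using hs1)⟩
    · obtain ⟨C₁, hC₁, h1⟩ := exists_abs_powerDefect_le_const hβ₀ hβ le_rfl (peanoDecay_one' hβ₀ hβ)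
      have e : averageWeight β 2 = 1 - β / 2 := if_neg (by norm_num)
      rw [e] at *
      refine ⟨max C₀ C₁, le_max_of_le_left hC₀, fun k s hk hs hs1 => ?_⟩
      rcases le_or_gt s 1 with h | h
      · exact (h0 k s hk hs (by simp; linarith) (by simpa using h)).trans (le_max_left _ _)
      · exact (h1 k s hk hs (by simpa using h) (by push_cast at *; linarith)).trans
          (le_max_right _ _)
  obtain ⟨C₁, hC₁, h1⟩ := hsmall
  have hp1 : 1 ≤ p := by rcases hp with rfl | rfl <;> norm_num
  have hdecay : PeanoDecay β (averageWeight β p) p β := by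
    rcases hp with rfl | rfl
    · exact peanoDecay_one hβ₀ hβ _
    · rw [show averageWeight β 2 = 1 - β / 2 from if_neg (by norm_num)]
      exact peanoDecay_two hβ₀ hβ
  obtain ⟨C₂, hC₂, h2⟩ := exists_abs_powerDefect_le_rpow hβ₀ hβ hp1 hdecay
  -- Lowering the argument by p costs p factors of size at most 1 + s; with the linear bound for the
  -- first quotient this gives the power p + 1.
  have hΓ : ∀ s : ℝ, (p : ℝ) < s → Real.Gamma (s + 1) / Real.Gamma (s + 1 - β - p)
      ≤ Real.Gamma β * (1 + s) ^ (p + 1) := by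
    intro s hs
    have hp1' : (1 : ℝ) ≤ p := by exact_mod_cast hp1
    have t1 := gamma_div_gamma_le hβ₀ hβ (show β < s by linarith)
    have t2 := gamma_div_gamma_nonneg hβ (show 0 < s by linarith)
    have t3 := Real.Gamma_pos_of_pos (show 0 < s + 1 - β - p by linarith)
    have key : Real.Gamma (s + 1 - β) ≤ (1 + s) ^ p * Real.Gamma (s + 1 - β - p) := by
      rcases hp with rfl | rfl
      · simp only [Nat.cast_one] at *
        have e : s + 1 - β = s + 1 - β - 1 + 1 := by ring
        rw [e, Real.Gamma_add_one (by linarith), ← e, pow_one]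
        exact mul_le_mul_of_nonneg_right (by linarith) t3.le
      · simp only [Nat.cast_ofNat] at *
        have e1 : s + 1 - β = s - β + 1 := by ring
        have e2 : s - β = s + 1 - β - 2 + 1 := by ring
        have t4 : Real.Gamma (s + 1 - β) = (s - β) * ((s + 1 - β - 2)
            * Real.Gamma (s + 1 - β - 2)) := by
          rw [← Real.Gamma_add_one (by linarith : s + 1 - β - 2 ≠ 0), ← e2,
            ← Real.Gamma_add_one (by linarith : s - β ≠ 0), ← e1]
        rw [t4, ← mul_assoc]
        exact mul_le_mul_of_nonneg_right (by nlinarith) t3.le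
    have t5 : 1 / Real.Gamma (s + 1 - β - p) ≤ (1 + s) ^ p / Real.Gamma (s + 1 - β) := by
      rw [div_le_div_iff₀ t3 (Real.Gamma_pos_of_pos (by linarith)), one_mul]
      exact key
    have hG1 := Real.Gamma_pos_of_pos (show 0 < s + 1 by linarith)
    calc _ = Real.Gamma (s + 1) * (1 / Real.Gamma (s + 1 - β - p)) := by ring
      _ ≤ Real.Gamma (s + 1) * ((1 + s) ^ p / Real.Gamma (s + 1 - β)) :=
        mul_le_mul_of_nonneg_left t5 hG1.le
      _ = Real.Gamma (s + 1) / Real.Gamma (s + 1 - β) * (1 + s) ^ p := by ring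
      _ ≤ Real.Gamma β * (1 + s) * (1 + s) ^ p :=
        mul_le_mul_of_nonneg_right t1 (pow_nonneg (by linarith) p)
      _ = _ := by ring
  refine ⟨C₁ + C₂ * Real.Gamma β, by positivity, fun k s hk hs => ?_⟩
  have hs1 : 1 ≤ (1 + s) ^ (p + 1) := one_le_pow₀ (by linarith)
  have hm1 : 1 ≤ max 1 ((k : ℝ) ^ (s - β - p)) := le_max_left _ _
  have hA : 1 ≤ (1 + s) ^ (p + 1) * max 1 ((k : ℝ) ^ (s - β - p)) := one_le_mul_of_one_le_of_one_le hs1 hm1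
  rw [mul_assoc, add_mul]
  have hCG : 0 ≤ C₂ * Real.Gamma β * ((1 + s) ^ (p + 1) * max 1 ((k : ℝ) ^ (s - β - p))) := by
    positivity
  rcases le_or_gt s p with hsp | hsp
  · have := h1 k s hk hs hsp
    have : C₁ * 1 ≤ C₁ * ((1 + s) ^ (p + 1) * max 1 ((k : ℝ) ^ (s - β - p))) :=
      mul_le_mul_of_nonneg_left hA hC₁
    linarith
  · have t1 := h2 k s hk hsp
    have t2 : C₂ * (Real.Gamma (s + 1) / Real.Gamma (s + 1 - β - p)) * (k : ℝ) ^ (s - β - p)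
        ≤ C₂ * (Real.Gamma β * (1 + s) ^ (p + 1)) * max 1 ((k : ℝ) ^ (s - β - p)) := by
      refine mul_le_mul (mul_le_mul_of_nonneg_left (hΓ s hsp) hC₂) (le_max_right _ _)
        (by positivity) (by positivity)
    have t3 : 0 ≤ C₁ * ((1 + s) ^ (p + 1) * max 1 ((k : ℝ) ^ (s - β - p))) := by positivity
    refine (t1.trans t2).trans ?_
    nlinarith


/-! ### Discrete fractional Grönwall inequality -/

/-- The coefficients of `(1 - z) ^ (-1 - β)`. -/
def barrier (β : ℝ) (k : ℕ) : ℝ := cqWeight (-β - 1) k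

lemma barrier_succ (β : ℝ) (n : ℕ) : barrier β (n + 1) * (n + 1) = barrier β n * (n + 1 + β) := by
  rw [barrier, barrier, cqWeight_succ]
  ring

lemma barrier_pos {β : ℝ} (hβ : 0 < β) (n : ℕ) : 0 < barrier β n := by
  induction n with
  | zero => simp [barrier, cqWeight_zero]
  | succ n ih =>
    have h1 := barrier_succ β n
    have h2 : 0 < barrier β n * (n + 1 + β) := by positivity
    rw [← h1] at h2
    exact pos_of_mul_pos_left h2 (by positivity)

/-- Coefficient form of (1 - z)^β (1 - z)^(-1-β) = (1 - z)^(-1), by Vandermonde's convolution. -/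
lemma sum_cqWeight_mul_barrier (β : ℝ) (k : ℕ) :
    ∑ j ∈ Finset.range (k + 1), cqWeight β (k - j) * barrier β j = 1 := by
  have h1 : ∀ k, cqWeight (-1) k = 1 := by
    intro k
    induction k with
    | zero => exact cqWeight_zero _
    | succ n ih =>
      have := cqWeight_succ (-1) n
      rw [ih] at this
      have h2 : (n + 1 : ℝ) ≠ 0 := by positivity
      exact mul_right_cancel₀ h2 (by linarith)
  have h2 := Ring.add_choose_eq (r := -β - 1) (s := β) k (Commute.all _ _)
  rw [Finset.Nat.sum_antidiagonal_eq_sum_range_succ_mk, show -β - 1 + β = -1 by ring] at h2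
  rw [← h1 k, cqWeight, h2, Finset.mul_sum]
  refine Finset.sum_congr rfl fun j hj => ?_
  have hjk : j ≤ k := Nat.lt_succ_iff.1 (Finset.mem_range.1 hj)
  rw [barrier, cqWeight, cqWeight]
  have : (-1 : ℝ) ^ k = (-1) ^ (k - j) * (-1) ^ j := by rw [← pow_add, Nat.sub_add_cancel hjk]
  rw [this]
  ring

/-- Bernoulli's inequality for the exponent β < 1 gives n^β ≤ (1 - β/(n+1)) (n+1)^β, and the
recurrence multiplies by 1 + β/(n+1); the product is at most 1. -/
lemma barrier_le {β : ℝ} (hβ₀ : 0 < β) (hβ : β < 1) {n : ℕ} (hn : 1 ≤ n) :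
    barrier β n ≤ 2 * (n : ℝ) ^ β := by
  induction n, hn using Nat.le_induction with
  | base =>
    have := barrier_succ β 0
    simp [barrier, cqWeight_zero] at this ⊢
    linarith
  | succ n hn ih =>
    have hn0 : (0 : ℝ) < n := by exact_mod_cast hn
    have h1 := barrier_succ β n
    have h2 : (1 + -(1 / ((n : ℝ) + 1))) ^ β ≤ 1 + β * -(1 / ((n : ℝ) + 1)) :=
      rpow_one_add_le_one_add_mul_self (by
        have : 1 / ((n : ℝ) + 1) ≤ 1 := by
          rw [div_le_one (by positivity)]; linarith
        linarith) hβ₀.le hβ.le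
    have e1 : 1 + -(1 / ((n : ℝ) + 1)) = n / (n + 1) := by field_simp; ring
    rw [e1, Real.div_rpow hn0.le (by positivity), div_le_iff₀ (by positivity)] at h2
    have h3 : barrier β (n + 1) = barrier β n * (1 + β / (n + 1)) := by
      have h4 : (n + 1 : ℝ) ≠ 0 := by positivity
      refine mul_right_cancel₀ h4 ?_
      rw [h1]; field_simp
    have hX : (0 : ℝ) < ((n : ℝ) + 1) ^ β := by positivity
    have ht : 0 ≤ β / ((n : ℝ) + 1) := by positivity
    rw [h3]
    push_cast
    calc barrier β n * (1 + β / (n + 1)) ≤ 2 * (n : ℝ) ^ β * (1 + β / (n + 1)) := by gcongr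
      _ ≤ 2 * ((1 + β * -(1 / ((n : ℝ) + 1))) * ((n : ℝ) + 1) ^ β) * (1 + β / (n + 1)) := by gcongr
      _ = 2 * ((n : ℝ) + 1) ^ β * (1 - (β / (n + 1)) ^ 2) := by ring
      _ ≤ 2 * ((n : ℝ) + 1) ^ β :=
        mul_le_of_le_one_right (by positivity) (by nlinarith)

/-- Comparison principle for the discrete fractional derivative. -/
lemma le_of_sum_cqWeight_mul_le {β A : ℝ} {n : ℕ} {y : ℕ → ℝ} (hβ₀ : 0 < β) (hβ : β < 1)
    (hA : 0 ≤ A) (h0 : y 0 ≤ 0)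
    (h : ∀ k, 1 ≤ k → k ≤ n → ∑ j ∈ Finset.range (k + 1), cqWeight β (k - j) * y j ≤ A) :
    ∀ k ≤ n, y k ≤ A * barrier β k := by
  intro k
  induction k using Nat.strong_induction_on with
  | _ k ih =>
    intro hk
    rcases Nat.eq_zero_or_pos k with rfl | hk1
    · exact h0.trans (mul_nonneg hA (barrier_pos hβ₀ 0).le)
    · have h1 := h k hk1 hk
      have h2 := sum_cqWeight_mul_barrier β k
      rw [Finset.sum_range_succ, Nat.sub_self, cqWeight_zero, one_mul] at h1 h2
      -- All weights here have positive index and are nonpositive, so upper bounds for the earlier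
      -- values bound the sum from below.
      have h3 : A * ∑ j ∈ Finset.range k, cqWeight β (k - j) * barrier β j
          ≤ ∑ j ∈ Finset.range k, cqWeight β (k - j) * y j := by
        rw [Finset.mul_sum]
        refine Finset.sum_le_sum fun j hj => ?_
        have hj := Finset.mem_range.1 hj
        obtain ⟨i, hi⟩ : ∃ i, k - j = i + 1 := ⟨k - j - 1, by omega⟩
        rw [hi, mul_left_comm]
        exact mul_le_mul_of_nonpos_left (ih j hj (by omega)) (cqWeight_succ_nonpos hβ₀.le hβ i)
      have h4 : A * ∑ j ∈ Finset.range k, cqWeight β (k - j) * barrier β j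
          = A - A * barrier β k := by
        rw [eq_sub_of_add_eq h2]; ring
      linarith

/-! ### Coercivity of the convolution quadrature -/

lemma innerL2_self_nonneg (a : ℝ[X]) : 0 ≤ innerL2 a a := by
  rw [innerL2_self]; exact sq_nonneg _

lemma innerL2_sub_mul_two (a b m : ℝ[X]) : 2 * innerL2 (a - b) m =
    (innerL2 a a - innerL2 b b) + (innerL2 (b - m) (b - m) - innerL2 (a - m) (a - m)) := by
  simp only [innerL2_sub_left, innerL2_sub_right]
  rw [innerL2_comm m a, innerL2_comm m b]
  ring

/-- Polarization about the averaged value m reduces the claim to ∑ ϖ_{l+1-j} Q_j ≤ b_{l+1} Q_0 with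
Q_j = ‖e_j - m‖² and b_{l+1} the full sum of the weights. The only positive weight multiplies
Q_{l+1} = (1-θ)² ‖e_{l+1} - e_l‖², which is absorbed by ϖ_1 Q_l = -β θ² ‖e_{l+1} - e_l‖²; this is
the condition on θ. -/
lemma innerL2_sum_cqWeight_ge {β θ : ℝ} (hβ₀ : 0 < β) (hβ : β < 1) (hθ : (1 - θ) ^ 2 ≤ β * θ ^ 2)
    (e : ℕ → ℝ[X]) (l : ℕ) :
    ∑ j ∈ Finset.range (l + 1 + 1), cqWeight β (l + 1 - j)
        * (innerL2 (e j) (e j) - innerL2 (e 0) (e 0))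
      ≤ 2 * innerL2 (∑ j ∈ Finset.range (l + 1 + 1), cqWeight β (l + 1 - j) • (e j - e 0))
          (θ • e (l + 1) + (1 - θ) • e l) := by
  set m := θ • e (l + 1) + (1 - θ) • e l with hm
  set Q : ℕ → ℝ := fun j => innerL2 (e j - m) (e j - m) with hQ
  have hQ0 : ∀ j, 0 ≤ Q j := fun j => innerL2_self_nonneg _
  have e1 : 2 * innerL2 (∑ j ∈ Finset.range (l + 1 + 1), cqWeight β (l + 1 - j) • (e j - e 0)) m
      = ∑ j ∈ Finset.range (l + 1 + 1), cqWeight β (l + 1 - j)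
          * (innerL2 (e j) (e j) - innerL2 (e 0) (e 0))
        + (cqSum β (l + 1) * Q 0 - ∑ j ∈ Finset.range (l + 1 + 1), cqWeight β (l + 1 - j) * Q j) := by
    have e2 : cqSum β (l + 1) * Q 0
        = ∑ j ∈ Finset.range (l + 1 + 1), cqWeight β (l + 1 - j) * Q 0 := by
      rw [cqSum, Finset.sum_mul, ← Finset.sum_range_reflect]
      refine Finset.sum_congr rfl fun j _ => ?_
      rw [Nat.add_sub_cancel]
    rw [e2, ← Finset.sum_sub_distrib, ← Finset.sum_add_distrib, innerL2_sum_left, Finset.mul_sum]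
    refine Finset.sum_congr rfl fun j _ => ?_
    rw [innerL2_smul_left]
    have := innerL2_sub_mul_two (e j) (e 0) m
    simp only [hQ]
    linear_combination cqWeight β (l + 1 - j) * this
  rw [e1]
  have hd1 : Q (l + 1) = (1 - θ) ^ 2 * innerL2 (e (l + 1) - e l) (e (l + 1) - e l) := by
    have : e (l + 1) - m = (1 - θ) • (e (l + 1) - e l) := by rw [hm]; module
    simp only [hQ]
    rw [this, innerL2_smul_left, innerL2_smul_right]; ring
  have hd2 : Q l = θ ^ 2 * innerL2 (e (l + 1) - e l) (e (l + 1) - e l) := by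
    have : e l - m = (-θ) • (e (l + 1) - e l) := by rw [hm]; module
    simp only [hQ]
    rw [this, innerL2_smul_left, innerL2_smul_right]; ring
  have hD := innerL2_self_nonneg (e (l + 1) - e l)
  have hϖ : cqWeight β 1 = -β := by
    have := cqWeight_succ_eq β 0
    simpa [cqSum_zero] using this
  have h3 : ∑ j ∈ Finset.range (l + 1 + 1), cqWeight β (l + 1 - j) * Q j ≤ 0 := by
    rw [Finset.sum_range_succ, Finset.sum_range_succ, Nat.sub_self, cqWeight_zero, one_mul,
      Nat.add_sub_cancel_left, hϖ, hd1, hd2]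
    have h4 : ∑ j ∈ Finset.range l, cqWeight β (l + 1 - j) * Q j ≤ 0 :=
      Finset.sum_nonpos fun j hj => by
        have hj := Finset.mem_range.1 hj
        obtain ⟨i, hi⟩ : ∃ i, l + 1 - j = i + 1 := ⟨l - j, by omega⟩
        rw [hi]
        exact mul_nonpos_of_nonpos_of_nonneg (cqWeight_succ_nonpos hβ₀.le hβ i) (hQ0 j)
    nlinarith
  have h5 := mul_nonneg (cqSum_pos hβ (l + 1)).le (hQ0 0)
  linarith

lemma timeAverage_eq {E : Type*} [AddCommGroup E] [Module ℝ E] {β : ℝ} {p : ℕ} (w : ℕ → E)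
    (l : ℕ) : timeAverage β p w (l + 1)
      = averageWeight β p • w (l + 1) + (1 - averageWeight β p) • w l := by
  unfold timeAverage averageWeight
  split_ifs
  · simp
  · rw [Nat.add_sub_cancel, sub_sub_cancel]

lemma averageWeight_coercive {β : ℝ} (p : ℕ) (hβ₀ : 0 < β) (hβ : β < 1) :
    (1 - averageWeight β p) ^ 2 ≤ β * averageWeight β p ^ 2 := by
  unfold averageWeight
  split_ifs
  · simp; exact hβ₀.le
  -- For θ = 1 - β/2 the difference of the two sides is β(1-β)(4-β)/4.
  · have : 0 ≤ β * ((1 - β) * (4 - β)) := by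
      refine mul_nonneg hβ₀.le (mul_nonneg ?_ ?_) <;> linarith
    nlinarith

/-! ### Stability of the scheme -/

lemma timeAverage_mem_galerkinSpace {β : ℝ} {p N : ℕ} {e : ℕ → ℝ[X]} {l : ℕ}
    (h : e l ∈ galerkinSpace N) (h' : e (l + 1) ∈ galerkinSpace N) :
    timeAverage β p e (l + 1) ∈ galerkinSpace N := by
  obtain ⟨h1, h2, h3⟩ := h
  obtain ⟨h1', h2', h3'⟩ := h'
  rw [timeAverage_eq]
  refine ⟨(natDegree_add_le _ _).trans (max_le ((natDegree_smul_le _ _).trans h1')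
    ((natDegree_smul_le _ _).trans h1)), by simp [h2, h2'], by simp [h3, h3']⟩

lemma derivative_timeAverage {β : ℝ} {p : ℕ} (e : ℕ → ℝ[X]) (l : ℕ) :
    derivative (timeAverage β p e (l + 1)) = timeAverage β p (fun j => derivative (e j)) (l + 1) := by
  simp [timeAverage_eq]

/-- The test function is L_p e^k, which requires e^0 to lie in V_N^0 as well. Coercivity of the
quadrature and absorption into the diffusion term leave a scalar inequality for ‖e^j‖² - ‖e^0‖² with
a constant right-hand side, to which the comparison principle and the bound 2 k^β for the barrier
apply. -/
theorem galerkin_stability {β μ τ M : ℝ} {p N n : ℕ} (hβ₀ : 0 < β) (hβ : β < 1) (hμ : 0 < μ)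
    (hτ : 0 < τ) {e : ℕ → ℝ[X]} (he : ∀ k ≤ n, e k ∈ galerkinSpace N)
    (h : ∀ k, 1 ≤ k → k ≤ n → ∀ v ∈ galerkinSpace N,
      |innerL2 (discreteFracDeriv β τ e k) v
        + μ * innerL2 (timeAverage β p (fun j => derivative (e j)) k) (derivative v)|
      ≤ M * normL2 (fun x => v.eval x)) (hM : 0 ≤ M) {k : ℕ} (hk : 1 ≤ k) (hkn : k ≤ n) :
    normL2 (fun x => (e k).eval x) ^ 2
      ≤ normL2 (fun x => (e 0).eval x) ^ 2 + 16 * M ^ 2 / μ * (k * τ) ^ β := by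
  set A := τ ^ β * (8 * M ^ 2 / μ) with hA
  have hA0 : 0 ≤ A := by positivity
  have hτβ : 0 < τ ^ β := by positivity
  have key := le_of_sum_cqWeight_mul_le (y := fun j => innerL2 (e j) (e j) - innerL2 (e 0) (e 0))
    (n := n) hβ₀ hβ hA0 (by simp) (fun k hk hkn => ?_) k hkn
  · have h1 := barrier_le hβ₀ hβ hk
    have h2 := mul_le_mul_of_nonneg_left h1 hA0
    rw [← innerL2_self, ← innerL2_self, Real.mul_rpow (by positivity) hτ.le]
    have e1 : A * (2 * (k : ℝ) ^ β) = 16 * M ^ 2 / μ * ((k : ℝ) ^ β * τ ^ β) := by rw [hA]; ring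
    linarith
  · obtain ⟨l, rfl⟩ : ∃ l, k = l + 1 := ⟨k - 1, by omega⟩
    have h1 := innerL2_sum_cqWeight_ge hβ₀ hβ (averageWeight_coercive p hβ₀ hβ) e l
    rw [← timeAverage_eq] at h1
    have hv := timeAverage_mem_galerkinSpace (β := β) (p := p) (he l (by omega)) (he (l + 1) hkn)
    have h2 := h (l + 1) hk hkn _ hv
    rw [← derivative_timeAverage, discreteFracDeriv, innerL2_smul_left] at h2
    set v := timeAverage β p e (l + 1)
    have h3 := (isPrim_eval v).normL2_le hv.2.1
    rw [innerL2_self] at h2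
    set S := innerL2 (∑ j ∈ Finset.range (l + 1 + 1), cqWeight β (l + 1 - j) • (e j - e 0)) v
    set X := normL2 fun x => (derivative v).eval x
    have h4 := (abs_le.1 h2).2
    have h5 : M * normL2 (fun x => v.eval x) ≤ M * (4 * X) := mul_le_mul_of_nonneg_left h3 hM
    -- Young's inequality, scaled so that the diffusion term μ X² is used up exactly; the 4 is the
    -- Poincaré constant.
    have h6 : M * (4 * X) ≤ μ * X ^ 2 + 4 * M ^ 2 / μ := by
      have : 0 ≤ (μ * X - 2 * M) ^ 2 / μ := by positivity
      have e1 : (μ * X - 2 * M) ^ 2 / μ = μ * X ^ 2 - M * (4 * X) + 4 * M ^ 2 / μ := by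
        field_simp; ring
      linarith
    have h7 : S ≤ τ ^ β * (4 * M ^ 2 / μ) := by
      have : 1 / τ ^ β * S ≤ 4 * M ^ 2 / μ := by linarith
      rwa [one_div, inv_mul_le_iff₀ hτβ] at this
    refine h1.trans ?_
    have e2 : A = 2 * (τ ^ β * (4 * M ^ 2 / μ)) := by rw [hA]; ring
    linarith


/-! ### Expansions in powers of `t` -/

/-- Exponents and coefficients of an expansion in powers of `t` which converges absolutely in
`H^(k+1)(I)` together with its derivatives up to the order `l`. -/
structure IsExpansionFamily (β T : ℝ) (l k : ℕ) (σ : ℕ → ℝ) (c : ℕ → ℝ → ℝ) (B : ℕ → ℝ) : Prop where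
  lt : ∀ j, β < σ j
  chain : ∀ j, ∃ h, SobChain (k + 1) h (B j) ∧ h 0 = c j
  summable : Summable fun j => (1 + σ j) ^ l * T ^ σ j * B j

lemma HasTimeExpansion.exists_isExpansionFamily {β T m : ℝ} {l k : ℕ} {u₀ : ℝ → ℝ}
    {u : ℝ → ℝ → ℝ} {σ : ℕ → ℝ} {c : ℕ → ℝ → ℝ} (h : HasTimeExpansion T m l u₀ u σ c)
    (hβ : 0 < β) (hT : 0 < T) (hσ : β < σ 0) (hk : k + 1 ≤ ⌊m⌋₊) :
    ∃ B, IsExpansionFamily β T l k σ c B := by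
  have hlt : ∀ j, β < σ j := fun j => hσ.trans_le (h.strictMono.monotone (Nat.zero_le j))
  set w : ℕ → ℝ := fun j => (1 + σ j) ^ l * T ^ σ j with hw
  have hw0 : ∀ j, 0 < w j := fun j => by
    have := hlt j
    have : 0 < 1 + σ j := by linarith
    positivity
  -- The small positive addition provides the strict bound needed to extract a chain, even for a
  -- zero coefficient; after multiplication by the weight it is a geometric series.
  refine ⟨fun j => (sobolevNorm m (c j)).toReal + (1 / 2) ^ j / w j, hlt, fun j => ?_, ?_⟩
  · refine exists_sobChain hk (h.coeff j).1 ?_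
    have : 0 < (1 / 2 : ℝ) ^ j / w j := by have := hw0 j; positivity
    exact (ENNReal.lt_ofReal_iff_toReal_lt (h.coeff j).2.ne).2 (by linarith)
  · have h1 := (ENNReal.summable_toReal h.converges.ne).add
      (summable_geometric_of_lt_one (r := (1 / 2 : ℝ)) (by norm_num) (by norm_num))
    refine h1.congr fun j => ?_
    rw [ENNReal.toReal_mul, ENNReal.toReal_ofReal (hw0 j).le, mul_add,
      mul_div_cancel₀ _ (hw0 j).ne']

namespace IsExpansionFamily

variable {β T : ℝ} {l k : ℕ} {σ : ℕ → ℝ} {c : ℕ → ℝ → ℝ} {B : ℕ → ℝ}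

lemma nonneg (H : IsExpansionFamily β T l k σ c B) (j : ℕ) : 0 ≤ B j :=
  (H.chain j).choose_spec.1.nonneg

lemma abs_le (H : IsExpansionFamily β T l k σ c B) (j : ℕ) {x : ℝ} (hx : x ∈ Icc (-1 : ℝ) 1) :
    |c j x| ≤ 5 * B j := by
  obtain ⟨h, hc, h0⟩ := H.chain j
  rw [← h0]
  exact hc.abs_le hx

lemma continuousOn (H : IsExpansionFamily β T l k σ c B) (j : ℕ) :
    ContinuousOn (c j) (Icc (-1) 1) := by
  obtain ⟨h, hc, h0⟩ := H.chain j
  rw [← h0]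
  exact (hc.prim 0 (by omega)).continuousOn

/-- The sum of the weighted norms of the coefficients. -/
lemma summable_mul (H : IsExpansionFamily β T l k σ c B) {a : ℕ → ℝ} {K : ℝ}
    (ha : ∀ j, |a j| ≤ K * ((1 + σ j) ^ l * T ^ σ j)) : Summable fun j => |a j| * B j := by
  refine Summable.of_nonneg_of_le (fun j => mul_nonneg (abs_nonneg _) (H.nonneg j)) (fun j => ?_)
    (H.summable.mul_left K)
  rw [← mul_assoc]
  exact mul_le_mul_of_nonneg_right (ha j) (H.nonneg j)

lemma tsum_mul_le (H : IsExpansionFamily β T l k σ c B) {a : ℕ → ℝ} {K : ℝ}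
    (ha : ∀ j, |a j| ≤ K * ((1 + σ j) ^ l * T ^ σ j)) :
    ∑' j, |a j| * B j ≤ K * ∑' j, (1 + σ j) ^ l * T ^ σ j * B j := by
  rw [← tsum_mul_left]
  refine (H.summable_mul ha).tsum_le_tsum (fun j => ?_) (H.summable.mul_left K)
  rw [← mul_assoc]
  exact mul_le_mul_of_nonneg_right (ha j) (H.nonneg j)

lemma norm_mul_le (H : IsExpansionFamily β T l k σ c B) (a : ℕ → ℝ) (j : ℕ) {x : ℝ}
    (hx : x ∈ Icc (-1 : ℝ) 1) : ‖a j * c j x‖ ≤ 5 * (|a j| * B j) := by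
  rw [norm_mul, Real.norm_eq_abs, Real.norm_eq_abs]
  nlinarith [mul_le_mul_of_nonneg_left (H.abs_le j hx) (abs_nonneg (a j))]

lemma summable_series (H : IsExpansionFamily β T l k σ c B) {a : ℕ → ℝ} {K : ℝ}
    (ha : ∀ j, |a j| ≤ K * ((1 + σ j) ^ l * T ^ σ j)) {x : ℝ} (hx : x ∈ Icc (-1 : ℝ) 1) :
    Summable fun j => a j * c j x :=
  Summable.of_norm_bounded ((H.summable_mul ha).mul_left 5) fun j => H.norm_mul_le a j hx

lemma abs_series_le (H : IsExpansionFamily β T l k σ c B) {a : ℕ → ℝ} {K : ℝ}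
    (ha : ∀ j, |a j| ≤ K * ((1 + σ j) ^ l * T ^ σ j)) {x y : ℝ} (hx : x ∈ Icc (-1 : ℝ) 1)
    (hy : HasSum (fun j => a j * c j x) y) :
    |y| ≤ 5 * (K * ∑' j, (1 + σ j) ^ l * T ^ σ j * B j) := by
  have h1 := HasSum.norm_le_of_bounded hy ((H.summable_mul ha).mul_left 5).hasSum
    fun j => H.norm_mul_le a j hx
  rw [tsum_mul_left] at h1
  exact h1.trans (mul_le_mul_of_nonneg_left (H.tsum_mul_le ha) (by norm_num))

lemma continuousOn_series (H : IsExpansionFamily β T l k σ c B) {a : ℕ → ℝ} {K : ℝ}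
    (ha : ∀ j, |a j| ≤ K * ((1 + σ j) ^ l * T ^ σ j)) {h : ℝ → ℝ}
    (hh : ∀ x ∈ Icc (-1 : ℝ) 1, HasSum (fun j => a j * c j x) (h x)) :
    ContinuousOn h (Icc (-1) 1) := by
  refine (continuousOn_tsum (f := fun j x => a j * c j x)
    (fun j => continuousOn_const.mul (H.continuousOn j)) ((H.summable_mul ha).mul_left 5)
    fun j x hx => H.norm_mul_le a j hx).congr fun x hx => (hh x hx).tsum_eq.symm

lemma exists_chain_sum (H : IsExpansionFamily β T l k σ c B) (a : ℕ → ℝ) (n : ℕ) :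
    ∃ h, SobChain (k + 1) h (∑ j ∈ Finset.range n, |a j| * B j) ∧
      h 0 = fun x => ∑ j ∈ Finset.range n, a j * c j x := by
  induction n with
  | zero =>
    obtain ⟨h, hc, -⟩ := H.chain 0
    refine ⟨_, by simpa using hc.const_mul 0, ?_⟩
    simp
  | succ n ih =>
    obtain ⟨h, hc, h0⟩ := ih
    obtain ⟨g, hg, g0⟩ := H.chain n
    refine ⟨_, by rw [Finset.sum_range_succ]; exact hc.add (hg.const_mul (a n)), ?_⟩
    ext x
    simp [h0, g0, Finset.sum_range_succ]

end IsExpansionFamily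

/-- The error of the elliptic projection for the sum of a series. -/
lemma exists_ellProj_series_error_le (k : ℕ) : ∃ C : ℝ, 0 ≤ C ∧
    ∀ {β T : ℝ} {l : ℕ} {σ : ℕ → ℝ} {c : ℕ → ℝ → ℝ} {B : ℕ → ℝ},
      IsExpansionFamily β T l k σ c B → ∀ (a : ℕ → ℝ) (K : ℝ) (h : ℝ → ℝ) (N : ℕ),
      (∀ j, |a j| ≤ K * ((1 + σ j) ^ l * T ^ σ j)) →
      (∀ x ∈ Icc (-1 : ℝ) 1, HasSum (fun j => a j * c j x) (h x)) → 1 ≤ N →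
      (N : ℝ) ^ (k + 1) * normL2 (fun x => h x - (ellProj N h).eval x)
        ≤ C * (K * ∑' j, (1 + σ j) ^ l * T ^ σ j * B j) := by
  obtain ⟨C, hC, hp⟩ := exists_ellProj_error_le k
  refine ⟨C, hC, fun {β T l σ c B} H a K h N ha hh hN => ?_⟩
  obtain ⟨M, hM, hM'⟩ := exists_normL2_ellProj_le N
  set S : ℕ → ℝ := fun n => ∑ j ∈ Finset.range n, |a j| * B j with hS
  have hsum := (H.summable_mul ha).hasSum
  have hSlim : Tendsto S atTop (𝓝 (∑' j, |a j| * B j)) := hsum.tendsto_sum_nat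
  have hSle : ∀ n, S n ≤ ∑' j, |a j| * B j := fun n =>
    (H.summable_mul ha).sum_le_tsum _ fun j _ => mul_nonneg (abs_nonneg _) (H.nonneg j)
  have hhm : MemLp h 2 volI := (H.continuousOn_series ha hh).memLp_volI 2
  -- The estimate is applied to partial sums, which have chains of derivatives; the tail is small in
  -- the uniform norm, where Π is continuous for fixed N. No chain for the limit function is needed.
  have key : ∀ n, (N : ℝ) ^ (k + 1) * normL2 (fun x => h x - (ellProj N h).eval x)
      ≤ C * (K * ∑' j, (1 + σ j) ^ l * T ^ σ j * B j)
        + (N : ℝ) ^ (k + 1) * ((2 + M) * (5 * ((∑' j, |a j| * B j) - S n))) := by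
    intro n
    obtain ⟨g, hg, g0⟩ := H.exists_chain_sum a n
    have hgm : MemLp (g 0) 2 volI := hg.memLp 0 (by omega)
    have h1 := (hp g _ N hg hN).2
    set ε := 5 * ((∑' j, |a j| * B j) - S n) with hε
    have hε0 : 0 ≤ ε := by have := hSle n; rw [hε]; linarith
    have htail : ∀ x ∈ Icc (-1 : ℝ) 1, |h x - g 0 x| ≤ ε := by
      intro x hx
      have t1 := (hasSum_nat_add_iff' n).2 (hh x hx)
      have t2 := ((hasSum_nat_add_iff' n).2 hsum).mul_left 5
      rw [g0]
      exact HasSum.norm_le_of_bounded t1 t2 fun j => H.norm_mul_le a (j + n) hx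
    have h2 := normL2_le_of_bound hε0 fun x hx => htail x (Ioo_subset_Icc_self hx)
    have h3 := hM' _ ε hε0 htail
    have h4 : normL2 (fun x => h x - (ellProj N h).eval x)
        ≤ normL2 (fun x => g 0 x - (ellProj N (g 0)).eval x) + (2 * ε + M * ε) := by
      have e : ∀ x, h x - (ellProj N h).eval x = (g 0 x - (ellProj N (g 0)).eval x)
          + ((h x - g 0 x) - (ellProj N fun x => h x - g 0 x).eval x) := fun x => by
        rw [ellProj_sub hhm hgm, eval_sub]; ring
      simp only [e]
      refine (normL2_add_le (hgm.sub (memLp_eval _ _)) ((hhm.sub hgm).sub (memLp_eval _ _))).trans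
        (add_le_add le_rfl ((normL2_sub_le (hhm.sub hgm) (memLp_eval _ _)).trans ?_))
      exact add_le_add h2 h3
    have hN0 : (0 : ℝ) ≤ (N : ℝ) ^ (k + 1) := by positivity
    have h5 := mul_le_mul_of_nonneg_left h4 hN0
    have h6 : C * S n ≤ C * (K * ∑' j, (1 + σ j) ^ l * T ^ σ j * B j) :=
      mul_le_mul_of_nonneg_left ((hSle n).trans (H.tsum_mul_le ha)) hC
    refine h5.trans ?_
    rw [mul_add]
    refine add_le_add (h1.trans h6) (le_of_eq (by ring))
  refine ge_of_tendsto' (f := fun n => C * (K * ∑' j, (1 + σ j) ^ l * T ^ σ j * B j)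
    + (N : ℝ) ^ (k + 1) * ((2 + M) * (5 * ((∑' j, |a j| * B j) - S n)))) (x := atTop) ?_ key
  have := ((((hSlim.const_sub (∑' j, |a j| * B j)).const_mul 5).const_mul (2 + M)).const_mul
    ((N : ℝ) ^ (k + 1))).const_add (C * (K * ∑' j, (1 + σ j) ^ l * T ^ σ j * B j))
  simpa using this

/-! ### The Caputo derivative of an expansion -/

/-- `Γ(s + 1) / Γ(s + 1 - β)`, the factor in the Caputo derivative of `t ^ s`. -/
def caputoCoeff (β s : ℝ) : ℝ := Real.Gamma (s + 1) / Real.Gamma (s + 1 - β)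

/-- The termwise Caputo derivative. -/
def caputoSeries (β : ℝ) (σ : ℕ → ℝ) (c : ℕ → ℝ → ℝ) (t x : ℝ) : ℝ :=
  ∑' j, caputoCoeff β (σ j) * t ^ (σ j - β) * c j x

lemma mul_integral_caputo_kernel {β s t : ℝ} (hβ : β < 1) (hs : 0 < s) (ht : 0 < t) :
    s * ∫ z in (0 : ℝ)..t, (t - z) ^ (-β) * z ^ (s - 1)
      = Real.Gamma (1 - β) * (caputoCoeff β s * t ^ (s - β)) := by
  rw [integral_rpow_mul_rpow (by linarith) (by linarith) ht, caputoCoeff, Real.Gamma_add_one hs.ne',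
    show -β + (s - 1) + 1 = s - β by ring, show -β + 1 = 1 - β by ring,
    show s - 1 + 1 = s by ring, show -β + (s - 1) + 2 = s + 1 - β by ring]
  ring

lemma rpow_sub_le_mul {T t s β : ℝ} (hT : 0 < T) (ht : 0 ≤ t) (htT : t ≤ T) (hs : β < s) :
    t ^ (s - β) ≤ T ^ (-β) * T ^ s := by
  rw [← Real.rpow_add hT, show -β + s = s - β by ring]
  exact Real.rpow_le_rpow ht htT (by linarith)

namespace IsExpansionFamily

variable {β T : ℝ} {l k : ℕ} {σ : ℕ → ℝ} {c : ℕ → ℝ → ℝ} {B : ℕ → ℝ}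

lemma caputoCoeff_nonneg (H : IsExpansionFamily β T l k σ c B) (hβ₀ : 0 < β) (hβ : β < 1) (j : ℕ) :
    0 ≤ caputoCoeff β (σ j) := gamma_div_gamma_nonneg hβ (hβ₀.trans (H.lt j))

lemma caputoCoeff_le (H : IsExpansionFamily β T l k σ c B) (hβ₀ : 0 < β) (hβ : β < 1) (hl : 1 ≤ l)
    (j : ℕ) : caputoCoeff β (σ j) ≤ Real.Gamma β * (1 + σ j) ^ l := by
  refine (gamma_div_gamma_le hβ₀ hβ (H.lt j)).trans ?_
  refine mul_le_mul_of_nonneg_left ?_ (Real.Gamma_pos_of_pos hβ₀).le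
  exact le_self_pow₀ (by have := H.lt j; linarith) (by omega)

lemma abs_caputo_le (H : IsExpansionFamily β T l k σ c B) (hβ₀ : 0 < β) (hβ : β < 1) (hl : 1 ≤ l)
    (hT : 0 < T) {t : ℝ} (ht : t ∈ Icc 0 T) (j : ℕ) :
    |caputoCoeff β (σ j) * t ^ (σ j - β)|
      ≤ Real.Gamma β * T ^ (-β) * ((1 + σ j) ^ l * T ^ σ j) := by
  have h1 := H.caputoCoeff_nonneg hβ₀ hβ j
  have h2 := H.caputoCoeff_le hβ₀ hβ hl j
  have h3 := rpow_sub_le_mul hT ht.1 ht.2 (H.lt j)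
  have h4 : 0 ≤ t ^ (σ j - β) := Real.rpow_nonneg ht.1 _
  rw [abs_of_nonneg (mul_nonneg h1 h4)]
  refine (mul_le_mul h2 h3 h4 (h1.trans h2)).trans (le_of_eq (by ring))

lemma hasSum_caputo (H : IsExpansionFamily β T l k σ c B) (hβ₀ : 0 < β) (hβ : β < 1) (hl : 1 ≤ l)
    (hT : 0 < T) {t x : ℝ} (ht : t ∈ Icc 0 T) (hx : x ∈ Icc (-1 : ℝ) 1) :
    HasSum (fun j => caputoCoeff β (σ j) * t ^ (σ j - β) * c j x) (caputoSeries β σ c t x) :=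
  (H.summable_series (H.abs_caputo_le hβ₀ hβ hl hT ht) hx).hasSum

lemma hasDerivAt (H : IsExpansionFamily β T l k σ c B) (hβ₀ : 0 < β) (hl : 1 ≤ l)
    (hT : 0 < T) {x a : ℝ} (hx : x ∈ Icc (-1 : ℝ) 1) {g : ℝ → ℝ}
    (hg : ∀ s ∈ Icc 0 T, HasSum (fun j => c j x * s ^ σ j) (g s - a)) {s : ℝ} (hs : s ∈ Ioo 0 T) :
    HasDerivAt g (∑' j, c j x * (σ j * s ^ (σ j - 1))) s := by
  have hs2 : 0 < s / 2 := by linarith [hs.1]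
  have hsub : ∀ y ∈ Ioo (s / 2) T, y ∈ Icc 0 T := fun y hy => ⟨by linarith [hy.1], hy.2.le⟩
  have hmem : s ∈ Ioo (s / 2) T := ⟨by linarith [hs.1], hs.2⟩
  -- On (s/2, T) one has y^(σ-1) ≤ (2/s) T^σ, so the assumed weighted sum dominates the
  -- differentiated series.
  set v : ℕ → ℝ := fun j => 5 * (2 / s) * ((1 + σ j) ^ l * T ^ σ j * B j) with hv
  have hvs : Summable v := H.summable.mul_left _
  have h1 := hasDerivAt_tsum_of_isPreconnected (g := fun j y => c j x * y ^ σ j)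
    (g' := fun j y => c j x * (σ j * y ^ (σ j - 1))) hvs isOpen_Ioo isPreconnected_Ioo
    (fun j y hy => (Real.hasDerivAt_rpow_const (Or.inl (by linarith [hy.1] : y ≠ 0))).const_mul _)
    (fun j y hy => ?_) hmem (hg s ⟨hs.1.le, hs.2.le⟩).summable hmem
  · refine (h1.const_add a).congr_of_eventuallyEq ?_
    filter_upwards [isOpen_Ioo.mem_nhds hmem] with y hy
    rw [(hg y (hsub y hy)).tsum_eq]
    ring
  · have hy0 : 0 < y := by linarith [hy.1]
    have hσ0 : 0 < σ j := hβ₀.trans (H.lt j)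
    have t1 : y ^ (σ j - 1) ≤ T ^ σ j * (2 / s) := by
      rw [Real.rpow_sub_one hy0.ne', div_eq_mul_inv]
      refine mul_le_mul (Real.rpow_le_rpow hy0.le hy.2.le hσ0.le) ?_ (by positivity) (by positivity)
      rw [inv_le_comm₀ hy0 (by have := hs.1; positivity), inv_div]
      exact hy.1.le
    have t2 : σ j ≤ (1 + σ j) ^ l :=
      (by linarith : σ j ≤ 1 + σ j).trans (le_self_pow₀ (by linarith) (by omega))
    have t3 : 0 ≤ y ^ (σ j - 1) := by positivity
    rw [norm_mul, Real.norm_eq_abs, Real.norm_eq_abs, abs_of_nonneg (mul_nonneg hσ0.le t3)]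
    have t4 := mul_le_mul (H.abs_le j hx) (mul_le_mul t2 t1 t3 (hσ0.le.trans t2))
      (mul_nonneg hσ0.le t3) (by have := H.nonneg j; positivity)
    refine t4.trans (le_of_eq ?_)
    simp only [hv]
    ring

/-- The Caputo derivative can be computed term by term. -/
lemma caputo_eq (H : IsExpansionFamily β T l k σ c B) (hβ₀ : 0 < β) (hβ : β < 1) (hl : 1 ≤ l)
    (hT : 0 < T) {x a : ℝ} (hx : x ∈ Icc (-1 : ℝ) 1) {g : ℝ → ℝ}
    (hg : ∀ s ∈ Icc 0 T, HasSum (fun j => c j x * s ^ σ j) (g s - a)) {t d : ℝ} (ht : t ∈ Ioo 0 T)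
    (hd : HasCaputoDerivAt β g t d) : d = caputoSeries β σ c t x := by
  obtain ⟨-, -, rfl⟩ := hd
  have hG := Real.Gamma_pos_of_pos (show 0 < 1 - β by linarith)
  have hσ0 : ∀ j, 0 < σ j := fun j => hβ₀.trans (H.lt j)
  set F : ℕ → ℝ → ℝ := fun j s => (t - s) ^ (-β) * (c j x * (σ j * s ^ (σ j - 1))) with hF
  have hF' : ∀ j, F j = fun s => (c j x * σ j) * ((t - s) ^ (-β) * s ^ (σ j - 1)) := fun j => by
    ext s; simp only [hF]; ring
  have hFi : ∀ j, Integrable (F j) (volume.restrict (Ioc 0 t)) := fun j => by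
    rw [hF']
    have := (intervalIntegrable_rpow_mul_rpow (a := -β) (b := σ j - 1) (t := t) (by linarith)
      (by linarith [hσ0 j]) ht.1).const_mul (c j x * σ j)
    rwa [intervalIntegrable_iff, uIoc_of_le ht.1.le] at this
  have hint : ∀ j, ∫ s in Ioc 0 t, F j s
      = c j x * (Real.Gamma (1 - β) * (caputoCoeff β (σ j) * t ^ (σ j - β))) := fun j => by
    rw [hF', ← intervalIntegral.integral_of_le ht.1.le, intervalIntegral.integral_const_mul, mul_assoc,
      mul_integral_caputo_kernel hβ (hσ0 j) ht.1]
  -- Each term has constant sign in s, so its L¹ norm has the same closed form as its integral; this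
  -- justifies the exchange of sum and integral.
  have hnorm : ∀ j, ∫ s in Ioc 0 t, ‖F j s‖
      = |c j x| * (Real.Gamma (1 - β) * (caputoCoeff β (σ j) * t ^ (σ j - β))) := fun j => by
    rw [← mul_integral_caputo_kernel hβ (hσ0 j) ht.1, ← mul_assoc,
      ← intervalIntegral.integral_const_mul, intervalIntegral.integral_of_le ht.1.le]
    refine setIntegral_congr_fun measurableSet_Ioc fun s hs => ?_
    simp only [hF']
    rw [Real.norm_eq_abs, abs_mul, abs_mul, abs_of_pos (hσ0 j), abs_of_nonneg (mul_nonneg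
      (Real.rpow_nonneg (by linarith [hs.2]) _) (Real.rpow_nonneg hs.1.le _))]
  have hsum : Summable fun j => ∫ s in Ioc 0 t, ‖F j s‖ := by
    have := (H.summable_series (H.abs_caputo_le hβ₀ hβ hl hT ⟨ht.1.le, ht.2.le⟩) hx).abs.mul_left
      (Real.Gamma (1 - β))
    refine this.congr fun j => ?_
    rw [hnorm, abs_mul, abs_of_nonneg (mul_nonneg (H.caputoCoeff_nonneg hβ₀ hβ j)
      (Real.rpow_nonneg ht.1.le _))]
    ring
  have h1 := hasSum_integral_of_summable_integral_norm hFi hsum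
  have h2 : ∫ s in (0 : ℝ)..t, (t - s) ^ (-β) * deriv g s = ∫ s in Ioc 0 t, ∑' j, F j s := by
    rw [← intervalIntegral.integral_of_le ht.1.le]
    refine intervalIntegral.integral_congr_uIoo fun s hs => ?_
    rw [uIoo_of_le ht.1.le] at hs
    simp only [hF]
    rw [(H.hasDerivAt hβ₀ hl hT hx hg ⟨hs.1, hs.2.trans ht.2⟩).deriv, tsum_mul_left]
  rw [h2, ← h1.tsum_eq, caputoSeries, ← tsum_mul_left]
  refine tsum_congr fun j => ?_
  rw [hint]
  field_simp

end IsExpansionFamily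


/-! ### The weak form on the closed time interval -/

/-- Continuity of a function of time with respect to uniform convergence on `[-1, 1]`. -/
structure IsUniformPath (T : ℝ) (w : ℝ → ℝ → ℝ) : Prop where
  continuousOn : ∀ t ∈ Icc 0 T, ContinuousOn (w t) (Icc (-1) 1)
  eventually : ∀ t ∈ Icc 0 T, ∀ ε > 0, ∀ᶠ s in 𝓝[Icc 0 T] t,
    ∀ x ∈ Icc (-1 : ℝ) 1, |w s x - w t x| ≤ ε

lemma IsUniformPath.memLp {T : ℝ} {w : ℝ → ℝ → ℝ} (h : IsUniformPath T w) {t : ℝ}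
    (ht : t ∈ Icc 0 T) : MemLp (w t) 2 volI := (h.continuousOn t ht).memLp_volI 2

lemma IsUniformPath.continuousOn_integral {T : ℝ} {w : ℝ → ℝ → ℝ} (h : IsUniformPath T w)
    (q : ℝ[X]) : ContinuousOn (fun t => ∫ x, w t x * q.eval x ∂volI) (Icc 0 T) := by
  intro t ht
  rw [ContinuousWithinAt, Metric.tendsto_nhds]
  intro ε hε
  set Q := normL2 fun x => q.eval x with hQ
  have hQ0 : 0 ≤ Q := normL2_nonneg _
  filter_upwards [h.eventually t ht (ε / (2 * Q + 1) / 2) (by positivity), self_mem_nhdsWithin]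
    with s hs hsT
  have h1 := normL2_le_of_bound (f := fun x => w s x - w t x) (by positivity)
    fun x hx => hs x (Ioo_subset_Icc_self hx)
  have h2 := abs_integral_mul_le ((h.memLp hsT).sub (h.memLp ht)) (memLp_eval q 2)
  have h3 : ∫ x, (w s - w t) x * q.eval x ∂volI
      = ∫ x, w s x * q.eval x ∂volI - ∫ x, w t x * q.eval x ∂volI := by
    rw [← integral_sub (integrable_mul (h.memLp hsT) (memLp_eval q 2))
      (integrable_mul (h.memLp ht) (memLp_eval q 2))]
    simp only [Pi.sub_apply, sub_mul]
  rw [h3] at h2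
  rw [Real.dist_eq]
  refine h2.trans_lt ?_
  refine (mul_le_mul_of_nonneg_right h1 hQ0).trans_lt ?_
  rw [show 2 * (ε / (2 * Q + 1) / 2) * Q = ε * (Q / (2 * Q + 1)) by ring]
  refine mul_lt_of_lt_one_right hε ?_
  rw [div_lt_one (by positivity)]
  linarith

lemma ContinuousInSobolev.isUniformPath {T m : ℝ} {w : ℝ → ℝ → ℝ} (hw : ContinuousInSobolev T m w)
    (hm : 1 ≤ ⌊m⌋₊) : IsUniformPath T w :=
  ⟨fun t ht => (hw.1 t ht).1, fun _ ht _ hε => hw.eventually_abs_sub_le hm ht hε⟩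

/-- The exponents σ_j - β are positive, so continuity holds up to t = 0. The increment is bounded,
uniformly in x, by a series R that converges uniformly in time and vanishes at t. -/
lemma IsExpansionFamily.isUniformPath_caputoSeries {β T : ℝ} {l k : ℕ} {σ : ℕ → ℝ} {c : ℕ → ℝ → ℝ}
    {B : ℕ → ℝ} (H : IsExpansionFamily β T l k σ c B) (hβ₀ : 0 < β) (hβ : β < 1) (hl : 1 ≤ l)
    (hT : 0 < T) : IsUniformPath T (caputoSeries β σ c) := by
  refine ⟨fun t ht => H.continuousOn_series (H.abs_caputo_le hβ₀ hβ hl hT ht)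
    fun x hx => H.hasSum_caputo hβ₀ hβ hl hT ht hx, fun t ht ε hε => ?_⟩
  set R : ℝ → ℝ := fun s => ∑' j, 5 * (|caputoCoeff β (σ j) * s ^ (σ j - β)
    - caputoCoeff β (σ j) * t ^ (σ j - β)| * B j) with hR
  have hbound : ∀ s ∈ Icc 0 T, ∀ j, |caputoCoeff β (σ j) * s ^ (σ j - β)
      - caputoCoeff β (σ j) * t ^ (σ j - β)|
        ≤ 2 * (Real.Gamma β * T ^ (-β)) * ((1 + σ j) ^ l * T ^ σ j) := fun s hs j => by
    have h1 := H.abs_caputo_le hβ₀ hβ hl hT hs j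
    have h2 := H.abs_caputo_le hβ₀ hβ hl hT ht j
    refine (abs_sub _ _).trans ((add_le_add h1 h2).trans (le_of_eq (by ring)))
  have hRc : ContinuousOn R (Icc 0 T) := by
    refine continuousOn_tsum (u := fun j => 5 * (2 * (Real.Gamma β * T ^ (-β))
      * ((1 + σ j) ^ l * T ^ σ j * B j))) (fun j => ?_) ((H.summable.mul_left _).mul_left _)
      fun j s hs => ?_
    · have : Continuous fun s : ℝ => s ^ (σ j - β) :=
        Real.continuous_rpow_const (by linarith [H.lt j])
      fun_prop
    · rw [Real.norm_of_nonneg (by have := H.nonneg j; positivity)]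
      have := mul_le_mul_of_nonneg_right (hbound s hs j) (H.nonneg j)
      linarith
  have hR0 : R t = 0 := by simp [hR]
  have h1 : ∀ᶠ s in 𝓝[Icc 0 T] t, R s < ε :=
    (hRc t ht).eventually_lt_const (by rw [hR0]; exact hε)
  filter_upwards [h1, self_mem_nhdsWithin] with s hs hsT x hx
  have h2 := (H.hasSum_caputo hβ₀ hβ hl hT hsT hx).sub (H.hasSum_caputo hβ₀ hβ hl hT ht hx)
  simp only [← sub_mul] at h2
  refine le_trans ?_ hs.le
  exact HasSum.norm_le_of_bounded h2 ((H.summable_mul (hbound s hsT)).mul_left 5).hasSum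
    fun j => H.norm_mul_le (fun j => caputoCoeff β (σ j) * s ^ (σ j - β)
      - caputoCoeff β (σ j) * t ^ (σ j - β)) j hx

/-- The equation is given on the open interval, while the scheme also involves t = 0 and t = T; both
sides are continuous on [0, T], so the identity extends to the closure. -/
lemma weak_form {β μ T m : ℝ} {l k : ℕ} {σ : ℕ → ℝ} {c : ℕ → ℝ → ℝ} {B : ℕ → ℝ}
    {u f : ℝ → ℝ → ℝ} {u₀ : ℝ → ℝ} (H : IsExpansionFamily β T l k σ c B) (hβ₀ : 0 < β) (hβ : β < 1)
    (hl : 1 ≤ l) (hT : 0 < T) (hm : 2 ≤ ⌊m⌋₊)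
    (hu : ContinuousInSobolev T m u) (hu_zero : ∀ t ∈ Icc 0 T, u t (-1) = 0 ∧ u t 1 = 0)
    (hf : ContinuousInSobolev T m f) (hsol : IsSolution β μ T f u₀ u)
    (hexp : ∀ t ∈ Icc 0 T, ∀ x ∈ Icc (-1 : ℝ) 1, HasSum (fun j => c j x * t ^ σ j) (u t x - u₀ x))
    {q : ℝ[X]} (hq1 : q.eval 1 = 0) (hq2 : q.eval (-1) = 0) {t : ℝ} (ht : t ∈ Icc 0 T) :
    ∫ x, caputoSeries β σ c t x * q.eval x ∂volI
      = μ * ∫ x, u t x * (derivative (derivative q)).eval x ∂volI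
        + ∫ x, f t x * q.eval x ∂volI := by
  have hF := H.isUniformPath_caputoSeries hβ₀ hβ hl hT
  have hu' := hu.isUniformPath (by omega)
  have hf' := hf.isUniformPath (by omega)
  refine EqOn.of_subset_closure (s := Ioo 0 T) (t := Icc 0 T)
    (f := fun t => ∫ x, caputoSeries β σ c t x * q.eval x ∂volI)
    (g := fun t => μ * ∫ x, u t x * (derivative (derivative q)).eval x ∂volI
      + ∫ x, f t x * q.eval x ∂volI) (fun t ht => ?_) (hF.continuousOn_integral q)
    (((hu'.continuousOn_integral _).const_mul μ).add (hf'.continuousOn_integral q))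
    Ioo_subset_Icc_self (closure_Ioo hT.ne).ge ht
  have htI : t ∈ Icc 0 T := Ioo_subset_Icc_self ht
  obtain ⟨w, hw, hweak, hae⟩ := hsol.equation t ht
  obtain ⟨B', hB'⟩ := hu.exists_bound hm
  obtain ⟨h, hc, h0⟩ := hB' t htI
  have hz := hu_zero t htI
  have e1 := integral_weakDeriv_two_mul (k := 0) hc (by rw [h0]; exact hz.2)
    (by rw [h0]; exact hz.1) hw (by rw [h0]; exact hweak) hq1 hq2
  rw [h0] at e1
  simp only
  rw [← e1, ← integral_const_mul, ← integral_add ((integrable_mul hw (memLp_eval q 2)).const_mul μ)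
    (integrable_mul (hf'.memLp htI) (memLp_eval q 2))]
  refine integral_congr_ae ?_
  filter_upwards [hae, ae_volI_mem] with x hx hxI
  have hxI' : x ∈ Icc (-1 : ℝ) 1 := Ioo_subset_Icc_self hxI
  rw [← H.caputo_eq hβ₀ hβ hl hT hxI' (fun s hs => hexp s hs x hxI') ht hx]
  ring

/-! ### Consistency of the time discretization -/

lemma averageWeight_mem {β : ℝ} (hβ₀ : 0 < β) (hβ : β < 1) (p : ℕ) :
    averageWeight β p ∈ Icc (0 : ℝ) 1 := by
  unfold averageWeight
  split_ifs
  · simp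
  · constructor <;> linarith

/-- Scaling by T makes the base τ/T at most 1, so exponents may be lowered to q without constants
depending on s beyond T^s. For s - β > p the product equals τ^p t_k^(s-β-p). -/
lemma rpow_mul_max_le {T τ s β q p : ℝ} {k : ℕ} (hT : 0 < T) (hτ : 0 < τ) (hk : 1 ≤ k)
    (hkT : k * τ ≤ T) (hq : q ≤ s - β) (hqp : q ≤ p) :
    τ ^ (s - β) * max 1 ((k : ℝ) ^ (s - β - p)) ≤ T ^ (-β) * T ^ s * (τ / T) ^ q := by
  have hk1 : (1 : ℝ) ≤ k := by exact_mod_cast hk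
  have hτT : τ ≤ T := by nlinarith
  have hx0 : 0 < τ / T := by positivity
  have hx1 : τ / T ≤ 1 := (div_le_one hT).2 hτT
  have e1 : T ^ (-β) * T ^ s = T ^ (s - β) := by rw [← Real.rpow_add hT]; congr 1; ring
  have hTs : 0 < T ^ (s - β) := by positivity
  rw [e1, mul_max_of_nonneg _ _ (by positivity), mul_one]
  refine max_le ?_ ?_
  · have : τ ^ (s - β) = T ^ (s - β) * (τ / T) ^ (s - β) := by
      rw [← Real.mul_rpow hT.le hx0.le, mul_div_cancel₀ _ hT.ne']
    rw [this]
    exact mul_le_mul_of_nonneg_left (Real.rpow_le_rpow_of_exponent_ge hx0 hx1 hq) hTs.le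
  · rcases le_or_gt (s - β) p with h | h
    · refine (mul_le_of_le_one_right (by positivity)
        (Real.rpow_le_one_of_one_le_of_nonpos hk1 (by linarith))).trans ?_
      have : τ ^ (s - β) = T ^ (s - β) * (τ / T) ^ (s - β) := by
        rw [← Real.mul_rpow hT.le hx0.le, mul_div_cancel₀ _ hT.ne']
      rw [this]
      exact mul_le_mul_of_nonneg_left (Real.rpow_le_rpow_of_exponent_ge hx0 hx1 hq) hTs.le
    · have e2 : τ ^ (s - β) * (k : ℝ) ^ (s - β - p) = τ ^ p * (k * τ) ^ (s - β - p) := by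
        rw [Real.mul_rpow (by linarith) hτ.le, mul_left_comm, ← Real.rpow_add hτ, mul_comm]
        congr 2; ring
      have e3 : T ^ (s - β) * (τ / T) ^ p = τ ^ p * T ^ (s - β - p) := by
        rw [Real.div_rpow hτ.le hT.le, Real.rpow_sub hT (s - β) p]
        ring
      rw [e2]
      calc τ ^ p * (k * τ) ^ (s - β - p) ≤ τ ^ p * T ^ (s - β - p) := by
            refine mul_le_mul_of_nonneg_left ?_ (by positivity)
            exact Real.rpow_le_rpow (by positivity) hkT (by linarith)
        _ = T ^ (s - β) * (τ / T) ^ p := e3.symm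
        _ ≤ T ^ (s - β) * (τ / T) ^ q :=
          mul_le_mul_of_nonneg_left (Real.rpow_le_rpow_of_exponent_ge hx0 hx1 hqp) hTs.le

/-- The discrete fractional derivative of `t ^ s` at `t_k`. -/
def powerDeriv (β τ s : ℝ) (k : ℕ) : ℝ :=
  1 / τ ^ β * ∑ i ∈ Finset.range (k + 1), cqWeight β (k - i) * (i * τ) ^ s

lemma powerDeriv_eq {β τ s : ℝ} {k : ℕ} (θ : ℝ) (hτ : 0 < τ) (hk : 1 ≤ k) :
    powerDeriv β τ s k = τ ^ (s - β) * powerDefect β θ k s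
      + (θ * (caputoCoeff β s * (k * τ) ^ (s - β))
        + (1 - θ) * (caputoCoeff β s * (((k : ℝ) - 1) * τ) ^ (s - β))) := by
  have hk1 : (1 : ℝ) ≤ k := by exact_mod_cast hk
  have e1 : ∑ i ∈ Finset.range (k + 1), cqWeight β (k - i) * (i * τ) ^ s
      = τ ^ s * ∑ i ∈ Finset.range (k + 1), cqWeight β (k - i) * (i : ℝ) ^ s := by
    rw [Finset.mul_sum]
    refine Finset.sum_congr rfl fun i _ => ?_
    rw [Real.mul_rpow (by positivity) hτ.le]
    ring
  rw [powerDeriv, e1, powerDefect, Real.mul_rpow (by linarith) hτ.le,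
    Real.mul_rpow (by linarith) hτ.le, Real.rpow_sub hτ, caputoCoeff]
  ring

lemma discreteFracDeriv_real (β τ : ℝ) (w : ℕ → ℝ) (k : ℕ) : discreteFracDeriv β τ w k
    = 1 / τ ^ β * ∑ j ∈ Finset.range (k + 1), cqWeight β (k - j) * (w j - w 0) := by
  simp [discreteFracDeriv]

/-! ### The discrete fractional derivative of the expansion -/

section

variable {β T τ : ℝ} {l k p n : ℕ} {σ : ℕ → ℝ} {c : ℕ → ℝ → ℝ} {B : ℕ → ℝ} {u : ℝ → ℝ → ℝ}
  {u₀ : ℝ → ℝ}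

lemma mul_mem_Icc_of_le (hτ : 0 < τ) (hnT : n * τ ≤ T) {i : ℕ} (hi : i ≤ n) :
    (i : ℝ) * τ ∈ Icc 0 T :=
  ⟨by positivity, (mul_le_mul_of_nonneg_right (by exact_mod_cast hi) hτ.le).trans hnT⟩

lemma IsExpansionFamily.initial_eq (H : IsExpansionFamily β T l k σ c B) (hβ₀ : 0 < β) (hT : 0 ≤ T)
    (hexp : ∀ t ∈ Icc 0 T, ∀ x ∈ Icc (-1 : ℝ) 1, HasSum (fun j => c j x * t ^ σ j) (u t x - u₀ x))
    {x : ℝ} (hx : x ∈ Icc (-1 : ℝ) 1) : u 0 x = u₀ x := by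
  have h1 := hexp 0 ⟨le_rfl, hT⟩ x hx
  have h2 : (fun j => c j x * (0 : ℝ) ^ σ j) = fun _ => 0 := by
    ext j
    rw [Real.zero_rpow (by linarith [H.lt j]), mul_zero]
  rw [h2] at h1
  exact sub_eq_zero.1 (h1.unique hasSum_zero)

lemma IsExpansionFamily.hasSum_discreteFracDeriv (H : IsExpansionFamily β T l k σ c B) (hβ₀ : 0 < β)
    (hτ : 0 < τ)
    (hexp : ∀ t ∈ Icc 0 T, ∀ x ∈ Icc (-1 : ℝ) 1, HasSum (fun j => c j x * t ^ σ j) (u t x - u₀ x))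
    (hnT : n * τ ≤ T) {x : ℝ} (hx : x ∈ Icc (-1 : ℝ) 1) :
    HasSum (fun j => powerDeriv β τ (σ j) n * c j x)
      (discreteFracDeriv β τ (fun i => u (i * τ) x) n) := by
  have hT : 0 ≤ T := (by positivity : 0 ≤ n * τ).trans hnT
  have h0 := H.initial_eq hβ₀ hT hexp hx
  have h1 : HasSum (fun j => 1 / τ ^ β * ∑ i ∈ Finset.range (n + 1), cqWeight β (n - i)
      * (c j x * (i * τ) ^ σ j)) (1 / τ ^ β * ∑ i ∈ Finset.range (n + 1), cqWeight β (n - i)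
      * (u (i * τ) x - u₀ x)) :=
    (hasSum_sum fun i hi => (hexp _ (mul_mem_Icc_of_le hτ hnT
      (Nat.lt_succ_iff.1 (Finset.mem_range.1 hi))) x hx).mul_left _).mul_left _
  rw [discreteFracDeriv_real]
  simp only [Nat.cast_zero, zero_mul, h0]
  refine h1.congr_fun fun j => ?_
  rw [powerDeriv, mul_assoc, Finset.sum_mul]
  congr 1
  exact Finset.sum_congr rfl fun i _ => by ring

end


/-- The first bound carries τ^q and serves the quadrature error. The second, without a power of τ,
makes D_τ u itself an admissible series, so that its projection error is of full order in N
uniformly in τ. -/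
lemma IsExpansionFamily.exists_abs_powerDeriv_le {β T q : ℝ} {k p : ℕ} {σ : ℕ → ℝ}
    {c : ℕ → ℝ → ℝ} {B : ℕ → ℝ} (H : IsExpansionFamily β T (p + 1) k σ c B) (hβ₀ : 0 < β)
    (hβ : β < 1) (hT : 0 < T) (hp : p = 1 ∨ p = 2) (hq0 : 0 ≤ q) (hq : ∀ j, q ≤ σ j - β)
    (hqp : q ≤ p) : ∃ C : ℝ, 0 ≤ C ∧ ∀ (τ : ℝ) (n : ℕ), 0 < τ → 1 ≤ n → n * τ ≤ T → ∀ j,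
      |τ ^ (σ j - β) * powerDefect β (averageWeight β p) n (σ j)|
        ≤ C * τ ^ q * ((1 + σ j) ^ (p + 1) * T ^ σ j) ∧
      |powerDeriv β τ (σ j) n| ≤ C * ((1 + σ j) ^ (p + 1) * T ^ σ j) := by
  obtain ⟨C, hC, h⟩ := exists_abs_powerDefect_le hβ₀ hβ hp
  have hG := Real.Gamma_pos_of_pos hβ₀
  have hp1 : 1 ≤ p + 1 := by omega
  set θ := averageWeight β p with hθ
  obtain ⟨hθ0, hθ1⟩ := averageWeight_mem hβ₀ hβ p
  rw [← hθ] at hθ0 hθ1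
  have hTβ : 0 < T ^ (-β) := by positivity
  have hTq : 0 < T ^ (-q) := by positivity
  refine ⟨C * T ^ (-β) * T ^ (-q) + C * T ^ (-β) + Real.Gamma β * T ^ (-β), by positivity,
    fun τ n hτ hn hnT j => ?_⟩
  have hn1 : (1 : ℝ) ≤ n := by exact_mod_cast hn
  have hτT : τ ≤ T := by nlinarith
  have hw : 0 ≤ (1 + σ j) ^ (p + 1) * T ^ σ j := by
    have := H.lt j
    have : 0 < 1 + σ j := by linarith
    positivity
  set w := (1 + σ j) ^ (p + 1) * T ^ σ j with hwdef
  have h1 := h n (σ j) hn (H.lt j)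
  have h2 := rpow_mul_max_le hT hτ hn hnT (hq j) hqp
  have hwl : 0 ≤ (1 + σ j) ^ (p + 1) := pow_nonneg (by linarith [H.lt j]) _
  have hτs : 0 < τ ^ (σ j - β) := by positivity
  have h3 : |τ ^ (σ j - β) * powerDefect β θ n (σ j)| ≤ C * T ^ (-β) * (τ / T) ^ q * w := by
    rw [abs_mul, abs_of_pos hτs]
    calc τ ^ (σ j - β) * |powerDefect β θ n (σ j)|
        ≤ τ ^ (σ j - β) * (C * (1 + σ j) ^ (p + 1) * max 1 ((n : ℝ) ^ (σ j - β - p))) :=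
          mul_le_mul_of_nonneg_left h1 hτs.le
      _ = C * (1 + σ j) ^ (p + 1) * (τ ^ (σ j - β) * max 1 ((n : ℝ) ^ (σ j - β - p))) := by ring
      _ ≤ C * (1 + σ j) ^ (p + 1) * (T ^ (-β) * T ^ σ j * (τ / T) ^ q) :=
          mul_le_mul_of_nonneg_left h2 (mul_nonneg hC hwl)
      _ = C * T ^ (-β) * (τ / T) ^ q * w := by rw [hwdef]; ring
  have e1 : (τ / T) ^ q = T ^ (-q) * τ ^ q := by
    rw [Real.div_rpow hτ.le hT.le, Real.rpow_neg hT.le]; ring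
  have hτq : 0 ≤ τ ^ q := by positivity
  constructor
  · refine h3.trans ?_
    rw [e1]
    refine mul_le_mul_of_nonneg_right ?_ hw
    have t1 : 0 ≤ (C * T ^ (-β) + Real.Gamma β * T ^ (-β)) * τ ^ q := by positivity
    nlinarith
  · have h4 : (τ / T) ^ q ≤ 1 :=
      Real.rpow_le_one (by positivity) ((div_le_one hT).2 hτT) hq0
    have h5 : C * T ^ (-β) * (τ / T) ^ q * w ≤ C * T ^ (-β) * w :=
      mul_le_mul_of_nonneg_right (mul_le_of_le_one_right (by positivity) h4) hw
    have hx : ∀ y ∈ Icc 0 T, |caputoCoeff β (σ j) * y ^ (σ j - β)| ≤ Real.Gamma β * T ^ (-β) * w :=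
      fun y hy => H.abs_caputo_le hβ₀ hβ hp1 hT hy j
    have h6 := hx (n * τ) ⟨by positivity, hnT⟩
    have h7 := hx (((n : ℝ) - 1) * τ) ⟨mul_nonneg (by linarith) hτ.le, by nlinarith⟩
    rw [powerDeriv_eq θ hτ hn]
    set X := caputoCoeff β (σ j) * (n * τ) ^ (σ j - β)
    set Y := caputoCoeff β (σ j) * (((n : ℝ) - 1) * τ) ^ (σ j - β)
    clear_value X Y
    have h8 : |θ * X + (1 - θ) * Y| ≤ Real.Gamma β * T ^ (-β) * w := by
      refine (abs_add_le _ _).trans ?_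
      rw [abs_mul, abs_mul, abs_of_nonneg hθ0, abs_of_nonneg (by linarith : 0 ≤ 1 - θ)]
      have t1 := mul_le_mul_of_nonneg_left h6 hθ0
      have t2 := mul_le_mul_of_nonneg_left h7 (by linarith : 0 ≤ 1 - θ)
      linarith
    refine (abs_add_le _ _).trans ?_
    have t1 : 0 ≤ C * T ^ (-β) * T ^ (-q) * w := by positivity
    linarith

lemma IsExpansionFamily.hasSum_residual {β T τ : ℝ} {l k p n : ℕ} {σ : ℕ → ℝ} {c : ℕ → ℝ → ℝ}
    {B : ℕ → ℝ} {u : ℝ → ℝ → ℝ} {u₀ : ℝ → ℝ} (H : IsExpansionFamily β T l k σ c B) (hβ₀ : 0 < β)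
    (hβ : β < 1) (hl : 1 ≤ l) (hτ : 0 < τ) (hT : 0 < T)
    (hexp : ∀ t ∈ Icc 0 T, ∀ x ∈ Icc (-1 : ℝ) 1, HasSum (fun j => c j x * t ^ σ j) (u t x - u₀ x))
    (hnT : ((n + 1 : ℕ) : ℝ) * τ ≤ T) {x : ℝ} (hx : x ∈ Icc (-1 : ℝ) 1) :
    HasSum (fun j => τ ^ (σ j - β) * powerDefect β (averageWeight β p) (n + 1) (σ j) * c j x)
      (discreteFracDeriv β τ (fun i => u (i * τ) x) (n + 1)
        - (averageWeight β p * caputoSeries β σ c ((n + 1 : ℕ) * τ) x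
          + (1 - averageWeight β p) * caputoSeries β σ c (n * τ) x)) := by
  have h1 := H.hasSum_discreteFracDeriv hβ₀ hτ hexp hnT hx
  have h2 := H.hasSum_caputo hβ₀ hβ hl hT (mul_mem_Icc_of_le hτ hnT le_rfl) hx
  have h3 := H.hasSum_caputo hβ₀ hβ hl hT (mul_mem_Icc_of_le hτ hnT (Nat.le_succ n)) hx
  refine (h1.sub ((h2.mul_left (averageWeight β p)).add
    (h3.mul_left (1 - averageWeight β p)))).congr_fun fun j => ?_
  rw [powerDeriv_eq (averageWeight β p) hτ (by omega : 1 ≤ n + 1)]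
  push_cast
  rw [add_sub_cancel_right]
  ring

/-! ### The error equation -/

lemma discreteFracDeriv_sub {E : Type*} [AddCommGroup E] [Module ℝ E] (β τ : ℝ) (v w : ℕ → E)
    (k : ℕ) : discreteFracDeriv β τ (fun j => v j - w j) k
      = discreteFracDeriv β τ v k - discreteFracDeriv β τ w k := by
  rw [discreteFracDeriv, discreteFracDeriv, discreteFracDeriv, ← smul_sub, ← Finset.sum_sub_distrib]
  congr 1
  refine Finset.sum_congr rfl fun j _ => ?_
  rw [← smul_sub]
  congr 1
  abel

lemma discreteFracDeriv_ellProj (β τ : ℝ) {w : ℕ → ℝ → ℝ} {k : ℕ} (N : ℕ)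
    (hw : ∀ j ≤ k, MemLp (w j) 2 volI) : discreteFracDeriv β τ (fun j => ellProj N (w j)) k
      = ellProj N (fun x => discreteFracDeriv β τ (fun j => w j x) k) := by
  simp only [discreteFracDeriv_real]
  have hj : ∀ j ∈ Finset.range (k + 1), MemLp (fun x => w j x - w 0 x) 2 volI := fun j hj =>
    (hw j (Nat.lt_succ_iff.1 (Finset.mem_range.1 hj))).sub (hw 0 (Nat.zero_le k))
  rw [ellProj_const_mul, ellProj_sum _ _ hj, discreteFracDeriv]
  congr 1
  refine Finset.sum_congr rfl fun j hj => ?_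
  rw [ellProj_sub (hw j (Nat.lt_succ_iff.1 (Finset.mem_range.1 hj))) (hw 0 (Nat.zero_le k))]

lemma derivative_mem_degreeLT {N : ℕ} {v : ℝ[X]} (hv : v.natDegree ≤ N) (hN : 1 ≤ N) :
    derivative v ∈ degreeLT ℝ N := by
  rw [mem_degreeLT]
  refine lt_of_le_of_lt degree_le_natDegree ?_
  have := natDegree_derivative_le v
  exact_mod_cast (by omega : (derivative v).natDegree < N)

lemma innerL2_derivative_ellProj_of_zero {N : ℕ} {w : ℝ → ℝ} {v : ℝ[X]} (hw : MemLp w 2 volI)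
    (h1 : w (-1) = 0) (h2 : w 1 = 0) (hN : 1 ≤ N) (hv : v ∈ galerkinSpace N) :
    innerL2 (derivative (ellProj N w)) (derivative v)
      = -∫ x, w x * (derivative (derivative v)).eval x ∂volI := by
  rw [innerL2_derivative_ellProj hw (derivative_mem_degreeLT hv.1 hN), h1, h2]
  ring

lemma natDegree_ellProj_le (N : ℕ) (v : ℝ → ℝ) : (ellProj N v).natDegree ≤ N := by
  have := ellProj_mem N v
  rw [mem_degreeLT] at this
  by_cases h : ellProj N v = 0
  · rw [h]; simp
  · rw [degree_eq_natDegree h] at this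
    exact Nat.lt_succ_iff.1 (by exact_mod_cast this)

lemma sub_mem_galerkinSpace {N : ℕ} {a b : ℝ[X]} (ha : a ∈ galerkinSpace N)
    (hb : b ∈ galerkinSpace N) : a - b ∈ galerkinSpace N :=
  ⟨(natDegree_sub_le _ _).trans (max_le ha.1 hb.1), by simp [ha.2.1, hb.2.1],
    by simp [ha.2.2, hb.2.2]⟩

lemma ellProj_mem_galerkinSpace {N : ℕ} {w : ℝ → ℝ} (hw : MemLp w 2 volI) (hN : 1 ≤ N)
    (h1 : w (-1) = 0) (h2 : w 1 = 0) : ellProj N w ∈ galerkinSpace N :=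
  ⟨natDegree_ellProj_le N w, by rw [eval_neg_one_ellProj, h1], by rw [eval_one_ellProj hw hN, h2]⟩

lemma lglInterp_mem_galerkinSpace {N : ℕ} {w : ℝ → ℝ} (hN : 1 ≤ N)
    (h1 : w (-1) = 0) (h2 : w 1 = 0) : lglInterp N w ∈ galerkinSpace N :=
  ⟨natDegree_lglInterp_le hN w, by rw [eval_lglInterp ((mem_lglNodes hN).2 (by simp)), h1],
    by rw [eval_lglInterp ((mem_lglNodes hN).2 (by simp)), h2]⟩

/-- The residual of the projected solution in the scheme, tested with `v`. -/
lemma abs_residual_le {β μ τ M₁ M₂ M₃ : ℝ} {p N n : ℕ} {w F f : ℕ → ℝ → ℝ} {U : ℕ → ℝ[X]} {v : ℝ[X]}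
    (hN : 1 ≤ N) (hv : v ∈ galerkinSpace N) (hw : ∀ j ≤ n + 1, MemLp (w j) 2 volI)
    (hF : ∀ j ≤ n + 1, MemLp (F j) 2 volI) (hf : ∀ j ≤ n + 1, MemLp (f j) 2 volI)
    (hw0 : ∀ j ≤ n + 1, w j (-1) = 0 ∧ w j 1 = 0)
    (hweak : ∀ j ≤ n + 1, ∫ x, F j x * v.eval x ∂volI
      = μ * ∫ x, w j x * (derivative (derivative v)).eval x ∂volI + ∫ x, f j x * v.eval x ∂volI)
    (hU : innerL2 (discreteFracDeriv β τ U (n + 1)) v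
      + μ * innerL2 (timeAverage β p (fun j => derivative (U j)) (n + 1)) (derivative v)
      = innerL2 (lglInterp N (timeAverage β p f (n + 1))) v)
    (h₁ : normL2 (fun x => discreteFracDeriv β τ (fun j => w j x) (n + 1)
      - (ellProj N (fun x => discreteFracDeriv β τ (fun j => w j x) (n + 1))).eval x) ≤ M₁)
    (h₂ : normL2 (fun x => discreteFracDeriv β τ (fun j => w j x) (n + 1)
      - (averageWeight β p * F (n + 1) x + (1 - averageWeight β p) * F n x)) ≤ M₂)
    (h₃ : normL2 (fun x => timeAverage β p f (n + 1) x
      - (lglInterp N (timeAverage β p f (n + 1))).eval x) ≤ M₃) :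
    |innerL2 (discreteFracDeriv β τ (fun j => ellProj N (w j) - U j) (n + 1)) v
      + μ * innerL2 (timeAverage β p (fun j => derivative (ellProj N (w j) - U j)) (n + 1))
        (derivative v)| ≤ (M₁ + M₂ + M₃) * normL2 (fun x => v.eval x) := by
  set θ := averageWeight β p
  set h : ℝ → ℝ := fun x => discreteFracDeriv β τ (fun j => w j x) (n + 1) with hh
  set A : ℝ → ℝ := fun x => θ * F (n + 1) x + (1 - θ) * F n x with hA
  set G : ℝ → ℝ := timeAverage β p f (n + 1) with hG
  have hGx : G = fun x => θ * f (n + 1) x + (1 - θ) * f n x := by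
    rw [hG, timeAverage_eq]; rfl
  have hhm : MemLp h 2 volI := by
    have h1 : ∀ j ∈ Finset.range (n + 1 + 1),
        MemLp (fun x => cqWeight β (n + 1 - j) * (w j x - w 0 x)) 2 volI := fun j hj =>
      ((hw j (Nat.lt_succ_iff.1 (Finset.mem_range.1 hj))).sub (hw 0 (Nat.zero_le _))).const_mul _
    simp only [hh, discreteFracDeriv_real]
    exact (memLp_finsetSum _ h1).const_mul _
  have hAm : MemLp A 2 volI :=
    ((hF (n + 1) le_rfl).const_mul θ).add ((hF n (Nat.le_succ n)).const_mul (1 - θ))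
  have hGm : MemLp G 2 volI := by
    rw [hGx]
    exact ((hf (n + 1) le_rfl).const_mul θ).add ((hf n (Nat.le_succ n)).const_mul (1 - θ))
  have hvm := memLp_eval v 2
  have i : ∀ {a : ℝ → ℝ}, MemLp a 2 volI → Integrable (fun x => a x * v.eval x) volI :=
    fun ha => integrable_mul ha hvm
  have comb : ∀ {a b : ℝ → ℝ}, MemLp a 2 volI → MemLp b 2 volI →
      ∫ x, (θ * a x + (1 - θ) * b x) * v.eval x ∂volI
        = θ * ∫ x, a x * v.eval x ∂volI + (1 - θ) * ∫ x, b x * v.eval x ∂volI := by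
    intro a b ha hb
    rw [← integral_const_mul, ← integral_const_mul, ← integral_add ((i ha).const_mul θ)
      ((i hb).const_mul (1 - θ))]
    congr 1; ext x; ring
  have e1 : innerL2 (discreteFracDeriv β τ (fun j => ellProj N (w j) - U j) (n + 1)) v
      = ∫ x, (ellProj N h).eval x * v.eval x ∂volI
        - innerL2 (discreteFracDeriv β τ U (n + 1)) v := by
    rw [discreteFracDeriv_sub, innerL2_sub_left, discreteFracDeriv_ellProj β τ N hw]
    rfl
  -- The projection turns the diffusion term into an integral of w against v'', and the weak form
  -- trades this for the Caputo derivative and the source: no elliptic error is left.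
  have e2 : μ * innerL2 (timeAverage β p (fun j => derivative (ellProj N (w j) - U j)) (n + 1))
        (derivative v)
      = -∫ x, A x * v.eval x ∂volI + ∫ x, G x * v.eval x ∂volI
        - μ * innerL2 (timeAverage β p (fun j => derivative (U j)) (n + 1)) (derivative v) := by
    have t1 := innerL2_derivative_ellProj_of_zero (hw (n + 1) le_rfl) (hw0 (n + 1) le_rfl).1
      (hw0 (n + 1) le_rfl).2 hN hv
    have t2 := innerL2_derivative_ellProj_of_zero (hw n (Nat.le_succ n)) (hw0 n (Nat.le_succ n)).1
      (hw0 n (Nat.le_succ n)).2 hN hv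
    rw [hGx, comb (hf (n + 1) le_rfl) (hf n (Nat.le_succ n)),
      comb (hF (n + 1) le_rfl) (hF n (Nat.le_succ n)), hweak (n + 1) le_rfl, hweak n (Nat.le_succ n)]
    simp only [timeAverage_eq, derivative_sub, smul_sub, innerL2_add_left, innerL2_sub_left,
      innerL2_smul_left, t1, t2]
    ring
  have e3 : ∫ x, (ellProj N h).eval x * v.eval x ∂volI + (-∫ x, A x * v.eval x ∂volI
        + ∫ x, G x * v.eval x ∂volI) - innerL2 (lglInterp N G) v
      = ∫ x, ((h x - A x) - (h x - (ellProj N h).eval x) + (G x - (lglInterp N G).eval x))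
          * v.eval x ∂volI := by
    have t1 : ∫ x, ((h x - A x) - (h x - (ellProj N h).eval x) + (G x - (lglInterp N G).eval x))
          * v.eval x ∂volI = ∫ x, ((ellProj N h).eval x * v.eval x - A x * v.eval x
            + (G x * v.eval x - (lglInterp N G).eval x * v.eval x)) ∂volI := by
      congr 1; ext x; ring
    have i₁ : Integrable (fun x => (ellProj N h).eval x * v.eval x - A x * v.eval x) volI :=
      (i (memLp_eval _ 2)).sub (i hAm)
    have i₂ : Integrable (fun x => G x * v.eval x - (lglInterp N G).eval x * v.eval x) volI :=
      (i hGm).sub (i (memLp_eval _ 2))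
    rw [t1, integral_add i₁ i₂,
      integral_sub (i (memLp_eval _ 2)) (i hAm), integral_sub (i hGm) (i (memLp_eval _ 2)), innerL2]
    ring
  rw [e1, e2]
  have e4 : ∀ a b c d e : ℝ, a - b + (c + d - e) = a + (c + d) - (b + e) := fun a b c d e => by ring
  rw [e4, hU, e3]
  have m1 : MemLp (fun x => h x - A x) 2 volI := hhm.sub hAm
  have m2 : MemLp (fun x => h x - (ellProj N h).eval x) 2 volI := hhm.sub (memLp_eval _ 2)
  have m3 : MemLp (fun x => G x - (lglInterp N G).eval x) 2 volI := hGm.sub (memLp_eval _ 2)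
  refine (abs_integral_mul_le ((m1.sub m2).add m3) hvm).trans ?_
  refine mul_le_mul_of_nonneg_right ?_ (normL2_nonneg _)
  have t1 := normL2_add_le (m1.sub m2) m3
  have t2 := normL2_sub_le m1 m2
  refine t1.trans ((add_le_add (t2.trans (add_le_add h₂ h₁)) h₃).trans (le_of_eq (by ring)))


/-! ### The error estimate -/

lemma le_inv_pow_mul {C x : ℝ} {N k : ℕ} (hN : 1 ≤ N) (h : (N : ℝ) ^ k * x ≤ C) :
    x ≤ C * ((N : ℝ) ^ k)⁻¹ := by
  have hN0 : (0 : ℝ) < (N : ℝ) ^ k := by positivity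
  rw [← div_eq_mul_inv, le_div_iff₀ hN0]
  linarith

lemma SobChain.exists_timeAverage {β B : ℝ} {k p n : ℕ} {f : ℕ → ℝ → ℝ} (hβ₀ : 0 < β) (hβ : β < 1)
    (h₁ : ∃ h, SobChain k h B ∧ h 0 = f (n + 1)) (h₂ : ∃ h, SobChain k h B ∧ h 0 = f n) :
    ∃ h, SobChain k h B ∧ h 0 = timeAverage β p f (n + 1) := by
  obtain ⟨g₁, c₁, e₁⟩ := h₁
  obtain ⟨g₂, c₂, e₂⟩ := h₂
  obtain ⟨hθ0, hθ1⟩ := averageWeight_mem hβ₀ hβ p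
  refine ⟨_, ((c₁.const_mul (averageWeight β p)).add
    (c₂.const_mul (1 - averageWeight β p))).mono (le_of_eq ?_), ?_⟩
  · rw [abs_of_nonneg hθ0, abs_of_nonneg (by linarith)]; ring
  · rw [timeAverage_eq, ← e₁, ← e₂]
    rfl

set_option maxHeartbeats 1000000 in
theorem galerkin_error_estimate (β μ T r m : ℝ) (p : ℕ) (σ : ℕ → ℝ) (c : ℕ → ℝ → ℝ)
    (u f : ℝ → ℝ → ℝ) (u₀ : ℝ → ℝ)
    (hβ₀ : 0 < β) (hβ₁ : β < 1) (hμ : 0 < μ) (hT : 0 < T) (hp : p = 1 ∨ p = 2)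
    (hr : 1 ≤ r) (hm : r + 1 ≤ m)
    (hu : ContinuousInSobolev T m u)
    (hu_zero : ∀ t ∈ Set.Icc 0 T, u t (-1) = 0 ∧ u t 1 = 0)
    (hf : ContinuousInSobolev T m f)
    (hu₀ : MemSobolev m u₀)
    (hsol : IsSolution β μ T f u₀ u)
    (hσ : β < σ 0)
    (hexp : HasTimeExpansion T m (p + 1) u₀ u σ c) :
    ∃ C : ℝ, 0 < C ∧ ∀ N nT : ℕ, 1 ≤ N → 1 ≤ nT → ∀ τ : ℝ, τ = T / nT →
      ∀ U : ℕ → ℝ[X], IsGalerkinSolution β μ f u₀ p N nT τ U →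
        ∀ k : ℕ, 1 ≤ k → k ≤ nT →
          normL2 (fun x => u (k * τ) x - (U k).eval x)
            ≤ C * (τ ^ min (σ 0 - β) (p : ℝ) + (N : ℝ) ^ (-r)) := by
  have hm2 : 2 ≤ ⌊m⌋₊ := Nat.le_floor (by push_cast; linarith)
  -- Integer orders suffice: r ≤ m - 1 < ⌊m⌋ = κ + 1.
  obtain ⟨κ, hκ⟩ : ∃ κ, ⌊m⌋₊ = κ + 1 := ⟨⌊m⌋₊ - 1, by omega⟩
  have hrκ : r ≤ ((κ + 1 : ℕ) : ℝ) := by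
    have := Nat.lt_floor_add_one m
    rw [hκ] at this
    linarith
  have hp1 : 1 ≤ p + 1 := by omega
  have hp1' : (1 : ℝ) ≤ p := by rcases hp with rfl | rfl <;> norm_num
  obtain ⟨B, H⟩ := hexp.exists_isExpansionFamily hβ₀ hT hσ hκ.ge
  set S := ∑' j, (1 + σ j) ^ (p + 1) * T ^ σ j * B j with hS
  have hS0 : 0 ≤ S := tsum_nonneg fun j => by
    have := H.lt j
    have h1 : 0 ≤ (1 + σ j) ^ (p + 1) := pow_nonneg (by linarith) _
    have := H.nonneg j
    positivity
  set q := min (σ 0 - β) (p : ℝ) with hq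
  have hq0 : 0 ≤ q := le_min (by linarith) (by linarith)
  obtain ⟨C₁, hC₁, hδ⟩ := H.exists_abs_powerDeriv_le hβ₀ hβ₁ hT hp hq0
    (fun j => (min_le_left _ _).trans (sub_le_sub_right (hexp.strictMono.monotone (Nat.zero_le j)) β))
    (min_le_right _ _)
  obtain ⟨C₂, hC₂, hproj⟩ := exists_ellProj_series_error_le κ
  obtain ⟨C₃, hC₃, hlgl⟩ := exists_lglInterp_error_le κ
  obtain ⟨C₄, hC₄, hell⟩ := exists_ellProj_error_le κ
  obtain ⟨Bu, hBu⟩ := hu.exists_bound hκ.ge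
  obtain ⟨Bf, hBf⟩ := hf.exists_bound hκ.ge
  obtain ⟨g₀, hg₀, hg₀'⟩ := exists_sobChain hκ.ge hu₀.1 (B := (sobolevNorm m u₀).toReal + 1)
    ((ENNReal.lt_ofReal_iff_toReal_lt hu₀.2.ne).2 (by linarith))
  set B₀ := (sobolevNorm m u₀).toReal + 1
  have hB₀ := hg₀.nonneg
  have h0T : (0 : ℝ) ∈ Icc 0 T := ⟨le_rfl, hT.le⟩
  have hBu0 : 0 ≤ Bu := by obtain ⟨g, hg, -⟩ := hBu 0 h0T; exact hg.nonneg
  have hBf0 : 0 ≤ Bf := by obtain ⟨g, hg, -⟩ := hBf 0 h0T; exact hg.nonneg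
  have hinit : ∀ x ∈ Icc (-1 : ℝ) 1, u 0 x = u₀ x := fun x hx =>
    H.initial_eq hβ₀ hT.le hexp.expansion hx
  have hpu := hu.isUniformPath (by omega : 1 ≤ ⌊m⌋₊)
  have hpf := hf.isUniformPath (by omega : 1 ≤ ⌊m⌋₊)
  have hpF := H.isUniformPath_caputoSeries hβ₀ hβ₁ hp1 hT
  -- Chosen so that 16 M² t_k^β / μ ≤ (4 M K)² for all t_k ≤ T.
  set K := Real.sqrt (T ^ β / μ) with hK
  have hK0 : 0 ≤ K := Real.sqrt_nonneg _
  refine ⟨2 * (C₄ * Bu) + C₃ * B₀ + 4 * K * (C₂ * (C₁ * S) + 2 * (5 * (C₁ * S)) + C₃ * Bf) + 1,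
    by positivity, fun N nT hN hnT τ hτT U hU k hk hkn => ?_⟩
  have hnT0 : (0 : ℝ) < nT := by exact_mod_cast hnT
  have hτ : 0 < τ := by rw [hτT]; positivity
  have hnτ : nT * τ = T := by rw [hτT]; field_simp
  have hmem : ∀ j ≤ nT, (j : ℝ) * τ ∈ Icc 0 T := fun j hj => mul_mem_Icc_of_le hτ hnτ.le hj
  set ρ := ((N : ℝ) ^ (κ + 1))⁻¹ with hρ
  have hρ0 : 0 ≤ ρ := by positivity
  have hτq : 0 ≤ τ ^ q := by positivity
  have hPu : ∀ j ≤ nT, normL2 (fun x => u (j * τ) x - (ellProj N (u (j * τ))).eval x)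
      ≤ C₄ * Bu * ρ := fun j hj => by
    obtain ⟨g, hg, g0⟩ := hBu _ (hmem j hj)
    rw [← g0]
    exact le_inv_pow_mul hN (hell g Bu N hg hN).2
  set e : ℕ → ℝ[X] := fun j => ellProj N (u (j * τ)) - U j with he
  set M := C₂ * (C₁ * S) * ρ + 2 * (5 * (C₁ * τ ^ q * S)) + C₃ * Bf * ρ with hM
  have hM0 : 0 ≤ M := by positivity
  -- The scheme does not require it, but the starting value lies in V_N^0: u_0 = u(0) vanishes at
  -- ±1, and both endpoints are Lobatto nodes.
  have hU0 : U 0 ∈ galerkinSpace N := by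
    rw [hU.initial]
    exact lglInterp_mem_galerkinSpace hN
      ((hinit _ neg_one_mem_Icc).symm.trans (hu_zero 0 h0T).1)
      ((hinit _ one_mem_Icc).symm.trans (hu_zero 0 h0T).2)
  have heV : ∀ j ≤ nT, e j ∈ galerkinSpace N := fun j hj => by
    refine sub_mem_galerkinSpace (ellProj_mem_galerkinSpace (hpu.memLp (hmem j hj)) hN
      (hu_zero _ (hmem j hj)).1 (hu_zero _ (hmem j hj)).2) ?_
    rcases Nat.eq_zero_or_pos j with rfl | hj0
    · exact hU0
    · exact hU.mem j hj0 hj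
  have hres : ∀ j, 1 ≤ j → j ≤ nT → ∀ v ∈ galerkinSpace N,
      |innerL2 (discreteFracDeriv β τ e j) v
        + μ * innerL2 (timeAverage β p (fun i => derivative (e i)) j) (derivative v)|
      ≤ M * normL2 (fun x => v.eval x) := by
    intro j hj hjn v hv
    obtain ⟨n, rfl⟩ : ∃ n, j = n + 1 := ⟨j - 1, by omega⟩
    have hle : ∀ i ≤ n + 1, (i : ℝ) * τ ∈ Icc 0 T := fun i hi => hmem i (hi.trans hjn)
    have hnT' : ((n + 1 : ℕ) : ℝ) * τ ≤ T := (hle _ le_rfl).2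
    refine abs_residual_le (w := fun i => u (i * τ)) (F := fun i => caputoSeries β σ c (i * τ))
      (f := fun i => f (i * τ)) hN hv (fun i hi => hpu.memLp (hle i hi))
      (fun i hi => hpF.memLp (hle i hi)) (fun i hi => hpf.memLp (hle i hi))
      (fun i hi => hu_zero _ (hle i hi))
      (fun i hi => weak_form H hβ₀ hβ₁ hp1 hT hm2 hu hu_zero hf hsol hexp.expansion hv.2.2 hv.2.1
        (hle i hi)) (hU.equation (n + 1) hj hjn v hv) ?_ ?_ ?_
    · exact le_inv_pow_mul hN (hproj H _ C₁ _ N (fun i => (hδ τ (n + 1) hτ hj hnT' i).2)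
        (fun x hx => H.hasSum_discreteFracDeriv hβ₀ hτ hexp.expansion hnT' hx) hN)
    · refine normL2_le_of_bound (by positivity) fun x hx => ?_
      have hx' := Ioo_subset_Icc_self hx
      exact (H.abs_series_le (fun i => (hδ τ (n + 1) hτ hj hnT' i).1) hx'
        (H.hasSum_residual (p := p) hβ₀ hβ₁ hp1 hτ hT hexp.expansion hnT' hx')).trans le_rfl
    · obtain ⟨g, hg, g0⟩ := SobChain.exists_timeAverage (p := p) (f := fun i => f (i * τ)) hβ₀ hβ₁
        (hBf _ (hle (n + 1) le_rfl)) (hBf _ (hle n (Nat.le_succ n)))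
      rw [← g0]
      exact le_inv_pow_mul hN (hlgl g Bf N hg hN)
  have hstab := galerkin_stability hβ₀ hβ₁ hμ hτ heV hres hM0 hk hkn
  have he0 : normL2 (fun x => (e 0).eval x) ≤ C₄ * Bu * ρ + C₃ * B₀ * ρ := by
    have h1 := hPu 0 (Nat.zero_le _)
    have h2 : normL2 (fun x => u₀ x - (lglInterp N u₀).eval x) ≤ C₃ * B₀ * ρ := by
      rw [← hg₀']
      exact le_inv_pow_mul hN (hlgl g₀ B₀ N hg₀ hN)
    -- Both starting values are compared with u_0, one through interpolation and the other through
    -- Π.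
    have h3 : normL2 (fun x => (e 0).eval x) = normL2 (fun x => (u₀ x - (lglInterp N u₀).eval x)
        - (u ((0 : ℕ) * τ) x - (ellProj N (u ((0 : ℕ) * τ))).eval x)) := by
      refine normL2_congr_Icc fun x hx => ?_
      simp only [he, eval_sub, hU.initial, Nat.cast_zero, zero_mul, hinit x hx]
      ring
    rw [h3]
    refine (normL2_sub_le ((hu₀.1.memLp_volI 2).sub (memLp_eval _ 2))
      ((hpu.memLp (hmem 0 (Nat.zero_le _))).sub (memLp_eval _ 2))).trans ?_
    exact (add_le_add h2 h1).trans (le_of_eq (by ring))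
  have hek : normL2 (fun x => (e k).eval x) ≤ normL2 (fun x => (e 0).eval x) + 4 * M * K := by
    refine abs_le_of_sq_le_sq' (hstab.trans ?_)
      (by have := normL2_nonneg fun x => (e 0).eval x; positivity) |>.2
    have h1 : (k * τ) ^ β ≤ T ^ β := Real.rpow_le_rpow (hmem k hkn).1 (hmem k hkn).2 hβ₀.le
    have h2 : K ^ 2 = T ^ β / μ := Real.sq_sqrt (by positivity)
    have h3 : 16 * M ^ 2 / μ * (k * τ) ^ β ≤ 16 * M ^ 2 / μ * T ^ β :=
      mul_le_mul_of_nonneg_left h1 (by positivity)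
    have h4 : 16 * M ^ 2 / μ * T ^ β = (4 * M * K) ^ 2 := by
      rw [mul_pow, h2]; ring
    have h5 : 0 ≤ normL2 (fun x => (e 0).eval x) * (4 * M * K) :=
      mul_nonneg (normL2_nonneg _) (by positivity)
    rw [add_sq (normL2 fun x => (e 0).eval x) (4 * M * K), ← h4]
    linarith
  have hfin : normL2 (fun x => u (k * τ) x - (U k).eval x)
      ≤ C₄ * Bu * ρ + normL2 (fun x => (e k).eval x) := by
    have h1 : ∀ x, u (k * τ) x - (U k).eval x
        = (u (k * τ) x - (ellProj N (u (k * τ))).eval x) + (e k).eval x := fun x => by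
      simp only [he, eval_sub]; ring
    simp only [h1]
    exact (normL2_add_le ((hpu.memLp (hmem k hkn)).sub (memLp_eval _ 2)) (memLp_eval _ 2)).trans
      (add_le_add (hPu k hkn) le_rfl)
  have hρr : ρ ≤ (N : ℝ) ^ (-r) := by
    have hN1 : (1 : ℝ) ≤ N := by exact_mod_cast hN
    rw [hρ, ← Real.rpow_natCast, ← Real.rpow_neg (by linarith)]
    exact Real.rpow_le_rpow_of_exponent_le hN1 (by linarith)
  have hNr : 0 ≤ (N : ℝ) ^ (-r) := hρ0.trans hρr
  set A := 2 * (C₄ * Bu) + C₃ * B₀ + 4 * K * (C₂ * (C₁ * S) + C₃ * Bf) with hA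
  set D := 4 * K * (2 * (5 * (C₁ * S))) with hD
  have hA0 : 0 ≤ A := by positivity
  have hD0 : 0 ≤ D := by positivity
  have h1 : normL2 (fun x => u (k * τ) x - (U k).eval x) ≤ A * ρ + D * τ ^ q := by
    have : C₄ * Bu * ρ + (C₄ * Bu * ρ + C₃ * B₀ * ρ + 4 * M * K) = A * ρ + D * τ ^ q := by
      rw [hM, hA, hD]; ring
    linarith
  have h2 : A * ρ ≤ A * (N : ℝ) ^ (-r) := mul_le_mul_of_nonneg_left hρr hA0
  have h3 : 2 * (C₄ * Bu) + C₃ * B₀ + 4 * K * (C₂ * (C₁ * S) + 2 * (5 * (C₁ * S)) + C₃ * Bf) + 1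
      = A + D + 1 := by rw [hA, hD]; ring
  rw [h3]
  have h4 : 0 ≤ A * τ ^ q := by positivity
  have h5 : 0 ≤ D * (N : ℝ) ^ (-r) := by positivity
  have h6 : (A + D + 1) * (τ ^ q + (N : ℝ) ^ (-r)) = A * (N : ℝ) ^ (-r) + D * τ ^ q
      + (A * τ ^ q + D * (N : ℝ) ^ (-r)) + (τ ^ q + (N : ℝ) ^ (-r)) := by ring
  have h7 : 0 ≤ τ ^ q := by positivity
  rw [h6]
  linarith

end Subdiffusion

end

theorem theorem2p3 (β μ T r m : ℝ) (p : ℕ) (σ : ℕ → ℝ) (c : ℕ → ℝ → ℝ)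
    (u f : ℝ → ℝ → ℝ) (u₀ : ℝ → ℝ)
    (hβ₀ : 0 < β) (hβ₁ : β < 1) (hμ : 0 < μ) (hT : 0 < T) (hp : p = 1 ∨ p = 2)
    (hr : 1 ≤ r) (hm : r + 1 ≤ m)
    (hu : Subdiffusion.ContinuousInSobolev T m u)
    (hu_zero : ∀ t ∈ Set.Icc 0 T, u t (-1) = 0 ∧ u t 1 = 0)
    (hf : Subdiffusion.ContinuousInSobolev T m f)
    (hu₀ : Subdiffusion.MemSobolev m u₀)
    (hsol : Subdiffusion.IsSolution β μ T f u₀ u)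
    (hσ : β < σ 0)
    (hexp : Subdiffusion.HasTimeExpansion T m (p + 1) u₀ u σ c) :
    ∃ C : ℝ, 0 < C ∧ ∀ N nT : ℕ, 1 ≤ N → 1 ≤ nT → ∀ τ : ℝ, τ = T / nT →
      ∀ U : ℕ → Polynomial ℝ, Subdiffusion.IsGalerkinSolution β μ f u₀ p N nT τ U →
        ∀ k : ℕ, 1 ≤ k → k ≤ nT →
          Subdiffusion.normL2 (fun x => u (k * τ) x - (U k).eval x)
            ≤ C * (τ ^ min (σ 0 - β) (p : ℝ) + (N : ℝ) ^ (-r)) := by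
  exact Subdiffusion.galerkin_error_estimate β μ T r m p σ c u f u₀ hβ₀ hβ₁ hμ hT hp hr hm hu
    hu_zero hf hu₀ hsol hσ hexp
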